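/- Let $\lambda,\mu\in C^1([-1,1])$ be positive, let $b,c\in C([-1,1])$, and suppose that $\lambda(w)=\mu(-w)$ for all $w\in[-1,1]$. Consider the system $$u_t+\lambda(w)u_w=b(w)v,\qquad v_t-\mu(w)v_w=c(w)u,\qquad w\in(-1,1),\ t>0,$$ $$u(-1,t)=U_1(t),\qquad v(1,t)=U_2(t),\qquad u(\cdot,0)=u_0,\quad v(\cdot,0)=v_0 .$$ Let $E=\{(z,w): |z|\le |w|\le 1\}$. The kernel equations $$\lambda(w)L^{11}_w+\lambda(z)L^{11}_z=-\lambda'(z)L^{11}-c(z)L^{12},\qquad \lambda(w)L^{12}_w-\mu(z)L^{12}_z=-b(z)L^{11}+\mu'(z)L^{12},$$ $$\mu(w)L^{22}_w+\mu(z)L^{22}_z=b(z)L^{21}-\mu'(z)L^{22},\qquad \mu(w)L^{21}_w-\lambda(z)L^{21}_z=\lambda'(z)L^{21}+c(z)L^{22}$$ on $E$ (in which $L^{ij}=L^{ij}(z,w)$), understood along their characteristics, with the boundary conditions $$L^{11}(-w,w)=L^{22}(-w,w)=0,\qquad L^{12}(w,w)=\frac{b(w)}{\lambda(w)+\mu(w)},\qquad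 L^{21}(w,w)=-\frac{c(w)}{\lambda(w)+\mu(w)}\qquad(w\in[-1,1]),$$ have a unique solution $L^{11},L^{12},L^{21},L^{22}\in C(E)$. Apply the feedback laws $$U_1(t)=-\int_{-1}^{1}u(z,t)L^{11}(z,-1)\,dz-\int_{-1}^{1}v(z,t)L^{12}(z,-1)\,dz,$$ $$U_2(t)=\int_{-1}^{1}u(z,t)L^{21}(z,1)\,dz+\int_{-1}^{1}v(z,t)L^{22}(z,1)\,dz .$$ Then for all $u_0,v_0\in L^2([-1,1])$ the closed-loop system has a unique weak solution $(u,v)\in C([0,\infty);L^2([-1,1])^2)$, and it reaches the zero equilibrium in finite time: with $\phi_1(w)=\int_0^w\frac{dy}{\lambda(y)}$, $$u(\cdot,t)=v(\cdot,t)=0\qquad\text{for all } t\ge \phi_1(1)-\phi_1(-1).$$ -/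

import Mathlib

open MeasureTheory Set

/-- The spatial domain `[-1, 1]`. -/
abbrev spaceI : Set ℝ := Icc (-1 : ℝ) 1

/-- The state space `L²([-1, 1])` (real valued). -/
abbrev L2I : Type := Lp ℝ 2 (volume.restrict spaceI)

/-- The function `φ(w) = ∫₀ʷ dy / lam(y)` (`φ₁` in terms of the velocity `lam`). -/
noncomputable def phiOf (lam : ℝ → ℝ) (w : ℝ) : ℝ :=
  ∫ y in (0 : ℝ)..w, 1 / lam y

/-- The domain of the kernels: the union of the two triangles
`{-w ≤ z ≤ w, 0 ≤ w ≤ 1}` and `{w ≤ z ≤ -w, -1 ≤ w ≤ 0}`, with points written `(z, w)`. -/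
def kernelDomain : Set (ℝ × ℝ) :=
  {x | -x.2 ≤ x.1 ∧ x.1 ≤ x.2 ∧ 0 ≤ x.2 ∧ x.2 ≤ 1} ∪
    {x | x.2 ≤ x.1 ∧ x.1 ≤ -x.2 ∧ -1 ≤ x.2 ∧ x.2 ≤ 0}

/-- `L` satisfies `κ₁(w) ∂L/∂w (z,w) + κ₂(z) ∂L/∂z (z,w) = R(z,w)` on the kernel domain in the sense
of characteristics: along every characteristic curve `w' = κ₁(w)`, `z' = κ₂(z)` lying in the domain,
the function `s ↦ L(z(s), w(s))` is differentiable with derivative `R(z(s), w(s))`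
(one-sided at the end points). -/
def SolvesAlongCharacteristics (κ₁ κ₂ : ℝ → ℝ) (L R : ℝ → ℝ → ℝ) : Prop :=
  ∀ (s₀ s₁ : ℝ) (z w : ℝ → ℝ),
    (∀ s ∈ Icc s₀ s₁, (z s, w s) ∈ kernelDomain ∧
      HasDerivWithinAt w (κ₁ (w s)) (Icc s₀ s₁) s ∧
      HasDerivWithinAt z (κ₂ (z s)) (Icc s₀ s₁) s) →
    ∀ s ∈ Icc s₀ s₁,
      HasDerivWithinAt (fun r => L (z r) (w r)) (R (z s) (w s)) (Icc s₀ s₁) s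

/-- A quadruple of kernels `Lⁱʲ(z, w)`; the first argument is `z`. Only the values on
`kernelDomain` are meaningful. -/
structure Kernels where
  L11 : ℝ → ℝ → ℝ
  L12 : ℝ → ℝ → ℝ
  L21 : ℝ → ℝ → ℝ
  L22 : ℝ → ℝ → ℝ

/-- `K` is a continuous solution of the kernel equations with their boundary conditions. The
derivatives `lam'`, `mu'` are those of `C¹` functions on `[-1, 1]`. -/
structure Kernels.IsSolution (K : Kernels) (lam mu b c : ℝ → ℝ) : Prop where
  cont11 : ContinuousOn (fun x : ℝ × ℝ => K.L11 x.1 x.2) kernelDomain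
  cont12 : ContinuousOn (fun x : ℝ × ℝ => K.L12 x.1 x.2) kernelDomain
  cont21 : ContinuousOn (fun x : ℝ × ℝ => K.L21 x.1 x.2) kernelDomain
  cont22 : ContinuousOn (fun x : ℝ × ℝ => K.L22 x.1 x.2) kernelDomain
  eq11 : SolvesAlongCharacteristics lam lam K.L11
    (fun z w => -(derivWithin lam spaceI z) * K.L11 z w - c z * K.L12 z w)
  eq12 : SolvesAlongCharacteristics lam (fun z => -mu z) K.L12
    (fun z w => -(b z) * K.L11 z w + derivWithin mu spaceI z * K.L12 z w)
  eq22 : SolvesAlongCharacteristics mu mu K.L22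
    (fun z w => b z * K.L21 z w - derivWithin mu spaceI z * K.L22 z w)
  eq21 : SolvesAlongCharacteristics mu (fun z => -lam z) K.L21
    (fun z w => derivWithin lam spaceI z * K.L21 z w + c z * K.L22 z w)
  bdry11 : ∀ w ∈ spaceI, K.L11 (-w) w = 0
  bdry12 : ∀ w ∈ spaceI, K.L12 w w = b w / (lam w + mu w)
  bdry22 : ∀ w ∈ spaceI, K.L22 (-w) w = 0
  bdry21 : ∀ w ∈ spaceI, K.L21 w w = -(c w / (lam w + mu w))

/-- `K` and `K'` coincide as functions on the kernel domain. -/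
def Kernels.AgreeOn (K K' : Kernels) : Prop :=
  ∀ x ∈ kernelDomain,
    K.L11 x.1 x.2 = K'.L11 x.1 x.2 ∧ K.L12 x.1 x.2 = K'.L12 x.1 x.2 ∧
    K.L21 x.1 x.2 = K'.L21 x.1 x.2 ∧ K.L22 x.1 x.2 = K'.L22 x.1 x.2

/-- The feedback law at the left end `w = -1`, as a function of the current state `(u, v)`. -/
noncomputable def Kernels.feedbackLeft (K : Kernels) (u v : L2I) : ℝ :=
  -(∫ z in spaceI, u z * K.L11 z (-1)) - ∫ z in spaceI, v z * K.L12 z (-1)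

/-- The feedback law at the right end `w = 1`, as a function of the current state `(u, v)`. -/
noncomputable def Kernels.feedbackRight (K : Kernels) (u v : L2I) : ℝ :=
  (∫ z in spaceI, u z * K.L21 z 1) + ∫ z in spaceI, v z * K.L22 z 1

/-- `(u, v)` is an `L²` weak solution on `[0, ∞)` of
`u_t + lam u_w = b v`, `v_t - mu v_w = c u`, `u(-1, t) = U₁(t)`, `v(1, t) = U₂(t)`,
`u(·, 0) = u₀`, `v(·, 0) = v₀`: it is continuous in time with values in `L²`, and the equations
hold after multiplication by `C¹` test functions `p(w, t)` with `p(1, ·) = 0` (for `u`), resp.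
`p(-1, ·) = 0` (for `v`), and integration by parts over `[-1, 1] × [0, T]`, for every `T ≥ 0`. -/
structure IsWeakSolution (lam mu b c : ℝ → ℝ) (U₁ U₂ : ℝ → ℝ) (u₀ v₀ : L2I)
    (u v : ℝ → L2I) : Prop where
  cont_u : ContinuousOn u (Ici 0)
  cont_v : ContinuousOn v (Ici 0)
  init_u : u 0 = u₀
  init_v : v 0 = v₀
  weak_u : ∀ T : ℝ, 0 ≤ T → ∀ p : ℝ → ℝ → ℝ,
    ContDiff ℝ 1 (fun x : ℝ × ℝ => p x.1 x.2) → (∀ t ∈ Icc 0 T, p 1 t = 0) →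
    (∫ w in spaceI, u T w * p w T) - (∫ w in spaceI, u₀ w * p w 0)
      = (∫ t in (0 : ℝ)..T, ∫ w in spaceI,
          (u t w * (deriv (fun s => p w s) t + lam w * deriv (fun x => p x t) w
              + derivWithin lam spaceI w * p w t)
            + b w * v t w * p w t))
        + ∫ t in (0 : ℝ)..T, lam (-1) * p (-1) t * U₁ t
  weak_v : ∀ T : ℝ, 0 ≤ T → ∀ p : ℝ → ℝ → ℝ,
    ContDiff ℝ 1 (fun x : ℝ × ℝ => p x.1 x.2) → (∀ t ∈ Icc 0 T, p (-1) t = 0) →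
    (∫ w in spaceI, v T w * p w T) - (∫ w in spaceI, v₀ w * p w 0)
      = (∫ t in (0 : ℝ)..T, ∫ w in spaceI,
          (v t w * (deriv (fun s => p w s) t - mu w * deriv (fun x => p x t) w
              - derivWithin mu spaceI w * p w t)
            + c w * u t w * p w t))
        + ∫ t in (0 : ℝ)..T, mu 1 * p 1 t * U₂ t

/-- `(u, v)` solves the closed loop system: the boundary inputs are the feedback laws evaluated at
the current state. -/
def IsClosedLoopSolution (lam mu b c : ℝ → ℝ) (K : Kernels) (u₀ v₀ : L2I)
    (u v : ℝ → L2I) : Prop :=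
  IsWeakSolution lam mu b c (fun t => K.feedbackLeft (u t) (v t))
    (fun t => K.feedbackRight (u t) (v t)) u₀ v₀ u v

/-- A continuous speed on the real line, bounded between two positive constants. -/
structure Speed where
  v : ℝ → ℝ
  cont : Continuous v
  lo : ℝ
  hi : ℝ
  lo_pos : 0 < lo
  lo_le : ∀ w, lo ≤ v w
  le_hi : ∀ w, v w ≤ hi

namespace Speed

variable (S : Speed)

lemma pos (w : ℝ) : 0 < S.v w := S.lo_pos.trans_le (S.lo_le w)

lemma ne (w : ℝ) : S.v w ≠ 0 := (S.pos w).ne'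

lemma hi_pos : 0 < S.hi := (S.pos 0).trans_le (S.le_hi 0)

lemma cont_inv : Continuous fun w => 1 / S.v w :=
  continuous_const.div S.cont S.ne

/-- Travel time from `0` to `w`. -/
noncomputable def phi (w : ℝ) : ℝ := ∫ y in (0 : ℝ)..w, 1 / S.v y

lemma phi_hasDerivAt (w : ℝ) : HasDerivAt S.phi (1 / S.v w) w :=
  intervalIntegral.integral_hasDerivAt_right (S.cont_inv.intervalIntegrable _ _)
    (S.cont_inv.stronglyMeasurableAtFilter _ _) S.cont_inv.continuousAt

lemma phi_continuous : Continuous S.phi :=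
  continuous_iff_continuousAt.2 fun w => (S.phi_hasDerivAt w).continuousAt

@[simp] lemma phi_zero : S.phi 0 = 0 := by simp [phi]

lemma phi_strictMono : StrictMono S.phi :=
  strictMono_of_hasDerivAt_pos S.phi_hasDerivAt fun w => one_div_pos.2 (S.pos w)

lemma le_phi_sub {a b : ℝ} (h : a ≤ b) : (b - a) / S.hi ≤ S.phi b - S.phi a := by
  have := Convex.mul_sub_le_image_sub_of_le_deriv (f := S.phi) (C := 1 / S.hi) convex_univ
    S.phi_continuous.continuousOn
    (fun w _ => (S.phi_hasDerivAt w).differentiableAt.differentiableWithinAt)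
    (fun w _ => by
      rw [(S.phi_hasDerivAt w).deriv]
      exact one_div_le_one_div_of_le (S.pos w) (S.le_hi w)) a (mem_univ _) b (mem_univ _) h
  simpa [div_eq_inv_mul] using this

lemma phi_sub_le {a b : ℝ} (h : a ≤ b) : S.phi b - S.phi a ≤ (b - a) / S.lo := by
  have := Convex.image_sub_le_mul_sub_of_deriv_le (f := S.phi) (C := 1 / S.lo) convex_univ
    S.phi_continuous.continuousOn
    (fun w _ => (S.phi_hasDerivAt w).differentiableAt.differentiableWithinAt)
    (fun w _ => by
      rw [(S.phi_hasDerivAt w).deriv]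
      exact one_div_le_one_div_of_le S.lo_pos (S.lo_le w)) a (mem_univ _) b (mem_univ _) h
  simpa [div_eq_inv_mul] using this

lemma phi_surjective : Function.Surjective S.phi := by
  refine S.phi_continuous.surjective ?_ ?_
  · refine Filter.tendsto_atTop_mono' _ ?_
      (Filter.tendsto_id.atTop_div_const S.hi_pos : Filter.Tendsto (fun w : ℝ => w / S.hi) _ _)
    filter_upwards [Filter.eventually_ge_atTop 0] with w hw
    simpa using S.le_phi_sub hw
  · refine Filter.tendsto_atBot_mono' _ ?_
      (Filter.tendsto_id.atBot_div_const S.hi_pos : Filter.Tendsto (fun w : ℝ => w / S.hi) _ _)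
    filter_upwards [Filter.eventually_le_atBot 0] with w hw
    have := S.le_phi_sub hw
    simp only [zero_sub, phi_zero, neg_div] at this
    linarith

/-- The inverse of the travel time. -/
noncomputable def psi : ℝ → ℝ :=
  (S.phi_strictMono.orderIsoOfSurjective S.phi S.phi_surjective).symm

@[simp] lemma phi_psi (x : ℝ) : S.phi (S.psi x) = x :=
  (S.phi_strictMono.orderIsoOfSurjective S.phi S.phi_surjective).apply_symm_apply x

@[simp] lemma psi_phi (w : ℝ) : S.psi (S.phi w) = w :=
  (S.phi_strictMono.orderIsoOfSurjective S.phi S.phi_surjective).symm_apply_apply w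

lemma psi_continuous : Continuous S.psi := OrderIso.continuous _

lemma psi_strictMono : StrictMono S.psi := OrderIso.strictMono _

lemma psi_hasDerivAt (x : ℝ) : HasDerivAt S.psi (S.v (S.psi x)) x := by
  have h := HasDerivAt.of_local_left_inverse (f := S.phi) (g := S.psi) (a := x)
    S.psi_continuous.continuousAt (S.phi_hasDerivAt _) (one_div_pos.2 (S.pos _)).ne'
    (Filter.Eventually.of_forall S.phi_psi)
  simpa using h

lemma psi_le_iff {x w : ℝ} : S.psi x ≤ w ↔ x ≤ S.phi w := by
  rw [← S.phi_strictMono.le_iff_le, phi_psi]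

lemma le_psi_iff {x w : ℝ} : w ≤ S.psi x ↔ S.phi w ≤ x := by
  rw [← S.phi_strictMono.le_iff_le, phi_psi]

lemma lo_mul_le_psi_sub {x y : ℝ} (h : x ≤ y) : S.lo * (y - x) ≤ S.psi y - S.psi x := by
  have := S.phi_sub_le (S.psi_strictMono.monotone h)
  rw [phi_psi, phi_psi, le_div_iff₀ S.lo_pos] at this
  linarith

/-- Travel time from `-w` to `w`. -/
noncomputable def gap (w : ℝ) : ℝ := S.phi w - S.phi (-w)

lemma gap_hasDerivAt (w : ℝ) : HasDerivAt S.gap (1 / S.v w + 1 / S.v (-w)) w := by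
  have := (S.phi_hasDerivAt w).sub ((S.phi_hasDerivAt (-w)).comp w (hasDerivAt_neg w))
  convert! this using 1
  ring

lemma gap_continuous : Continuous S.gap :=
  S.phi_continuous.sub (S.phi_continuous.comp continuous_neg)

@[simp] lemma gap_zero : S.gap 0 = 0 := by simp [gap]

@[simp] lemma gap_neg (w : ℝ) : S.gap (-w) = -S.gap w := by simp [gap]

lemma gap_strictMono : StrictMono S.gap := fun _ _ h =>
  sub_lt_sub (S.phi_strictMono h) (S.phi_strictMono (neg_lt_neg h))

lemma gap_surjective : Function.Surjective S.gap := by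
  have key : ∀ w, 0 ≤ w → w / S.hi ≤ S.gap w := fun w hw => by
    have h1 := S.le_phi_sub hw
    have h2 := S.phi_strictMono.monotone (neg_nonpos.2 hw)
    simp only [sub_zero, phi_zero] at h1 h2
    rw [gap]
    linarith
  refine S.gap_continuous.surjective ?_ ?_
  · refine Filter.tendsto_atTop_mono' _ ?_
      (Filter.tendsto_id.atTop_div_const S.hi_pos : Filter.Tendsto (fun w : ℝ => w / S.hi) _ _)
    filter_upwards [Filter.eventually_ge_atTop 0] with w hw using key w hw
  · refine Filter.tendsto_atBot_mono' _ ?_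
      (Filter.tendsto_id.atBot_div_const S.hi_pos : Filter.Tendsto (fun w : ℝ => w / S.hi) _ _)
    filter_upwards [Filter.eventually_le_atBot 0] with w hw
    have := key (-w) (neg_nonneg.2 hw)
    rw [gap_neg, neg_div] at this
    linarith

/-- The inverse of `gap`: the abscissa at which a characteristic leaves the anti-diagonal. -/
noncomputable def ungap : ℝ → ℝ :=
  (S.gap_strictMono.orderIsoOfSurjective S.gap S.gap_surjective).symm

@[simp] lemma gap_ungap (x : ℝ) : S.gap (S.ungap x) = x :=
  (S.gap_strictMono.orderIsoOfSurjective S.gap S.gap_surjective).apply_symm_apply x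

@[simp] lemma ungap_gap (w : ℝ) : S.ungap (S.gap w) = w :=
  (S.gap_strictMono.orderIsoOfSurjective S.gap S.gap_surjective).symm_apply_apply w

@[simp] lemma ungap_zero : S.ungap 0 = 0 := by
  simpa using S.ungap_gap 0

lemma ungap_continuous : Continuous S.ungap := OrderIso.continuous _

lemma ungap_strictMono : StrictMono S.ungap := OrderIso.strictMono _

lemma ungap_le_iff {x w : ℝ} : S.ungap x ≤ w ↔ x ≤ S.gap w := by
  rw [← S.gap_strictMono.le_iff_le, gap_ungap]

lemma le_ungap_iff {x w : ℝ} : w ≤ S.ungap x ↔ S.gap w ≤ x := by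
  rw [← S.gap_strictMono.le_iff_le, gap_ungap]

/-- Abscissa of the point where the characteristic through `(z, w)` meets the anti-diagonal. -/
noncomputable def entry (z w : ℝ) : ℝ := S.ungap (S.phi w - S.phi z)

lemma phi_entry_sub (z w : ℝ) :
    S.phi (S.entry z w) - S.phi (-S.entry z w) = S.phi w - S.phi z :=
  S.gap_ungap _

@[simp] lemma entry_neg_self (w : ℝ) : S.entry (-w) w = w := S.ungap_gap w

lemma entry_continuous : Continuous fun x : ℝ × ℝ => S.entry x.1 x.2 :=
  S.ungap_continuous.comp
    ((S.phi_continuous.comp continuous_snd).sub (S.phi_continuous.comp continuous_fst))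

lemma entry_le_iff {z w : ℝ} : S.entry z w ≤ w ↔ -w ≤ z := by
  rw [entry, ungap_le_iff, gap, sub_le_sub_iff_left, S.phi_strictMono.le_iff_le]

lemma le_entry_iff {z w : ℝ} : w ≤ S.entry z w ↔ z ≤ -w := by
  rw [entry, le_ungap_iff, gap, sub_le_sub_iff_left, S.phi_strictMono.le_iff_le]

lemma entry_nonneg_iff {z w : ℝ} : 0 ≤ S.entry z w ↔ z ≤ w := by
  rw [entry, le_ungap_iff, gap_zero, sub_nonneg, S.phi_strictMono.le_iff_le]

lemma entry_nonpos_iff {z w : ℝ} : S.entry z w ≤ 0 ↔ w ≤ z := by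
  rw [entry, ungap_le_iff, gap_zero, sub_nonpos, S.phi_strictMono.le_iff_le]

end Speed

lemma mem_kernelDomain_iff {z w : ℝ} : (z, w) ∈ kernelDomain ↔ |z| ≤ |w| ∧ |w| ≤ 1 := by
  simp only [kernelDomain, mem_union, mem_ofPred_eq]
  constructor
  · rintro (⟨h1, h2, h3, h4⟩ | ⟨h1, h2, h3, h4⟩)
    · rw [abs_of_nonneg h3]; exact ⟨abs_le.2 ⟨h1, h2⟩, h4⟩
    · rw [abs_of_nonpos h4]; exact ⟨abs_le.2 ⟨by linarith, h2⟩, by linarith⟩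
  · rintro ⟨h1, h2⟩
    rcases le_total 0 w with h | h
    · rw [abs_of_nonneg h] at h1 h2; left
      exact ⟨(abs_le.1 h1).1, (abs_le.1 h1).2, h, h2⟩
    · rw [abs_of_nonpos h] at h1 h2; right
      exact ⟨by linarith [(abs_le.1 h1).1], (abs_le.1 h1).2, by linarith, h⟩

lemma neg_mem_kernelDomain_iff {z w : ℝ} : (-z, w) ∈ kernelDomain ↔ (z, w) ∈ kernelDomain := by
  simp [mem_kernelDomain_iff]

lemma mem_neg_kernelDomain_iff {z w : ℝ} : (z, -w) ∈ kernelDomain ↔ (z, w) ∈ kernelDomain := by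
  simp [mem_kernelDomain_iff]

lemma Speed.mem_kernelDomain_iff_entry (S : Speed) {z w : ℝ} :
    (z, w) ∈ kernelDomain ↔ |w| ≤ 1 ∧ S.entry z w ∈ uIcc 0 w := by
  rw [mem_kernelDomain_iff, and_comm]
  refine and_congr_right fun _ => ?_
  rcases le_total 0 w with h | h
  · rw [abs_of_nonneg h, uIcc_of_le h, mem_Icc, S.entry_nonneg_iff, S.entry_le_iff, abs_le,
      and_comm]
  · rw [abs_of_nonpos h, uIcc_of_ge h, mem_Icc, S.entry_nonpos_iff, S.le_entry_iff, abs_le,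
      neg_neg, and_comm]

lemma isCompact_kernelDomain : IsCompact kernelDomain := by
  have hc : IsClosed kernelDomain := by
    have : kernelDomain = {x : ℝ × ℝ | |x.1| ≤ |x.2|} ∩ {x | |x.2| ≤ 1} := by
      ext ⟨z, w⟩; exact mem_kernelDomain_iff
    rw [this]
    exact (isClosed_le (by fun_prop) (by fun_prop)).inter (isClosed_le (by fun_prop) (by fun_prop))
  refine (isCompact_Icc (a := ((-1, -1) : ℝ × ℝ)) (b := (1, 1))).of_isClosed_subset hc ?_
  rintro ⟨z, w⟩ h
  rw [mem_kernelDomain_iff] at h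
  have h1 := abs_le.1 (h.1.trans h.2)
  have h2 := abs_le.1 h.2
  exact ⟨⟨h1.1, h2.1⟩, ⟨h1.2, h2.2⟩⟩

lemma mem_spaceI_iff {w : ℝ} : w ∈ spaceI ↔ |w| ≤ 1 := abs_le.symm

lemma neg_mem_spaceI {w : ℝ} (h : w ∈ spaceI) : -w ∈ spaceI := by
  rw [mem_spaceI_iff, abs_neg]; exact mem_spaceI_iff.1 h

/-- Truncation of the real line to `[-a, a]`. -/
def clampTo (a x : ℝ) : ℝ := max (-a) (min a x)

lemma abs_clampTo_le {a : ℝ} (ha : 0 ≤ a) (x : ℝ) : |clampTo a x| ≤ a :=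
  abs_le.2 ⟨le_max_left _ _, max_le (by linarith) (min_le_left _ _)⟩

lemma clampTo_of_abs_le {a x : ℝ} (h : |x| ≤ a) : clampTo a x = x := by
  rw [abs_le] at h
  rw [clampTo, min_eq_right h.2, max_eq_right h.1]

lemma clampTo_mem_spaceI (x : ℝ) : clampTo 1 x ∈ spaceI :=
  mem_spaceI_iff.2 (abs_clampTo_le zero_le_one x)

lemma clampTo_of_mem {x : ℝ} (h : x ∈ spaceI) : clampTo 1 x = x :=
  clampTo_of_abs_le (mem_spaceI_iff.1 h)

/-- A continuous retraction of the plane on the kernel domain. -/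
def kernelRetract (x : ℝ × ℝ) : ℝ × ℝ := (clampTo |clampTo 1 x.2| x.1, clampTo 1 x.2)

lemma continuous_kernelRetract : Continuous kernelRetract := by
  unfold kernelRetract clampTo; fun_prop

lemma kernelRetract_mem (x : ℝ × ℝ) : kernelRetract x ∈ kernelDomain :=
  mem_kernelDomain_iff.2 ⟨abs_clampTo_le (abs_nonneg _) _, abs_clampTo_le zero_le_one _⟩

lemma kernelRetract_of_mem {x : ℝ × ℝ} (h : x ∈ kernelDomain) : kernelRetract x = x := by
  obtain ⟨z, w⟩ := x
  rw [mem_kernelDomain_iff] at h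
  simp only [kernelRetract, clampTo_of_abs_le h.2, clampTo_of_abs_le h.1]

lemma ContinuousOn.comp_clampTo {f : ℝ → ℝ} (h : ContinuousOn f spaceI) :
    Continuous fun x => f (clampTo 1 x) :=
  h.comp_continuous (by unfold clampTo; fun_prop) clampTo_mem_spaceI

lemma ContinuousOn.comp_kernelRetract {f : ℝ × ℝ → ℝ} (h : ContinuousOn f kernelDomain) :
    Continuous fun x => f (kernelRetract x) :=
  h.comp_continuous continuous_kernelRetract kernelRetract_mem

lemma fst_mem_of_mem_kernelDomain {z w : ℝ} (h : (z, w) ∈ kernelDomain) : z ∈ spaceI := by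
  rw [mem_kernelDomain_iff] at h
  exact mem_spaceI_iff.2 (h.1.trans h.2)

lemma snd_mem_of_mem_kernelDomain {z w : ℝ} (h : (z, w) ∈ kernelDomain) : w ∈ spaceI := by
  rw [mem_kernelDomain_iff] at h
  exact mem_spaceI_iff.2 h.2

namespace SolvesAlongCharacteristics

variable {κ₁ κ₂ κ₁' κ₂' : ℝ → ℝ} {L R L' R' : ℝ → ℝ → ℝ}

lemma congr (h : SolvesAlongCharacteristics κ₁ κ₂ L R)
    (h₁ : ∀ w ∈ spaceI, κ₁' w = κ₁ w) (h₂ : ∀ w ∈ spaceI, κ₂' w = κ₂ w)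
    (hL : ∀ z w, (z, w) ∈ kernelDomain → L' z w = L z w)
    (hR : ∀ z w, (z, w) ∈ kernelDomain → R' z w = R z w) :
    SolvesAlongCharacteristics κ₁' κ₂' L' R' := by
  intro s₀ s₁ z w hzw s hs
  have := h s₀ s₁ z w (fun s hs => by
    obtain ⟨hm, hw, hz⟩ := hzw s hs
    rw [h₁ _ (snd_mem_of_mem_kernelDomain hm)] at hw
    rw [h₂ _ (fst_mem_of_mem_kernelDomain hm)] at hz
    exact ⟨hm, hw, hz⟩) s hs
  rw [hR _ _ (hzw s hs).1]
  exact this.congr (fun r hr => hL _ _ (hzw r hr).1) (hL _ _ (hzw s hs).1)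

lemma neg_fst (h : SolvesAlongCharacteristics κ₁ κ₂ L R) :
    SolvesAlongCharacteristics κ₁ (fun z => -κ₂ (-z)) (fun z w => L (-z) w)
      (fun z w => R (-z) w) := by
  intro s₀ s₁ z w hzw s hs
  refine h s₀ s₁ (fun s => -z s) w (fun s hs => ?_) s hs
  obtain ⟨hm, hw, hz⟩ := hzw s hs
  refine ⟨neg_mem_kernelDomain_iff.2 hm, hw, ?_⟩
  simpa using hz.fun_neg

lemma neg_snd (h : SolvesAlongCharacteristics κ₁ κ₂ L R) :
    SolvesAlongCharacteristics (fun w => -κ₁ (-w)) κ₂ (fun z w => L z (-w))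
      (fun z w => R z (-w)) := by
  intro s₀ s₁ z w hzw s hs
  refine h s₀ s₁ z (fun s => -w s) (fun s hs => ?_) s hs
  obtain ⟨hm, hw, hz⟩ := hzw s hs
  refine ⟨mem_neg_kernelDomain_iff.2 hm, ?_, hz⟩
  simpa using hw.fun_neg

lemma _root_.HasDerivWithinAt.comp_neg_Icc {f : ℝ → ℝ} {f' s₀ s₁ s : ℝ}
    (h : HasDerivWithinAt f f' (Icc s₀ s₁) (-s)) :
    HasDerivWithinAt (fun r => f (-r)) (-f') (Icc (-s₁) (-s₀)) s := by
  have := h.comp s (h := fun r => -r) (s := Icc (-s₁) (-s₀)) (hasDerivAt_neg s).hasDerivWithinAt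
    (fun r hr => ⟨by linarith [hr.2], by linarith [hr.1]⟩)
  simpa [Function.comp_def] using this

lemma reverse (h : SolvesAlongCharacteristics κ₁ κ₂ L R) :
    SolvesAlongCharacteristics (fun w => -κ₁ w) (fun z => -κ₂ z) L (fun z w => -R z w) := by
  intro s₀ s₁ z w hzw s hs
  have hneg : ∀ r ∈ Icc (-s₁) (-s₀), -r ∈ Icc s₀ s₁ := fun r hr =>
    ⟨by linarith [hr.2], by linarith [hr.1]⟩
  have := h (-s₁) (-s₀) (fun s => z (-s)) (fun s => w (-s)) (fun r hr => by
    obtain ⟨hm, hw, hz⟩ := hzw (-r) (hneg r hr)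
    refine ⟨hm, ?_, ?_⟩
    · simpa using hw.comp_neg_Icc
    · simpa using hz.comp_neg_Icc) (-s) ⟨by linarith [hs.2], by linarith [hs.1]⟩
  simpa using this.comp_neg_Icc

lemma mul_fst (h : SolvesAlongCharacteristics κ₁ κ₂ L R) {g g' : ℝ → ℝ}
    (hg : ∀ z ∈ spaceI, HasDerivWithinAt g (g' z) spaceI z) :
    SolvesAlongCharacteristics κ₁ κ₂ (fun z w => g z * L z w)
      (fun z w => g' z * κ₂ z * L z w + g z * R z w) := by
  intro s₀ s₁ z w hzw s hs
  have hm := fun r hr => fst_mem_of_mem_kernelDomain (hzw r hr).1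
  exact ((hg _ (hm s hs)).comp s (hzw s hs).2.2 hm).mul (h s₀ s₁ z w hzw s hs)

lemma mul_snd (h : SolvesAlongCharacteristics κ₁ κ₂ L R) {g g' : ℝ → ℝ}
    (hg : ∀ z ∈ spaceI, HasDerivWithinAt g (g' z) spaceI z) :
    SolvesAlongCharacteristics κ₁ κ₂ (fun z w => g w * L z w)
      (fun z w => g' w * κ₁ w * L z w + g w * R z w) := by
  intro s₀ s₁ z w hzw s hs
  have hm := fun r hr => snd_mem_of_mem_kernelDomain (hzw r hr).1
  exact ((hg _ (hm s hs)).comp s (hzw s hs).2.1 hm).mul (h s₀ s₁ z w hzw s hs)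

lemma add (h : SolvesAlongCharacteristics κ₁ κ₂ L R)
    (h' : SolvesAlongCharacteristics κ₁ κ₂ L' R') :
    SolvesAlongCharacteristics κ₁ κ₂ (fun z w => L z w + L' z w)
      (fun z w => R z w + R' z w) :=
  fun s₀ s₁ z w hzw s hs => (h s₀ s₁ z w hzw s hs).add (h' s₀ s₁ z w hzw s hs)

/-- Integral form of an equation along a characteristic of slope one in travel time
coordinates. -/
lemma sub_eq_integral {S : Speed} (h : SolvesAlongCharacteristics S.v S.v L R)
    (hR : ContinuousOn (fun x : ℝ × ℝ => R x.1 x.2) kernelDomain) {η a b : ℝ}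
    (hab : ∀ r ∈ uIcc a b, (S.psi r, S.psi (r + η)) ∈ kernelDomain) :
    L (S.psi b) (S.psi (b + η)) - L (S.psi a) (S.psi (a + η)) =
      ∫ r in a..b, R (S.psi r) (S.psi (r + η)) := by
  wlog hle : a ≤ b generalizing a b
  · rw [intervalIntegral.integral_symm, ← this (by rwa [uIcc_comm]) (le_of_not_ge hle)]
    ring
  rw [uIcc_of_le hle] at hab
  have hd := h a b S.psi (fun r => S.psi (r + η)) fun r hr =>
    ⟨hab r hr, ((S.psi_hasDerivAt (r + η)).comp_add_const r η).hasDerivWithinAt,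
      (S.psi_hasDerivAt r).hasDerivWithinAt⟩
  symm
  refine intervalIntegral.integral_eq_sub_of_hasDerivAt_of_le hle
    (fun r hr => (hd r hr).continuousWithinAt)
    (fun r hr => (hd r (Ioo_subset_Icc_self hr)).hasDerivAt (Icc_mem_nhds hr.1 hr.2)) ?_
  refine ContinuousOn.intervalIntegrable ?_
  rw [uIcc_of_le hle]
  exact hR.comp (f := fun r => (S.psi r, S.psi (r + η)))
    (by have := S.psi_continuous; fun_prop) hab

end SolvesAlongCharacteristics

namespace Speed

variable (S : Speed)

lemma entry_psi (r η : ℝ) : S.entry (S.psi r) (S.psi (r + η)) = S.ungap η := by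
  simp [entry]

lemma phi_neg_entry_add (z w : ℝ) :
    S.phi (-S.entry z w) + (S.phi w - S.phi z) = S.phi (S.entry z w) := by
  linarith [S.phi_entry_sub z w]

lemma line_mem_uIcc {z w r : ℝ} (hr : r ∈ uIcc (S.phi (-S.entry z w)) (S.phi z)) :
    S.psi (r + (S.phi w - S.phi z)) ∈ uIcc (S.entry z w) w := by
  have h1 := S.phi_neg_entry_add z w
  rw [mem_uIcc] at hr ⊢
  simp only [le_psi_iff, psi_le_iff]
  rcases hr with hr | hr
  · left; constructor <;> linarith
  · right; constructor <;> linarith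

/-- The part of a characteristic between the anti-diagonal and a point of the kernel domain lies
in the kernel domain. -/
lemma line_mem_kernelDomain {z w r : ℝ} (h : (z, w) ∈ kernelDomain)
    (hr : r ∈ uIcc (S.phi (-S.entry z w)) (S.phi z)) :
    (S.psi r, S.psi (r + (S.phi w - S.phi z))) ∈ kernelDomain := by
  have hw := S.line_mem_uIcc hr
  rw [S.mem_kernelDomain_iff_entry] at h ⊢
  rw [S.entry_psi]
  change _ ∧ S.entry z w ∈ _
  obtain ⟨h1, h2⟩ := h
  rw [abs_le] at h1 ⊢
  simp only [mem_uIcc] at h2 hw ⊢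
  rcases h2 with h2 | h2
  · have : S.entry z w ≤ S.psi (r + (S.phi w - S.phi z)) ∧
        S.psi (r + (S.phi w - S.phi z)) ≤ w := by
      rcases hw with hw | hw
      · exact hw
      · exact ⟨by linarith, by linarith⟩
    exact ⟨⟨by linarith, by linarith⟩, Or.inl ⟨h2.1, this.1⟩⟩
  · have : w ≤ S.psi (r + (S.phi w - S.phi z)) ∧
        S.psi (r + (S.phi w - S.phi z)) ≤ S.entry z w := by
      rcases hw with hw | hw
      · exact ⟨by linarith, by linarith⟩
      · exact hw
    exact ⟨⟨by linarith, by linarith⟩, Or.inr ⟨this.2, h2.2⟩⟩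

/-- Along the characteristic between the anti-diagonal and a point of the kernel domain, the
second coordinate moves away from zero at least with the minimal speed. -/
lemma abs_line_le {z w r : ℝ} (h : (z, w) ∈ kernelDomain)
    (hr : r ∈ uIcc (S.phi (-S.entry z w)) (S.phi z)) :
    |S.psi (r + (S.phi w - S.phi z))| + S.lo * |S.phi z - r| ≤ |w| := by
  have hw := S.line_mem_uIcc hr
  have h1 := S.phi_neg_entry_add z w
  have h2 := (S.mem_kernelDomain_iff_entry.1 h).2
  rw [mem_uIcc] at hr h2
  rcases h2 with h2 | h2
  · rw [uIcc_of_le h2.2] at hw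
    have h3 := S.phi_strictMono.monotone h2.2
    have h4 : r ≤ S.phi z := by rcases hr with hr | hr <;> linarith
    have h5 := S.lo_mul_le_psi_sub (x := r + (S.phi w - S.phi z)) (y := S.phi w) (by linarith)
    rw [abs_of_nonneg (h2.1.trans hw.1), abs_of_nonneg (h2.1.trans h2.2),
      abs_of_nonneg (sub_nonneg.2 h4)]
    rw [psi_phi, show S.phi w - (r + (S.phi w - S.phi z)) = S.phi z - r by ring] at h5
    linarith
  · rw [uIcc_of_ge h2.1] at hw
    have h3 := S.phi_strictMono.monotone h2.1
    have h4 : S.phi z ≤ r := by rcases hr with hr | hr <;> linarith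
    have h5 := S.lo_mul_le_psi_sub (y := r + (S.phi w - S.phi z)) (x := S.phi w) (by linarith)
    rw [abs_of_nonpos (hw.2.trans h2.2), abs_of_nonpos (h2.1.trans h2.2),
      abs_of_nonpos (sub_nonpos.2 h4)]
    rw [psi_phi, show (r + (S.phi w - S.phi z)) - S.phi w = -(S.phi z - r) by ring] at h5
    linarith

/-- Integration along the characteristic through `(z, w)`, from the anti-diagonal to `(z, w)`. -/
noncomputable def lineIntegral (R : ℝ → ℝ → ℝ) (z w : ℝ) : ℝ :=
  ∫ r in S.phi (-S.entry z w)..S.phi z, R (S.psi r) (S.psi (r + (S.phi w - S.phi z)))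

lemma lineIntegral_congr {R R' : ℝ → ℝ → ℝ} {z w : ℝ} (h : (z, w) ∈ kernelDomain)
    (hR : ∀ z w, (z, w) ∈ kernelDomain → R z w = R' z w) :
    S.lineIntegral R z w = S.lineIntegral R' z w :=
  intervalIntegral.integral_congr fun _ hr => hR _ _ (S.line_mem_kernelDomain h hr)

lemma continuous_lineIntegral {R : ℝ → ℝ → ℝ} (hR : Continuous fun x : ℝ × ℝ => R x.1 x.2) :
    Continuous fun x : ℝ × ℝ => S.lineIntegral R x.1 x.2 := by
  have h1 := S.psi_continuous
  have h2 := S.phi_continuous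
  have h3 := S.entry_continuous
  have hI : Continuous fun x : (ℝ × ℝ) × ℝ =>
      R (S.psi x.2) (S.psi (x.2 + (S.phi x.1.2 - S.phi x.1.1))) :=
    hR.comp (g := fun x : ℝ × ℝ => R x.1 x.2)
      (f := fun x : (ℝ × ℝ) × ℝ => (S.psi x.2, S.psi (x.2 + (S.phi x.1.2 - S.phi x.1.1))))
      (by fun_prop)
  have key : ∀ s : ℝ × ℝ → ℝ, Continuous s → Continuous fun x : ℝ × ℝ =>
      ∫ r in (0 : ℝ)..s x, R (S.psi r) (S.psi (r + (S.phi x.2 - S.phi x.1))) := fun s hs =>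
    intervalIntegral.continuous_parametric_intervalIntegral_of_continuous (μ := volume)
      (f := fun (x : ℝ × ℝ) r => R (S.psi r) (S.psi (r + (S.phi x.2 - S.phi x.1)))) hI hs
  have e : (fun x : ℝ × ℝ => S.lineIntegral R x.1 x.2) = fun x : ℝ × ℝ =>
      (∫ r in (0 : ℝ)..S.phi x.1, R (S.psi r) (S.psi (r + (S.phi x.2 - S.phi x.1)))) -
      ∫ r in (0 : ℝ)..S.phi (-S.entry x.1 x.2),
        R (S.psi r) (S.psi (r + (S.phi x.2 - S.phi x.1))) := by
    ext x
    have hc : Continuous fun r => R (S.psi r) (S.psi (r + (S.phi x.2 - S.phi x.1))) :=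
      hI.comp (f := fun r => (x, r)) (by fun_prop)
    rw [lineIntegral, intervalIntegral.integral_interval_sub_left
      (hc.intervalIntegrable _ _) (hc.intervalIntegrable _ _)]
  rw [e]
  exact (key _ (by fun_prop)).sub (key _ (by fun_prop))

end Speed

lemma SolvesAlongCharacteristics.eq_lineIntegral {S : Speed} {L R : ℝ → ℝ → ℝ}
    (h : SolvesAlongCharacteristics S.v S.v L R)
    (hR : ContinuousOn (fun x : ℝ × ℝ => R x.1 x.2) kernelDomain) {z w : ℝ}
    (hzw : (z, w) ∈ kernelDomain) :
    L z w = L (-S.entry z w) (S.entry z w) + S.lineIntegral R z w := by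
  have := h.sub_eq_integral hR (fun r hr => S.line_mem_kernelDomain hzw hr)
  rw [S.phi_neg_entry_add, S.psi_phi, S.psi_phi, S.psi_phi, add_sub_cancel, S.psi_phi] at this
  rw [Speed.lineIntegral, ← this]
  ring

/-- Travel time along a curve moving with the prescribed speed. -/
lemma Speed.phi_curve (S : Speed) {s₀ s₁ : ℝ} {w : ℝ → ℝ}
    (h : ∀ s ∈ Icc s₀ s₁, HasDerivWithinAt w (S.v (w s)) (Icc s₀ s₁) s) {s : ℝ}
    (hs : s ∈ Icc s₀ s₁) : S.phi (w s) = S.phi (w s₀) + (s - s₀) := by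
  have hd : ∀ r ∈ Icc s₀ s₁,
      HasDerivWithinAt (fun r => S.phi (w r) - r) 0 (Icc s₀ s₁) r := fun r hr => by
    have := ((S.phi_hasDerivAt (w r)).comp_hasDerivWithinAt r (h r hr)).sub
      (hasDerivWithinAt_id r _)
    rw [one_div, inv_mul_cancel₀ (S.ne _), sub_self] at this
    exact this
  have := constant_of_has_deriv_right_zero (f := fun r => S.phi (w r) - r)
    (fun r hr => (hd r hr).continuousWithinAt)
    (fun r hr => ((hd r (Ico_subset_Icc_self hr)).mono_of_mem_nhdsWithin
      (Icc_mem_nhdsGE_of_mem hr))) s hs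
  linarith

lemma Speed.solvesAlong_of_eq_lineIntegral (S : Speed) {L R : ℝ → ℝ → ℝ} {n : ℝ → ℝ}
    (hR : Continuous fun x : ℝ × ℝ => R x.1 x.2)
    (h : ∀ z w, (z, w) ∈ kernelDomain → L z w = n (S.entry z w) + S.lineIntegral R z w) :
    SolvesAlongCharacteristics S.v S.v L R := by
  intro s₀ s₁ z w hzw s hs
  have hw := fun r hr => S.phi_curve (fun s hs => (hzw s hs).2.1) (s := r) hr
  have hz := fun r hr => S.phi_curve (fun s hs => (hzw s hs).2.2) (s := r) hr
  set η := S.phi (w s₀) - S.phi (z s₀) with hη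
  have hηr : ∀ r ∈ Icc s₀ s₁, S.phi (w r) - S.phi (z r) = η := fun r hr => by
    rw [hw r hr, hz r hr]; ring
  have hc : Continuous fun r => R (S.psi r) (S.psi (r + η)) :=
    hR.comp (f := fun r => (S.psi r, S.psi (r + η))) (by have := S.psi_continuous; fun_prop)
  have e : ∀ r ∈ Icc s₀ s₁, L (z r) (w r) = n (S.ungap η) +
      ∫ q in S.phi (-S.ungap η)..S.phi (z r), R (S.psi q) (S.psi (q + η)) := fun r hr => by
    rw [h _ _ (hzw r hr).1, Speed.lineIntegral, Speed.entry, hηr r hr]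
  have h1 := (intervalIntegral.integral_hasDerivAt_right
    (hc.intervalIntegrable (S.phi (-S.ungap η)) (S.phi (z s)))
    (hc.stronglyMeasurableAtFilter _ _) hc.continuousAt).comp_hasDerivWithinAt s
    ((S.phi_hasDerivAt (z s)).comp_hasDerivWithinAt s (hzw s hs).2.2)
  rw [one_div, inv_mul_cancel₀ (S.ne _), mul_one, S.psi_phi, ← hηr s hs, add_sub_cancel,
    S.psi_phi, hηr s hs] at h1
  exact (h1.const_add (n (S.ungap η))).congr e (e s hs)

lemma integral_exp_neg_mul_abs_sub_le {κ : ℝ} (hκ : 0 < κ) (a b : ℝ) :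
    |∫ r in a..b, Real.exp (-(κ * |b - r|))| ≤ 1 / κ := by
  have key : ∀ t : ℝ, 0 ≤ t → |∫ r in (0 : ℝ)..t, Real.exp (-(κ * r))| ≤ 1 / κ := fun t ht => by
    have hd : ∀ r ∈ uIcc 0 t,
        HasDerivAt (fun r => -Real.exp (-(κ * r)) / κ) (Real.exp (-(κ * r))) r := fun r _ => by
      have := ((((hasDerivAt_id r).const_mul κ).neg).exp.neg).div_const κ
      convert! this using 1
      simp only [Pi.neg_apply, id, mul_one]
      field_simp
    rw [intervalIntegral.integral_eq_sub_of_hasDerivAt hd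
      (Continuous.intervalIntegrable (by fun_prop) _ _)]
    have h1 : Real.exp (-(κ * t)) ≤ 1 := Real.exp_le_one_iff.2 (by nlinarith)
    have h2 := Real.exp_pos (-(κ * t))
    have e : -Real.exp (-(κ * t)) / κ - -Real.exp (-(κ * 0)) / κ
        = (1 - Real.exp (-(κ * t))) / κ := by simp; ring
    rw [e, abs_of_nonneg (div_nonneg (by linarith) hκ.le)]
    gcongr
    linarith
  rcases le_total a b with h | h
  · have e : ∫ r in a..b, Real.exp (-(κ * |b - r|)) = ∫ r in (0 : ℝ)..(b - a),
        Real.exp (-(κ * r)) := by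
      rw [← sub_self b, ← intervalIntegral.integral_comp_sub_left
        (fun r => Real.exp (-(κ * r)))]
      refine intervalIntegral.integral_congr fun r hr => ?_
      rw [uIcc_of_le h] at hr
      simp only [abs_of_nonneg (sub_nonneg.2 hr.2)]
    rw [e]
    exact key _ (sub_nonneg.2 h)
  · have e : ∫ r in a..b, Real.exp (-(κ * |b - r|)) = -∫ r in (0 : ℝ)..(a - b),
        Real.exp (-(κ * r)) := by
      rw [intervalIntegral.integral_symm, ← sub_self b, ← intervalIntegral.integral_comp_sub_right
        (fun r => Real.exp (-(κ * r)))]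
      congr 1
      refine intervalIntegral.integral_congr fun r hr => ?_
      rw [uIcc_of_le h] at hr
      simp only [abs_of_nonpos (sub_nonpos.2 hr.1), neg_sub]
    rw [e, abs_neg]
    exact key _ (sub_nonneg.2 h)

namespace Speed

variable (S : Speed)

/-- The weighted integral operator along characteristics whose fixed points are the weighted
solutions of a reflection-coupled pair of equations with data `n` on the anti-diagonal. -/
noncomputable def picard (a n : Fin 2 → ℝ → ℝ) (θ : ℝ) (N : Fin 2 → ℝ → ℝ → ℝ) (j : Fin 2)
    (z w : ℝ) : ℝ :=
  Real.exp (-(θ * |w|)) * (n j (S.entry z w) + S.lineIntegral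
    (fun z w => a j z * (Real.exp (θ * |w|) * N j.rev (-z) w)) z w)

lemma continuous_picard_source {a : Fin 2 → ℝ → ℝ} (ha : ∀ j, Continuous (a j)) (θ : ℝ)
    {N : Fin 2 → ℝ → ℝ → ℝ} (hN : ∀ j, Continuous fun x : ℝ × ℝ => N j x.1 x.2) (j : Fin 2) :
    Continuous fun x : ℝ × ℝ => a j x.1 * (Real.exp (θ * |x.2|) * N j.rev (-x.1) x.2) :=
  ((ha j).comp continuous_fst).mul (Continuous.mul (by fun_prop)
    ((hN j.rev).comp (f := fun x : ℝ × ℝ => (-x.1, x.2)) (by fun_prop)))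

lemma continuous_picard {a n : Fin 2 → ℝ → ℝ} (ha : ∀ j, Continuous (a j))
    (hn : ∀ j, Continuous (n j)) (θ : ℝ) {N : Fin 2 → ℝ → ℝ → ℝ}
    (hN : ∀ j, Continuous fun x : ℝ × ℝ => N j x.1 x.2) (j : Fin 2) :
    Continuous fun x : ℝ × ℝ => S.picard a n θ N j x.1 x.2 :=
  Continuous.mul (by fun_prop) (((hn j).comp S.entry_continuous).add
    (S.continuous_lineIntegral (continuous_picard_source ha θ hN j)))

lemma picard_sub_le {a n : Fin 2 → ℝ → ℝ} (ha : ∀ j, Continuous (a j)) {A θ : ℝ} (hA : 0 ≤ A)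
    (haA : ∀ j, ∀ z ∈ spaceI, |a j z| ≤ A) (hθ : 0 < θ) {N N' : Fin 2 → ℝ → ℝ → ℝ}
    (hN : ∀ j, Continuous fun x : ℝ × ℝ => N j x.1 x.2)
    (hN' : ∀ j, Continuous fun x : ℝ × ℝ => N' j x.1 x.2) {D : ℝ} (hD : 0 ≤ D)
    (h : ∀ j z w, |N j z w - N' j z w| ≤ D) (j : Fin 2) {z w : ℝ}
    (hzw : (z, w) ∈ kernelDomain) :
    |S.picard a n θ N j z w - S.picard a n θ N' j z w| ≤ A / (θ * S.lo) * D := by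
  have hR : ∀ {N : Fin 2 → ℝ → ℝ → ℝ}, (∀ j, Continuous fun x : ℝ × ℝ => N j x.1 x.2) →
      IntervalIntegrable (fun r => a j (S.psi r) *
        (Real.exp (θ * |S.psi (r + (S.phi w - S.phi z))|) *
          N j.rev (-S.psi r) (S.psi (r + (S.phi w - S.phi z))))) volume
        (S.phi (-S.entry z w)) (S.phi z) := fun hN =>
    Continuous.intervalIntegrable ((continuous_picard_source ha θ hN j).comp
      (f := fun r => (S.psi r, S.psi (r + (S.phi w - S.phi z))))
      (by have := S.psi_continuous; fun_prop)) _ _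
  rw [picard, picard, ← mul_sub, add_sub_add_left_eq_sub, lineIntegral, lineIntegral,
    ← intervalIntegral.integral_sub (hR hN) (hR hN'), abs_mul, abs_of_pos (Real.exp_pos _)]
  have hb : ∀ r ∈ uIoc (S.phi (-S.entry z w)) (S.phi z),
      ‖a j (S.psi r) * (Real.exp (θ * |S.psi (r + (S.phi w - S.phi z))|) *
          N j.rev (-S.psi r) (S.psi (r + (S.phi w - S.phi z)))) -
        a j (S.psi r) * (Real.exp (θ * |S.psi (r + (S.phi w - S.phi z))|) *
          N' j.rev (-S.psi r) (S.psi (r + (S.phi w - S.phi z))))‖ ≤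
      A * D * Real.exp (θ * |w|) * Real.exp (-(θ * S.lo * |S.phi z - r|)) := by
    intro r hr
    have hr' := uIoc_subset_uIcc hr
    have hm := S.line_mem_kernelDomain hzw hr'
    have h1 := haA j _ (fst_mem_of_mem_kernelDomain hm)
    have h2 := h j.rev (-S.psi r) (S.psi (r + (S.phi w - S.phi z)))
    have h3 := S.abs_line_le hzw hr'
    have h4 : Real.exp (θ * |S.psi (r + (S.phi w - S.phi z))|) ≤
        Real.exp (θ * |w|) * Real.exp (-(θ * S.lo * |S.phi z - r|)) := by
      rw [← Real.exp_add]
      refine Real.exp_le_exp.2 ?_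
      nlinarith
    rw [← mul_sub, ← mul_sub, Real.norm_eq_abs, abs_mul, abs_mul, abs_of_pos (Real.exp_pos _)]
    calc _ ≤ A * ((Real.exp (θ * |w|) * Real.exp (-(θ * S.lo * |S.phi z - r|))) * D) := by
          gcongr
      _ = _ := by ring
  have hκ : 0 < θ * S.lo := mul_pos hθ S.lo_pos
  have h1 := intervalIntegral.norm_integral_le_abs_of_norm_le (μ := volume)
    ((ae_restrict_iff' measurableSet_uIoc).2 (ae_of_all _ hb))
    (Continuous.intervalIntegrable (by fun_prop) _ _)
  rw [intervalIntegral.integral_const_mul, abs_mul, Real.norm_eq_abs,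
    abs_of_nonneg (show 0 ≤ A * D * Real.exp (θ * |w|) by positivity)] at h1
  have h2 := integral_exp_neg_mul_abs_sub_le hκ (S.phi (-S.entry z w)) (S.phi z)
  calc _ ≤ Real.exp (-(θ * |w|)) * (A * D * Real.exp (θ * |w|) * (1 / (θ * S.lo))) := by
        refine mul_le_mul_of_nonneg_left (h1.trans ?_) (Real.exp_pos _).le
        exact mul_le_mul_of_nonneg_left h2 (by positivity)
    _ = (Real.exp (-(θ * |w|)) * Real.exp (θ * |w|)) * (A / (θ * S.lo) * D) := by ring
    _ = _ := by rw [← Real.exp_add, neg_add_cancel, Real.exp_zero, one_mul]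

/-- Existence and uniqueness for a pair of characteristic equations coupled through the reflection
`z ↦ -z`, with prescribed values on the anti-diagonal. -/
theorem exists_unique_lineIntegral_system {a n : Fin 2 → ℝ → ℝ} (ha : ∀ j, Continuous (a j))
    (hn : ∀ j, Continuous (n j)) :
    ∃ L : Fin 2 → ℝ → ℝ → ℝ, (∀ j, Continuous fun x : ℝ × ℝ => L j x.1 x.2) ∧
      (∀ j z w, (z, w) ∈ kernelDomain → L j z w = n j (S.entry z w) +
        S.lineIntegral (fun z w => a j z * L j.rev (-z) w) z w) ∧
      ∀ L' : Fin 2 → ℝ → ℝ → ℝ,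
        (∀ j, ContinuousOn (fun x : ℝ × ℝ => L' j x.1 x.2) kernelDomain) →
        (∀ j z w, (z, w) ∈ kernelDomain → L' j z w = n j (S.entry z w) +
          S.lineIntegral (fun z w => a j z * L' j.rev (-z) w) z w) →
        ∀ j z w, (z, w) ∈ kernelDomain → L' j z w = L j z w := by
  have : CompactSpace kernelDomain := isCompact_iff_compactSpace.1 isCompact_kernelDomain
  obtain ⟨A, hA, haA⟩ : ∃ A, 0 < A ∧ ∀ j, ∀ z ∈ spaceI, |a j z| ≤ A := by
    have := fun j => (isCompact_Icc (a := (-1 : ℝ)) (b := 1)).exists_bound_of_continuousOn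
      (ha j).continuousOn
    choose A hA using this
    refine ⟨max 1 (max (A 0) (A 1)), lt_max_of_lt_left one_pos, fun j z hz => ?_⟩
    refine (hA j z hz).trans ?_
    fin_cases j <;> simp
  set θ := 2 * A / S.lo with hθ
  have hθ0 : 0 < θ := div_pos (by linarith) S.lo_pos
  have hK : A / (θ * S.lo) = 1 / 2 := by
    have := S.lo_pos.ne'
    rw [hθ]; field_simp
  let ext : C(kernelDomain, Fin 2 → ℝ) → Fin 2 → ℝ → ℝ → ℝ :=
    fun N j z w => N ⟨kernelRetract (z, w), kernelRetract_mem _⟩ j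
  have hext : ∀ N j, Continuous fun x : ℝ × ℝ => ext N j x.1 x.2 := fun N j =>
    (continuous_apply j).comp (N.continuous.comp (continuous_kernelRetract.subtype_mk _))
  have hext_mem : ∀ N j z w (hx : (z, w) ∈ kernelDomain), ext N j z w = N ⟨(z, w), hx⟩ j :=
    fun N j z w hx => by simp only [ext, kernelRetract_of_mem hx]
  let T : C(kernelDomain, Fin 2 → ℝ) → C(kernelDomain, Fin 2 → ℝ) := fun N =>
    ⟨fun x => fun j => S.picard a n θ (ext N) j x.1.1 x.1.2,
      continuous_pi fun j => (S.continuous_picard ha hn θ (hext N) j).comp continuous_subtype_val⟩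
  have hT : ContractingWith (1 / 2) T := by
    refine ⟨by norm_num, LipschitzWith.of_dist_le_mul fun N N' => ?_⟩
    refine (ContinuousMap.dist_le (by positivity)).2 fun x => ?_
    refine (dist_pi_le_iff (by positivity)).2 fun j => ?_
    have := S.picard_sub_le (n := n) ha hA.le haA hθ0 (hext N) (hext N') dist_nonneg
      (D := dist N N') (fun j z w => by
        rw [← Real.dist_eq]
        exact (dist_le_pi_dist (N _) (N' _) j).trans (ContinuousMap.dist_apply_le_dist _)) j x.2
    rw [hK] at this
    simpa [Real.dist_eq, T] using this
  have hexp : ∀ t : ℝ, Real.exp t * Real.exp (-t) = 1 := fun t => by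
    rw [← Real.exp_add, add_neg_cancel, Real.exp_zero]
  set N := ContractingWith.fixedPoint T hT with hNdef
  have hN : T N = N := hT.fixedPoint_isFixedPt
  refine ⟨fun j z w => Real.exp (θ * |w|) * ext N j z w, fun j => ?_, fun j z w hzw => ?_,
    fun L' hc hL' j z w hzw => ?_⟩
  · exact Continuous.mul (by fun_prop) (hext N j)
  · have h1 : ext N j z w = S.picard a n θ (ext N) j z w := by
      rw [hext_mem N _ _ _ hzw]
      conv_lhs => rw [← hN]
      rfl
    beta_reduce
    rw [h1, picard, ← mul_assoc, hexp, one_mul]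
  · let N' : C(kernelDomain, Fin 2 → ℝ) :=
      ⟨fun x => fun j => Real.exp (-(θ * |x.1.2|)) * L' j x.1.1 x.1.2, by
        refine continuous_pi fun j => Continuous.mul (by fun_prop) ?_
        exact (hc j).comp_continuous continuous_subtype_val fun x => x.2⟩
    have hN' : T N' = N' := by
      ext x j
      obtain ⟨⟨z, w⟩, hx⟩ := x
      change S.picard a n θ (ext N') j z w = Real.exp (-(θ * |w|)) * L' j z w
      rw [hL' j z w hx, picard]
      congr 2
      refine S.lineIntegral_congr hx fun z w hzw => ?_
      rw [hext_mem _ _ _ _ (neg_mem_kernelDomain_iff.2 hzw)]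
      change a j z * (Real.exp (θ * |w|) * (Real.exp (-(θ * |w|)) * L' j.rev (-z) w)) = _
      rw [← mul_assoc (Real.exp _), hexp, one_mul]
    have e : N' = N := hT.fixedPoint_unique hN'
    beta_reduce
    rw [← e, hext_mem _ _ _ _ hzw]
    change L' j z w = Real.exp (θ * |w|) * (Real.exp (-(θ * |w|)) * L' j z w)
    rw [← mul_assoc, hexp, one_mul]

end Speed

namespace SolvesAlongCharacteristics

variable {κ₁ κ₂ : ℝ → ℝ} {L R : ℝ → ℝ → ℝ}

lemma neg_fst_iff : SolvesAlongCharacteristics κ₁ (fun z => -κ₂ (-z)) (fun z w => L (-z) w)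
    (fun z w => R (-z) w) ↔ SolvesAlongCharacteristics κ₁ κ₂ L R :=
  ⟨fun h => by simpa using h.neg_fst, fun h => h.neg_fst⟩

lemma neg_snd_iff : SolvesAlongCharacteristics (fun w => -κ₁ (-w)) κ₂ (fun z w => L z (-w))
    (fun z w => R z (-w)) ↔ SolvesAlongCharacteristics κ₁ κ₂ L R :=
  ⟨fun h => by simpa using h.neg_snd, fun h => h.neg_snd⟩

lemma reverse_iff : SolvesAlongCharacteristics (fun w => -κ₁ w) (fun z => -κ₂ z) L
    (fun z w => -R z w) ↔ SolvesAlongCharacteristics κ₁ κ₂ L R :=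
  ⟨fun h => by simpa using h.reverse, fun h => h.reverse⟩

lemma neg (h : SolvesAlongCharacteristics κ₁ κ₂ L R) :
    SolvesAlongCharacteristics κ₁ κ₂ (fun z w => -L z w) (fun z w => -R z w) :=
  fun s₀ s₁ z w hzw s hs => (h s₀ s₁ z w hzw s hs).fun_neg

lemma neg_iff : SolvesAlongCharacteristics κ₁ κ₂ (fun z w => -L z w) (fun z w => -R z w) ↔
    SolvesAlongCharacteristics κ₁ κ₂ L R :=
  ⟨fun h => by simpa using h.neg, fun h => h.neg⟩

/-- Multiplication by the speed in `z` removes the zero order term of a conservation law. -/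
lemma weight_iff {κ₂' : ℝ → ℝ} {Q : ℝ → ℝ → ℝ}
    (hκ : ∀ z ∈ spaceI, HasDerivWithinAt κ₂ (κ₂' z) spaceI z) (h0 : ∀ z ∈ spaceI, κ₂ z ≠ 0) :
    SolvesAlongCharacteristics κ₁ κ₂ (fun z w => κ₂ z * L z w) (fun z w => κ₂ z * Q z w) ↔
    SolvesAlongCharacteristics κ₁ κ₂ L (fun z w => -κ₂' z * L z w + Q z w) := by
  constructor
  · intro h
    refine (h.mul_fst (g := fun z => (κ₂ z)⁻¹) (g' := fun z => -κ₂' z / κ₂ z ^ 2)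
      (fun z hz => (hκ z hz).fun_inv (h0 z hz))).congr (fun _ _ => rfl) (fun _ _ => rfl) ?_ ?_
    · intro z w hzw
      have := h0 z (fst_mem_of_mem_kernelDomain hzw)
      field_simp
    · intro z w hzw
      have := h0 z (fst_mem_of_mem_kernelDomain hzw)
      field_simp
  · intro h
    refine (h.mul_fst hκ).congr (fun _ _ => rfl) (fun _ _ => rfl) (fun _ _ _ => rfl) ?_
    intro z w _
    ring

lemma congr_iff {κ₁' κ₂' : ℝ → ℝ} {L' R' : ℝ → ℝ → ℝ}
    (h₁ : ∀ w ∈ spaceI, κ₁' w = κ₁ w) (h₂ : ∀ w ∈ spaceI, κ₂' w = κ₂ w)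
    (hL : ∀ z w, (z, w) ∈ kernelDomain → L' z w = L z w)
    (hR : ∀ z w, (z, w) ∈ kernelDomain → R' z w = R z w) :
    SolvesAlongCharacteristics κ₁' κ₂' L' R' ↔ SolvesAlongCharacteristics κ₁ κ₂ L R :=
  ⟨fun h => h.congr (fun w hw => (h₁ w hw).symm) (fun w hw => (h₂ w hw).symm)
    (fun z w hzw => (hL z w hzw).symm) (fun z w hzw => (hR z w hzw).symm),
    fun h => h.congr h₁ h₂ hL hR⟩

end SolvesAlongCharacteristics

/-- The matrix kernels for the system `X_t + S X_w = C(w) X(-w)` satisfied by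
`X(w) = (u(w), v(-w))`, where `C` is the antidiagonal matrix with entries `c 0`, `c 1`. -/
structure IsCharKernel (S : Speed) (c : Fin 2 → ℝ → ℝ) (M : Fin 2 → Fin 2 → ℝ → ℝ → ℝ) :
    Prop where
  cont : ∀ i j, ContinuousOn (fun x : ℝ × ℝ => M i j x.1 x.2) kernelDomain
  eqn : ∀ i j, SolvesAlongCharacteristics S.v S.v (fun z w => S.v z * M i j z w)
    (fun z w => -(S.v z * c j.rev (-z)) * M i j.rev (-z) w)
  bdry : ∀ i j, ∀ w ∈ spaceI,
    M i j (-w) w = if i = j then 0 else c i w / (S.v w + S.v (-w))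

/-- The matrix kernel in the variables `(u(w), v(-w))`. -/
def Kernels.toMatrix (K : Kernels) : Fin 2 → Fin 2 → ℝ → ℝ → ℝ :=
  ![![K.L11, fun z w => K.L12 (-z) w],
    ![fun z w => -K.L21 z (-w), fun z w => -K.L22 (-z) (-w)]]

/-- The kernels with a given matrix kernel. -/
def Kernels.ofMatrix (M : Fin 2 → Fin 2 → ℝ → ℝ → ℝ) : Kernels where
  L11 := M 0 0
  L12 := fun z w => M 0 1 (-z) w
  L21 := fun z w => -M 1 0 z (-w)
  L22 := fun z w => -M 1 1 (-z) (-w)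

lemma Kernels.toMatrix_ofMatrix (M : Fin 2 → Fin 2 → ℝ → ℝ → ℝ) :
    (Kernels.ofMatrix M).toMatrix = M := by
  funext i j z w
  fin_cases i <;> fin_cases j <;> simp [Kernels.toMatrix, Kernels.ofMatrix]

lemma ContinuousOn.neg_fst {f : ℝ → ℝ → ℝ}
    (h : ContinuousOn (fun x : ℝ × ℝ => f x.1 x.2) kernelDomain) :
    ContinuousOn (fun x : ℝ × ℝ => f (-x.1) x.2) kernelDomain :=
  h.comp (f := fun x : ℝ × ℝ => (-x.1, x.2)) (by fun_prop)
    fun _ hx => neg_mem_kernelDomain_iff.2 hx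

lemma ContinuousOn.neg_snd {f : ℝ → ℝ → ℝ}
    (h : ContinuousOn (fun x : ℝ × ℝ => f x.1 x.2) kernelDomain) :
    ContinuousOn (fun x : ℝ × ℝ => f x.1 (-x.2)) kernelDomain :=
  h.comp (f := fun x : ℝ × ℝ => (x.1, -x.2)) (by fun_prop)
    fun _ hx => mem_neg_kernelDomain_iff.2 hx

/-- The data of the system, in terms of a globally defined speed and coupling. -/
structure SystemData (lam mu b c : ℝ → ℝ) (S : Speed) (C : Fin 2 → ℝ → ℝ) : Prop where
  lam_eq : ∀ w ∈ spaceI, S.v w = lam w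
  mu_eq : ∀ w ∈ spaceI, S.v (-w) = mu w
  lam_deriv : ∀ w ∈ spaceI, HasDerivWithinAt lam (derivWithin lam spaceI w) spaceI w
  mu_deriv : ∀ w ∈ spaceI, HasDerivWithinAt mu (derivWithin mu spaceI w) spaceI w
  lam_deriv_cont : ContinuousOn (derivWithin lam spaceI) spaceI
  cont : ∀ i, Continuous (C i)
  b_eq : ∀ w ∈ spaceI, C 0 w = b w
  c_eq : ∀ w ∈ spaceI, C 1 (-w) = c w

theorem exists_systemData {lam mu b c : ℝ → ℝ}
    (hlam : ContDiffOn ℝ 1 lam spaceI) (hmu : ContDiffOn ℝ 1 mu spaceI)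
    (hlam_pos : ∀ w ∈ spaceI, 0 < lam w)
    (hb : ContinuousOn b spaceI) (hc : ContinuousOn c spaceI)
    (hcase : ∀ w ∈ spaceI, lam w = mu (-w)) :
    ∃ S C, SystemData lam mu b c S C := by
  have hne : spaceI.Nonempty := ⟨0, by simp [spaceI]⟩
  obtain ⟨x, hx, hxm⟩ := (isCompact_Icc (a := (-1 : ℝ)) (b := 1)).exists_isMinOn hne
    hlam.continuousOn
  obtain ⟨y, hy, hym⟩ := (isCompact_Icc (a := (-1 : ℝ)) (b := 1)).exists_isMaxOn hne
    hlam.continuousOn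
  refine ⟨⟨fun w => lam (clampTo 1 w), hlam.continuousOn.comp_clampTo, lam x, lam y,
    hlam_pos x hx, fun w => hxm (clampTo_mem_spaceI w), fun w => hym (clampTo_mem_spaceI w)⟩,
    ![fun w => b (clampTo 1 w), fun w => c (clampTo 1 (-w))],
    fun w hw => by simp only [clampTo_of_mem hw], fun w hw => ?_,
    fun w hw => (hlam.differentiableOn one_ne_zero w hw).hasDerivWithinAt,
    fun w hw => (hmu.differentiableOn one_ne_zero w hw).hasDerivWithinAt,
    hlam.continuousOn_derivWithin (uniqueDiffOn_Icc (by norm_num)) le_rfl, fun i => ?_,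
    fun w hw => ?_, fun w hw => ?_⟩
  · simp only [clampTo_of_mem (neg_mem_spaceI hw), hcase _ (neg_mem_spaceI hw), neg_neg]
  · fin_cases i
    · exact hb.comp_clampTo
    · exact hc.comp_clampTo.comp continuous_neg
  · simp [clampTo_of_mem hw]
  · simp [clampTo_of_mem hw]

namespace SystemData

variable {lam mu b c : ℝ → ℝ} {S : Speed} {C : Fin 2 → ℝ → ℝ}

lemma isSolution_iff (h : SystemData lam mu b c S C) (K : Kernels) :
    K.IsSolution lam mu b c ↔ IsCharKernel S C K.toMatrix := by
  have hlam0 : ∀ z ∈ spaceI, lam z ≠ 0 := fun z hz => by rw [← h.lam_eq z hz]; exact S.ne z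
  have hmu0 : ∀ z ∈ spaceI, mu z ≠ 0 := fun z hz => by rw [← h.mu_eq z hz]; exact S.ne _
  have hmun : ∀ z ∈ spaceI, mu (-z) = S.v z := fun z hz => by
    rw [← h.mu_eq _ (neg_mem_spaceI hz), neg_neg]
  have hbn : ∀ z ∈ spaceI, C 0 (-z) = b (-z) := fun z hz => h.b_eq _ (neg_mem_spaceI hz)
  have e11 : SolvesAlongCharacteristics lam lam K.L11
        (fun z w => -(derivWithin lam spaceI z) * K.L11 z w - c z * K.L12 z w) ↔
      SolvesAlongCharacteristics S.v S.v (fun z w => S.v z * K.toMatrix 0 0 z w)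
        (fun z w => -(S.v z * C 1 (-z)) * K.toMatrix 0 1 (-z) w) := by
    simp_rw [sub_eq_add_neg]
    rw [← SolvesAlongCharacteristics.weight_iff (Q := fun z w => -(c z * K.L12 z w))
      h.lam_deriv hlam0]
    refine (SolvesAlongCharacteristics.congr_iff h.lam_eq h.lam_eq ?_ ?_).symm <;> intro z w hzw
    · simp [Kernels.toMatrix, h.lam_eq z (fst_mem_of_mem_kernelDomain hzw)]
    · simp only [h.lam_eq z (fst_mem_of_mem_kernelDomain hzw),
        h.c_eq z (fst_mem_of_mem_kernelDomain hzw)]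
      simp [Kernels.toMatrix]; ring
  have e12 : SolvesAlongCharacteristics lam (fun z => -mu z) K.L12
        (fun z w => -(b z) * K.L11 z w + derivWithin mu spaceI z * K.L12 z w) ↔
      SolvesAlongCharacteristics S.v S.v (fun z w => S.v z * K.toMatrix 0 1 z w)
        (fun z w => -(S.v z * C 0 (-z)) * K.toMatrix 0 0 (-z) w) := by
    have : (fun z w => -(b z) * K.L11 z w + derivWithin mu spaceI z * K.L12 z w) =
        fun z w => -(-derivWithin mu spaceI z) * K.L12 z w + -(b z) * K.L11 z w := by
      funext z w; ring
    rw [this, ← SolvesAlongCharacteristics.weight_iff (κ₂ := fun z => -mu z)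
      (fun z hz => (h.mu_deriv z hz).fun_neg) (fun z hz => neg_ne_zero.2 (hmu0 z hz)),
      ← SolvesAlongCharacteristics.neg_fst_iff, ← SolvesAlongCharacteristics.neg_iff]
    refine (SolvesAlongCharacteristics.congr_iff h.lam_eq ?_ ?_ ?_).symm
    · intro z hz
      simp [hmun z hz]
    all_goals
      intro z w hzw
      have hz := fst_mem_of_mem_kernelDomain hzw
      simp only [hmun z hz, hbn z hz]
      simp [Kernels.toMatrix]
    ring
  have e21 : SolvesAlongCharacteristics mu (fun z => -lam z) K.L21
        (fun z w => derivWithin lam spaceI z * K.L21 z w + c z * K.L22 z w) ↔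
      SolvesAlongCharacteristics S.v S.v (fun z w => S.v z * K.toMatrix 1 0 z w)
        (fun z w => -(S.v z * C 1 (-z)) * K.toMatrix 1 1 (-z) w) := by
    have : (fun z w => derivWithin lam spaceI z * K.L21 z w + c z * K.L22 z w) =
        fun z w => -(-derivWithin lam spaceI z) * K.L21 z w + c z * K.L22 z w := by
      funext z w; ring
    rw [this, ← SolvesAlongCharacteristics.weight_iff (κ₂ := fun z => -lam z)
      (fun z hz => (h.lam_deriv z hz).fun_neg) (fun z hz => neg_ne_zero.2 (hlam0 z hz)),
      ← SolvesAlongCharacteristics.neg_snd_iff, ← SolvesAlongCharacteristics.reverse_iff]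
    refine (SolvesAlongCharacteristics.congr_iff ?_ ?_ ?_ ?_).symm
    · intro z hz
      simp [hmun z hz]
    · intro z hz
      simp [h.lam_eq z hz]
    all_goals
      intro z w hzw
      have hz := fst_mem_of_mem_kernelDomain hzw
      simp only [h.lam_eq z hz, h.c_eq z hz]
      simp [Kernels.toMatrix]
    ring
  have e22 : SolvesAlongCharacteristics mu mu K.L22
        (fun z w => b z * K.L21 z w - derivWithin mu spaceI z * K.L22 z w) ↔
      SolvesAlongCharacteristics S.v S.v (fun z w => S.v z * K.toMatrix 1 1 z w)
        (fun z w => -(S.v z * C 0 (-z)) * K.toMatrix 1 0 (-z) w) := by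
    have : (fun z w => b z * K.L21 z w - derivWithin mu spaceI z * K.L22 z w) =
        fun z w => -derivWithin mu spaceI z * K.L22 z w + b z * K.L21 z w := by
      funext z w; ring
    rw [this, ← SolvesAlongCharacteristics.weight_iff h.mu_deriv hmu0,
      ← SolvesAlongCharacteristics.neg_fst_iff, ← SolvesAlongCharacteristics.neg_snd_iff,
      ← SolvesAlongCharacteristics.reverse_iff, ← SolvesAlongCharacteristics.neg_iff]
    refine (SolvesAlongCharacteristics.congr_iff ?_ ?_ ?_ ?_).symm
    · intro z hz
      simp [hmun z hz]
    · intro z hz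
      simp [hmun z hz]
    all_goals
      intro z w hzw
      have hz := fst_mem_of_mem_kernelDomain hzw
      simp only [hmun z hz, hbn z hz]
      simp [Kernels.toMatrix]
    ring
  constructor
  · intro hK
    refine ⟨fun i j => ?_, fun i j => ?_, fun i j w hw => ?_⟩
    · fin_cases i <;> fin_cases j
      · exact hK.cont11
      · exact hK.cont12.neg_fst
      · exact hK.cont21.neg_snd.neg
      · exact (ContinuousOn.neg_snd (f := fun z w => K.L22 (-z) w) hK.cont22.neg_fst).neg
    · fin_cases i <;> fin_cases j
      · exact e11.1 hK.eq11
      · exact e12.1 hK.eq12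
      · exact e21.1 hK.eq21
      · exact e22.1 hK.eq22
    · have hw' := neg_mem_spaceI hw
      have h1 := hK.bdry11 w hw
      have h2 := hK.bdry12 w hw
      have h3 := hK.bdry21 (-w) hw'
      have h4 := hK.bdry22 (-w) hw'
      have hc := h.c_eq (-w) hw'
      rw [← h.lam_eq w hw, ← h.mu_eq w hw, ← h.b_eq w hw] at h2
      rw [← h.lam_eq _ hw', ← h.mu_eq _ hw', ← hc, neg_neg] at h3
      fin_cases i <;> fin_cases j <;> simp [Kernels.toMatrix]
      · exact h1
      · exact h2
      · rw [h3, neg_neg, add_comm]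
      · simpa using h4
  · intro hK
    refine ⟨hK.cont 0 0, ?_, ?_, ?_, e11.2 (hK.eqn 0 0), e12.2 (hK.eqn 0 1), e22.2 (hK.eqn 1 1),
      e21.2 (hK.eqn 1 0), fun w hw => ?_, fun w hw => ?_, fun w hw => ?_, fun w hw => ?_⟩
    · simpa [Kernels.toMatrix] using (hK.cont 0 1).neg_fst
    · simpa [Kernels.toMatrix] using (hK.cont 1 0).neg_snd.fun_neg
    · simpa [Kernels.toMatrix] using (ContinuousOn.neg_snd
        (f := fun z w => K.toMatrix 1 1 (-z) w) (hK.cont 1 1).neg_fst).fun_neg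
    · simpa [Kernels.toMatrix] using hK.bdry 0 0 w hw
    · have := hK.bdry 0 1 w hw
      rw [← h.lam_eq w hw, ← h.mu_eq w hw, ← h.b_eq w hw]
      simpa [Kernels.toMatrix] using this
    · have := hK.bdry 1 1 (-w) (neg_mem_spaceI hw)
      simpa [Kernels.toMatrix] using this
    · have := hK.bdry 1 0 (-w) (neg_mem_spaceI hw)
      rw [← h.lam_eq w hw, ← h.mu_eq w hw, ← h.c_eq w hw, add_comm (S.v w)]
      simp [Kernels.toMatrix] at this
      rw [← this, neg_neg]

end SystemData

/-- Existence and uniqueness of the matrix kernel. -/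
theorem exists_unique_isCharKernel (S : Speed) {c : Fin 2 → ℝ → ℝ} (hc : ∀ i, Continuous (c i)) :
    ∃ M, IsCharKernel S c M ∧ ∀ M', IsCharKernel S c M' →
      ∀ i j z w, (z, w) ∈ kernelDomain → M' i j z w = M i j z w := by
  let a : Fin 2 → ℝ → ℝ := fun j z => -(S.v z * c j.rev (-z)) / S.v (-z)
  let n : Fin 2 → Fin 2 → ℝ → ℝ := fun i j w =>
    S.v (-w) * if i = j then 0 else c i w / (S.v w + S.v (-w))
  have hS := S.cont
  have ha : ∀ j, Continuous (a j) := fun j => by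
    have := hc j.rev
    exact Continuous.div (by fun_prop) (by fun_prop) fun z => S.ne _
  have hn : ∀ i j, Continuous (n i j) := fun i j => by
    have := hc i
    refine Continuous.mul (by fun_prop) ?_
    split_ifs
    · exact continuous_const
    · exact Continuous.div (by fun_prop) (by fun_prop) fun w =>
        (add_pos (S.pos _) (S.pos _)).ne'
  choose N hN hNeq hNun using fun i => S.exists_unique_lineIntegral_system ha (hn i)
  have hNM : ∀ i j z w, S.v z * (N i j z w / S.v z) = N i j z w := fun i j z w =>
    mul_div_cancel₀ _ (S.ne z)
  refine ⟨fun i j z w => N i j z w / S.v z, ⟨fun i j => ?_, fun i j => ?_, fun i j w hw => ?_⟩,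
    fun M' hM' i j z w hzw => ?_⟩
  · exact ((hN i j).div (by fun_prop) fun x => S.ne _).continuousOn
  · simp only [hNM]
    have hR : Continuous fun x : ℝ × ℝ => a j x.1 * N i j.rev (-x.1) x.2 :=
      ((ha j).comp continuous_fst).mul
        ((hN i j.rev).comp (f := fun x : ℝ × ℝ => (-x.1, x.2)) (by fun_prop))
    refine (S.solvesAlong_of_eq_lineIntegral hR (hNeq i j)).congr (fun _ _ => rfl)
      (fun _ _ => rfl) (fun _ _ _ => rfl) fun z w _ => ?_
    simp only [a]
    ring
  · have hm : (-w, w) ∈ kernelDomain := by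
      rw [mem_kernelDomain_iff, abs_neg]
      exact ⟨le_rfl, mem_spaceI_iff.1 hw⟩
    simp only [hNeq i j _ _ hm, S.entry_neg_self, Speed.lineIntegral,
      intervalIntegral.integral_same, add_zero, n]
    rw [mul_div_assoc, mul_comm, div_mul_cancel₀ _ (S.ne _)]
  · have := hNun i (fun j z w => S.v z * M' i j z w)
      (fun j => (hS.comp continuous_fst).continuousOn.mul (hM'.cont i j))
      (fun j z w hzw => by
        have hc' : ContinuousOn (fun x : ℝ × ℝ =>
            -(S.v x.1 * c j.rev (-x.1)) * M' i j.rev (-x.1) x.2) kernelDomain := by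
          have := hc j.rev
          exact ContinuousOn.mul (by fun_prop) (hM'.cont i j.rev).neg_fst
        have h1 := (hM'.eqn i j).eq_lineIntegral hc' hzw
        have hw0 : S.entry z w ∈ spaceI := by
          have := S.mem_kernelDomain_iff_entry.1 hzw
          have h2 := abs_le.1 this.1
          have h3 := mem_uIcc.1 this.2
          rcases h3 with h3 | h3 <;> constructor <;> linarith
        rw [h1, hM'.bdry i j _ hw0]
        congr 1
        refine S.lineIntegral_congr hzw fun z w _ => ?_
        simp only [a]
        field_simp [S.ne (-z)]) j z w hzw
    beta_reduce
    rw [← this, mul_div_cancel_left₀ _ (S.ne z)]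

theorem SystemData.exists_unique_kernels {lam mu b c : ℝ → ℝ} {S : Speed} {C : Fin 2 → ℝ → ℝ}
    (h : SystemData lam mu b c S C) :
    ∃ K : Kernels, K.IsSolution lam mu b c ∧
      ∀ K' : Kernels, K'.IsSolution lam mu b c → K'.AgreeOn K := by
  obtain ⟨M, hM, hun⟩ := exists_unique_isCharKernel S h.cont
  refine ⟨Kernels.ofMatrix M, (h.isSolution_iff _).2 (by rwa [Kernels.toMatrix_ofMatrix]),
    fun K' hK' x hx => ?_⟩
  have e := hun _ ((h.isSolution_iff _).1 hK')
  obtain ⟨z, w⟩ := x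
  have h1 := neg_mem_kernelDomain_iff.2 hx
  have h2 := mem_neg_kernelDomain_iff.2 hx
  have h3 := mem_neg_kernelDomain_iff.2 h1
  have e1 := e 0 0 _ _ hx
  have e2 := e 0 1 _ _ h1
  have e3 := e 1 0 _ _ h2
  have e4 := e 1 1 _ _ h3
  simp only [Kernels.toMatrix, Matrix.cons_val_zero, Matrix.cons_val_one, neg_neg] at e1 e2 e3 e4
  refine ⟨e1, e2, ?_, ?_⟩
  · simp only [Kernels.ofMatrix, ← e3, neg_neg]
  · simp only [Kernels.ofMatrix, ← e4, neg_neg]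

/-- The signed indicator function of the kernel domain: `1` for `|z| ≤ w` and `-1` for
`|z| ≤ -w`. -/
noncomputable def wedge (z w : ℝ) : ℝ := if |z| ≤ w then 1 else if |z| ≤ -w then -1 else 0

lemma measurable_wedge : Measurable fun x : ℝ × ℝ => wedge x.1 x.2 := by
  unfold wedge
  refine Measurable.ite (measurableSet_le (by fun_prop) (by fun_prop)) measurable_const
    (Measurable.ite (measurableSet_le (by fun_prop) (by fun_prop)) measurable_const
      measurable_const)

lemma abs_wedge_le (z w : ℝ) : |wedge z w| ≤ 1 := by
  unfold wedge
  split_ifs <;> simp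

lemma wedge_of_lt {z w : ℝ} (h : |w| < |z|) : wedge z w = 0 := by
  rw [wedge, if_neg (not_le.2 ((le_abs_self w).trans_lt h)),
    if_neg (not_le.2 ((neg_le_abs w).trans_lt h))]

lemma wedge_of_nonneg {z w : ℝ} (h : |z| ≤ |w|) (hw : 0 ≤ w) : wedge z w = 1 := by
  rw [abs_of_nonneg hw] at h
  rw [wedge, if_pos h]

lemma wedge_of_neg {z w : ℝ} (h : |z| ≤ |w|) (hw : w < 0) : wedge z w = -1 := by
  rw [abs_of_neg hw] at h
  rw [wedge, if_neg (not_le.2 (hw.trans_le (abs_nonneg _))), if_pos h]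

lemma wedge_neg_fst (z w : ℝ) : wedge (-z) w = wedge z w := by simp [wedge]

lemma ae_abs_ne (z : ℝ) (s : Set ℝ) : ∀ᵐ w ∂volume.restrict s, |z| ≠ |w| := by
  refine ae_restrict_of_ae ?_
  have : ∀ᵐ w : ℝ, w ∉ ({z, -z} : Set ℝ) :=
    measure_eq_zero_iff_ae_notMem.1 ((Set.toFinite _).measure_zero volume)
  filter_upwards [this] with w hw h
  rcases abs_eq_abs.1 h with h | h <;> simp [h] at hw

lemma continuousAt_wedge_fst {z w : ℝ} (h : |z| ≠ |w|) :
    ContinuousAt (fun z => wedge z w) z := by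
  have hc : Continuous fun z : ℝ => |z| := continuous_abs
  rcases lt_or_gt_of_ne h with h | h
  · have : (fun z => wedge z w) =ᶠ[nhds z] fun _ => wedge z w := by
      filter_upwards [hc.continuousAt.eventually_lt continuousAt_const h] with z' hz'
      rcases le_or_gt 0 w with hw | hw
      · rw [wedge_of_nonneg h.le hw, wedge_of_nonneg hz'.le hw]
      · rw [wedge_of_neg h.le hw, wedge_of_neg hz'.le hw]
    exact continuousAt_const.congr this.symm
  · have : (fun z => wedge z w) =ᶠ[nhds z] fun _ => 0 := by
      filter_upwards [continuousAt_const.eventually_lt hc.continuousAt h] with z' hz'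
      exact wedge_of_lt hz'
    exact continuousAt_const.congr this.symm

lemma continuousAt_wedge_snd {z w : ℝ} (h : |z| ≠ |w|) :
    ContinuousAt (fun w => wedge z w) w := by
  have hc : Continuous fun z : ℝ => |z| := continuous_abs
  rcases lt_or_gt_of_ne h with h | h
  · have : (fun w => wedge z w) =ᶠ[nhds w] fun _ => wedge z w := by
      rcases lt_trichotomy w 0 with hw | hw | hw
      · filter_upwards [continuousAt_const.eventually_lt hc.continuousAt h,
          eventually_lt_nhds hw] with w' hw' hw0
        rw [wedge_of_neg h.le hw, wedge_of_neg hw'.le hw0]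
      · rw [hw, abs_zero] at h
        exact absurd h (not_lt.2 (abs_nonneg z))
      · filter_upwards [continuousAt_const.eventually_lt hc.continuousAt h,
          eventually_gt_nhds hw] with w' hw' hw0
        rw [wedge_of_nonneg h.le hw.le, wedge_of_nonneg hw'.le (le_of_lt hw0)]
    exact continuousAt_const.congr this.symm
  · have : (fun w => wedge z w) =ᶠ[nhds w] fun _ => 0 := by
      filter_upwards [hc.continuousAt.eventually_lt continuousAt_const h] with w' hw'
      exact wedge_of_lt hw'
    exact continuousAt_const.congr this.symm

lemma continuous_integral_wedge_mul {g : ℝ → ℝ → ℝ}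
    (hg : Continuous fun x : ℝ × ℝ => g x.1 x.2) :
    Continuous fun z => ∫ w in spaceI, wedge z w * g z w := by
  refine continuous_iff_continuousAt.2 fun z₀ => ?_
  obtain ⟨B, hB⟩ := ((isCompact_Icc (a := z₀ - 1) (b := z₀ + 1)).prod
    (isCompact_Icc (a := (-1 : ℝ)) (b := 1))).exists_bound_of_continuousOn hg.continuousOn
  have hgz : ∀ z, Continuous (g z) := fun z => hg.comp (f := fun w => (z, w)) (by fun_prop)
  refine continuousAt_of_dominated (bound := fun _ => B) ?_ ?_
    (integrable_const _) ?_
  · refine Filter.Eventually.of_forall fun z => ?_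
    exact ((measurable_wedge.comp (measurable_const.prodMk measurable_id)).mul
      (hgz z).measurable).aestronglyMeasurable
  · filter_upwards [Icc_mem_nhds (show z₀ - 1 < z₀ by linarith) (show z₀ < z₀ + 1 by linarith)]
      with z hz
    refine (ae_restrict_iff' measurableSet_Icc).2 (ae_of_all _ fun w hw => ?_)
    have h1 := hB (z, w) ⟨hz, hw⟩
    have h2 := abs_wedge_le z w
    rw [norm_mul, Real.norm_eq_abs]
    calc _ ≤ 1 * B := mul_le_mul h2 h1 (norm_nonneg _) zero_le_one
      _ = B := one_mul _
  · filter_upwards [ae_abs_ne z₀ spaceI] with w hw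
    exact (continuousAt_wedge_fst hw).mul
      (hg.comp (f := fun z => (z, w)) (by fun_prop)).continuousAt

namespace Speed

variable (S : Speed)

lemma setIntegral_div_speed (g : ℝ → ℝ) :
    ∫ w in spaceI, g w / S.v w = ∫ x in Icc (S.phi (-1)) (S.phi 1), g (S.psi x) := by
  have him : S.phi '' spaceI = Icc (S.phi (-1)) (S.phi 1) := by
    ext x
    simp only [mem_image, spaceI, mem_Icc]
    constructor
    · rintro ⟨w, ⟨h1, h2⟩, rfl⟩
      exact ⟨S.phi_strictMono.monotone h1, S.phi_strictMono.monotone h2⟩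
    · rintro ⟨h1, h2⟩
      exact ⟨S.psi x, ⟨S.le_psi_iff.2 h1, S.psi_le_iff.2 h2⟩, S.phi_psi x⟩
  rw [← him, integral_image_eq_integral_abs_deriv_smul measurableSet_Icc
    (fun w _ => (S.phi_hasDerivAt w).hasDerivWithinAt) S.phi_strictMono.injective.injOn]
  refine setIntegral_congr_fun measurableSet_Icc fun w _ => ?_
  simp only [psi_phi, smul_eq_mul, abs_of_pos (one_div_pos.2 (S.pos w))]
  ring

/-- The signed indicator of the kernel domain in travel time coordinates. -/
noncomputable def wedgeT (r x : ℝ) : ℝ :=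
  (Icc (S.phi (-1)) (S.phi 1)).indicator (fun x => wedge (S.psi r) (S.psi x)) x

lemma measurable_wedgeT : Measurable fun x : ℝ × ℝ => S.wedgeT x.1 x.2 := by
  have h1 := S.psi_continuous.measurable
  have h2 : Measurable fun x : ℝ × ℝ => wedge (S.psi x.1) (S.psi x.2) :=
    measurable_wedge.comp (f := fun x : ℝ × ℝ => (S.psi x.1, S.psi x.2)) (by fun_prop)
  exact Measurable.ite (measurableSet_Icc.preimage measurable_snd) h2 measurable_const

lemma abs_wedgeT_le (r x : ℝ) : |S.wedgeT r x| ≤ 1 := by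
  rw [wedgeT, indicator]
  split_ifs
  · exact abs_wedge_le _ _
  · simp

lemma wedgeT_of_notMem {r x : ℝ} (h : x ∉ Icc (S.phi (-1)) (S.phi 1)) : S.wedgeT r x = 0 :=
  indicator_of_notMem h _

lemma phi_neg_ungap_add (η : ℝ) : S.phi (-S.ungap η) + η = S.phi (S.ungap η) := by
  have := S.gap_ungap η
  rw [gap] at this
  linarith

lemma wedgeT_line_of_pos {r η : ℝ} (hη : 0 < η) : S.wedgeT r (r + η) =
    (Icc (S.phi (-S.ungap η)) (S.phi 1 - η)).indicator 1 r := by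
  have hlt : S.psi r < S.psi (r + η) := S.psi_strictMono (by linarith)
  have h0 : 0 < S.phi (S.ungap η) := by
    rw [← S.phi_zero, S.phi_strictMono.lt_iff_lt, ← S.ungap_zero]
    exact S.ungap_strictMono hη
  have h1 : S.phi (-1) ≤ 0 := by
    rw [← S.phi_zero]; exact S.phi_strictMono.monotone (by norm_num)
  have he := S.phi_neg_ungap_add η
  have key : |S.psi r| ≤ S.psi (r + η) ↔ S.phi (-S.ungap η) ≤ r := by
    rw [abs_le, and_iff_left hlt.le, ← S.entry_le_iff, entry_psi, le_psi_iff, ← he]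
    exact add_le_add_iff_right η
  have hn : ¬ |S.psi r| ≤ -S.psi (r + η) := fun h => by
    have := (abs_le.1 h).1
    linarith
  by_cases hr : r ∈ Icc (S.phi (-S.ungap η)) (S.phi 1 - η)
  · have hm : r + η ∈ Icc (S.phi (-1)) (S.phi 1) := ⟨by linarith [hr.1], by linarith [hr.2]⟩
    rw [indicator_of_mem hr, wedgeT, indicator_of_mem hm,
      wedge, if_pos (key.2 hr.1), Pi.one_apply]
  · rw [indicator_of_notMem hr, wedgeT, indicator]
    split_ifs with hx
    · rw [wedge, if_neg, if_neg hn]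
      exact fun h => hr ⟨key.1 h, by linarith [hx.2]⟩
    · rfl

lemma wedgeT_line_of_neg {r η : ℝ} (hη : η < 0) : S.wedgeT r (r + η) =
    (Icc (S.phi (-1) - η) (S.phi (-S.ungap η))).indicator (-1) r := by
  have hlt : S.psi (r + η) < S.psi r := S.psi_strictMono (by linarith)
  have h0 : S.phi (S.ungap η) < 0 := by
    rw [← S.phi_zero, S.phi_strictMono.lt_iff_lt, ← S.ungap_zero]
    exact S.ungap_strictMono hη
  have h1 : 0 ≤ S.phi 1 := by
    rw [← S.phi_zero]; exact S.phi_strictMono.monotone (by norm_num)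
  have he := S.phi_neg_ungap_add η
  have key : |S.psi r| ≤ -S.psi (r + η) ↔ r ≤ S.phi (-S.ungap η) := by
    rw [abs_le, neg_neg, and_iff_right hlt.le, ← S.le_entry_iff, entry_psi, psi_le_iff, ← he]
    exact add_le_add_iff_right η
  have hn : ¬ |S.psi r| ≤ S.psi (r + η) := fun h => by
    have := (abs_le.1 h).2
    linarith
  by_cases hr : r ∈ Icc (S.phi (-1) - η) (S.phi (-S.ungap η))
  · have hm : r + η ∈ Icc (S.phi (-1)) (S.phi 1) := ⟨by linarith [hr.1], by linarith [hr.2]⟩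
    rw [indicator_of_mem hr, wedgeT, indicator_of_mem hm,
      wedge, if_neg hn, if_pos (key.2 hr.2)]
    rfl
  · rw [indicator_of_notMem hr, wedgeT, indicator]
    split_ifs with hx
    · rw [wedge, if_neg hn, if_neg]
      exact fun h => hr ⟨by linarith [hx.1], key.1 h⟩
    · rfl

end Speed

lemma setIntegral_indicator_one_mul {a p q y : ℝ} (hap : a ≤ p) (g : ℝ → ℝ) :
    ∫ r in Icc a y, (Icc p q).indicator 1 r * g r = ∫ r in Icc p (min y q), g r := by
  have : (fun r => (Icc p q).indicator (1 : ℝ → ℝ) r * g r) = (Icc p q).indicator g := by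
    funext r
    by_cases hr : r ∈ Icc p q <;> simp [hr]
  rw [this, setIntegral_indicator measurableSet_Icc, Icc_inter_Icc, sup_eq_right.2 hap]

namespace Speed

variable (S : Speed)

lemma line_mem_kernelDomain_of_pos {r η : ℝ} (hη : 0 < η)
    (hr : r ∈ Icc (S.phi (-S.ungap η)) (S.phi 1 - η)) :
    (S.psi r, S.psi (r + η)) ∈ kernelDomain := by
  have he := S.phi_neg_ungap_add η
  have h0 : 0 < S.ungap η := by rw [← S.ungap_zero]; exact S.ungap_strictMono hη
  have h1 : S.ungap η ≤ S.psi (r + η) := S.le_psi_iff.2 (by linarith [hr.1])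
  have h2 : S.psi (r + η) ≤ 1 := S.psi_le_iff.2 (by linarith [hr.2])
  rw [S.mem_kernelDomain_iff_entry, entry_psi, abs_le, mem_uIcc]
  exact ⟨⟨by linarith, h2⟩, Or.inl ⟨h0.le, h1⟩⟩

lemma line_mem_kernelDomain_of_neg {r η : ℝ} (hη : η < 0)
    (hr : r ∈ Icc (S.phi (-1) - η) (S.phi (-S.ungap η))) :
    (S.psi r, S.psi (r + η)) ∈ kernelDomain := by
  have he := S.phi_neg_ungap_add η
  have h0 : S.ungap η < 0 := by rw [← S.ungap_zero]; exact S.ungap_strictMono hη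
  have h1 : S.psi (r + η) ≤ S.ungap η := S.psi_le_iff.2 (by linarith [hr.2])
  have h2 : -1 ≤ S.psi (r + η) := S.le_psi_iff.2 (by linarith [hr.1])
  rw [S.mem_kernelDomain_iff_entry, entry_psi, abs_le, mem_uIcc]
  exact ⟨⟨h2, by linarith⟩, Or.inr ⟨h1, h0.le⟩⟩

lemma phi_neg_ungap_le_iff {η y : ℝ} : S.phi (-S.ungap η) ≤ y ↔ S.gap (-S.psi y) ≤ η := by
  rw [← S.le_psi_iff, ← S.le_ungap_iff, neg_le]

/-- Balance along one characteristic: what is present at `y` has entered through the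
anti-diagonal or through the bottom of the domain, and has not left it. -/
lemma line_balance {f k : ℝ → ℝ → ℝ} (h : SolvesAlongCharacteristics S.v S.v f k)
    (hk : Continuous fun x : ℝ × ℝ => k x.1 x.2) {y η : ℝ}
    (hy : y ∈ Icc (S.phi (-1)) (S.phi 1)) (h0 : η ≠ 0) (hb : η ≠ S.phi 1 - y)
    (he : η ≠ S.gap (-S.psi y)) :
    S.wedgeT y (y + η) * f (S.psi y) (S.psi (y + η)) =
      (∫ r in Icc (S.phi (-1)) y, S.wedgeT r (r + η) * k (S.psi r) (S.psi (r + η))) +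
      (Icc (S.gap (-S.psi y)) (S.gap 1)).indicator
        (fun η => f (-S.ungap η) (S.ungap η)) η -
      (Icc (S.phi 1 - y) (S.gap 1)).indicator (fun η => f (S.psi (S.phi 1 - η)) 1) η -
      (Icc (S.phi (-1) - y) 0).indicator (fun η => f (S.psi (S.phi (-1) - η)) (-1)) η := by
  set a := S.phi (-1)
  set b := S.phi 1
  set e := S.phi (-S.ungap η) with hedef
  have hgap1 : S.gap 1 = b - a := rfl
  have hee : e + η = S.phi (S.ungap η) := S.phi_neg_ungap_add η
  have hentry : f (-S.ungap η) (S.ungap η) = f (S.psi e) (S.psi (e + η)) := by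
    rw [hee, hedef, psi_phi, psi_phi]
  have hey : y ≠ e := fun hh => he (by
    have : S.psi y = -S.ungap η := by rw [hh, hedef, psi_phi]
    rw [this, neg_neg, gap_ungap])
  have ftc := fun {p q : ℝ} hpq => h.sub_eq_integral hk.continuousOn (η := η) (a := p) (b := q) hpq
  have hset : ∀ {p q : ℝ}, p ≤ q → ∫ r in Icc p q, k (S.psi r) (S.psi (r + η)) =
      ∫ r in p..q, k (S.psi r) (S.psi (r + η)) := fun hpq => by
    rw [intervalIntegral.integral_of_le hpq, integral_Icc_eq_integral_Ioc]
  have hset0 : ∀ {p q : ℝ}, q < p → ∫ r in Icc p q, k (S.psi r) (S.psi (r + η)) = 0 :=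
    fun hpq => by rw [Icc_eq_empty (not_le.2 hpq)]; simp
  have hub : S.ungap η ≤ 1 ↔ η ≤ b - a := S.ungap_le_iff
  have hlb : -1 ≤ S.ungap η ↔ -(b - a) ≤ η := by
    rw [S.le_ungap_iff, gap_neg, hgap1]
  rcases lt_or_gt_of_ne h0 with hneg | hpos
  · have hT1 : (∫ r in Icc a y, S.wedgeT r (r + η) * k (S.psi r) (S.psi (r + η))) =
        -∫ r in Icc (a - η) (min y e), k (S.psi r) (S.psi (r + η)) := by
      rw [← setIntegral_indicator_one_mul (a := a) (by linarith), ← integral_neg]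
      refine integral_congr_ae (ae_of_all _ fun r => ?_)
      simp only [S.wedgeT_line_of_neg hneg, ← neg_mul]
      congr 1
      by_cases hr : r ∈ Icc (a - η) e
      · rw [indicator_of_mem hr, indicator_of_mem hr]; rfl
      · rw [indicator_of_notMem hr, indicator_of_notMem hr, neg_zero]
    have hi3 : η ∉ Icc (b - y) (S.gap 1) := fun hh => by linarith [hh.1, hy.2]
    rw [hT1, S.wedgeT_line_of_neg hneg, indicator_of_notMem hi3]
    have hbot : f (S.psi (a - η)) (-1) = f (S.psi (a - η)) (S.psi (a - η + η)) := by
      rw [sub_add_cancel, psi_phi]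
    have hple : a - η ≤ e ↔ -(b - a) ≤ η := by
      have := S.phi_strictMono.le_iff_le (a := -1) (b := S.ungap η)
      rw [← hlb, ← this, ← hee]
      constructor <;> intro <;> linarith
    rcases lt_or_ge y (a - η) with h1 | h1
    · have hi1 : y ∉ Icc (a - η) e := fun hh => by linarith [hh.1]
      have hi4 : η ∉ Icc (a - y) 0 := fun hh => by linarith [hh.1]
      have hi2 : η ∉ Icc (S.gap (-S.psi y)) (S.gap 1) := fun hh => by
        have h2 : e ≤ y := S.phi_neg_ungap_le_iff.2 hh.1
        by_cases hc : -(b - a) ≤ η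
        · linarith [hple.2 hc]
        · linarith [hh.1, gap_neg S (S.psi y), S.gap_strictMono.monotone
            (S.psi_le_iff.2 hy.2 : S.psi y ≤ 1)]
      rw [indicator_of_notMem hi1, indicator_of_notMem hi4, indicator_of_notMem hi2,
        hset0 ((min_le_left _ _).trans_lt h1)]
      ring
    · have hc : -(b - a) ≤ η := by linarith [hy.2]
      have hi4 : η ∈ Icc (a - y) 0 := ⟨by linarith, hneg.le⟩
      rw [indicator_of_mem hi4, hbot]
      rcases lt_or_gt_of_ne hey with h2 | h2
      · have hi1 : y ∈ Icc (a - η) e := ⟨h1, h2.le⟩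
        have hi2 : η ∉ Icc (S.gap (-S.psi y)) (S.gap 1) := fun hh =>
          absurd (S.phi_neg_ungap_le_iff.2 hh.1) (not_le.2 h2)
        rw [indicator_of_mem hi1, indicator_of_notMem hi2, min_eq_left h2.le, hset h1, ← ftc]
        · simp only [Pi.neg_apply, Pi.one_apply]; ring
        · intro r hr
          rw [uIcc_of_le h1] at hr
          exact S.line_mem_kernelDomain_of_neg hneg ⟨hr.1, hr.2.trans h2.le⟩
      · have hi1 : y ∉ Icc (a - η) e := fun hh => by linarith [hh.2]
        have hi2 : η ∈ Icc (S.gap (-S.psi y)) (S.gap 1) :=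
          ⟨S.phi_neg_ungap_le_iff.1 h2.le, by linarith [hy.1, hy.2]⟩
        rw [indicator_of_notMem hi1, indicator_of_mem hi2, min_eq_right h2.le, hset (hple.2 hc),
          ← ftc, hentry]
        · ring
        · intro r hr
          rw [uIcc_of_le (hple.2 hc)] at hr
          exact S.line_mem_kernelDomain_of_neg hneg hr
  · have hae : a ≤ e ↔ η ≤ b - a := by
      rw [← hub, hedef, S.phi_strictMono.le_iff_le, neg_le_neg_iff]
    have hi4 : η ∉ Icc (a - y) 0 := fun hh => by linarith [hh.2]
    rw [S.wedgeT_line_of_pos hpos, indicator_of_notMem hi4]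
    by_cases hc : η ≤ b - a
    · have hT1 : (∫ r in Icc a y, S.wedgeT r (r + η) * k (S.psi r) (S.psi (r + η))) =
          ∫ r in Icc e (min y (b - η)), k (S.psi r) (S.psi (r + η)) := by
        rw [← setIntegral_indicator_one_mul (hae.2 hc)]
        simp only [S.wedgeT_line_of_pos hpos]
        rfl
      have htop : f (S.psi (b - η)) 1 = f (S.psi (b - η)) (S.psi (b - η + η)) := by
        rw [sub_add_cancel, psi_phi]
      have hle : e ≤ b - η := by
        have := S.phi_strictMono.monotone (hub.2 hc)
        rw [← hee] at this
        linarith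
      rw [hT1]
      rcases lt_or_gt_of_ne hey with h2 | h2
      · have hi1 : y ∉ Icc e (b - η) := fun hh => by linarith [hh.1]
        have hi2 : η ∉ Icc (S.gap (-S.psi y)) (S.gap 1) := fun hh =>
          absurd (S.phi_neg_ungap_le_iff.2 hh.1) (not_le.2 h2)
        have hi3 : η ∉ Icc (b - y) (S.gap 1) := fun hh => by linarith [hh.1]
        rw [indicator_of_notMem hi1, indicator_of_notMem hi2, indicator_of_notMem hi3,
          hset0 ((min_le_left _ _).trans_lt h2)]
        ring
      · have hi2 : η ∈ Icc (S.gap (-S.psi y)) (S.gap 1) :=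
          ⟨S.phi_neg_ungap_le_iff.1 h2.le, by linarith⟩
        rw [indicator_of_mem hi2, hentry]
        rcases lt_or_ge (b - η) y with h3 | h3
        · have hi1 : y ∉ Icc e (b - η) := fun hh => by linarith [hh.2]
          have hi3 : η ∈ Icc (b - y) (S.gap 1) := ⟨by linarith, by linarith⟩
          rw [indicator_of_notMem hi1, indicator_of_mem hi3, min_eq_right h3.le, hset hle, ← ftc,
            htop]
          · ring
          · intro r hr
            rw [uIcc_of_le hle] at hr
            exact S.line_mem_kernelDomain_of_pos hpos hr
        · have hi1 : y ∈ Icc e (b - η) := ⟨h2.le, h3⟩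
          have hi3 : η ∉ Icc (b - y) (S.gap 1) := fun hh =>
            hb (le_antisymm (by linarith) hh.1)
          rw [indicator_of_mem hi1, indicator_of_notMem hi3, min_eq_left h3, hset h2.le, ← ftc]
          · simp only [Pi.one_apply]; ring
          · intro r hr
            rw [uIcc_of_le h2.le] at hr
            exact S.line_mem_kernelDomain_of_pos hpos ⟨hr.1, hr.2.trans h3⟩
    · have hnc : ∀ r, r ∉ Icc e (b - η) := fun r hr => by
        have h3 : e ≤ b - η := hr.1.trans hr.2
        have h4 : S.phi (S.ungap η) ≤ S.phi 1 := by rw [← hee]; linarith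
        exact hc (hub.1 (S.phi_strictMono.le_iff_le.1 h4))
      have hi2 : η ∉ Icc (S.gap (-S.psi y)) (S.gap 1) := fun hh => hc hh.2
      have hi3 : η ∉ Icc (b - y) (S.gap 1) := fun hh => hc hh.2
      have hT1 : (∫ r in Icc a y, S.wedgeT r (r + η) * k (S.psi r) (S.psi (r + η))) = 0 := by
        rw [← integral_zero ℝ ℝ]
        refine setIntegral_congr_fun measurableSet_Icc fun r _ => ?_
        simp only [S.wedgeT_line_of_pos hpos]
        rw [indicator_of_notMem (hnc r), zero_mul]
      rw [hT1, indicator_of_notMem (hnc y), indicator_of_notMem hi2, indicator_of_notMem hi3]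
      ring

end Speed

lemma integral_add_sub_sub {α : Type*} [MeasurableSpace α] {μ : Measure α} {A B C D : α → ℝ}
    (hA : Integrable A μ) (hB : Integrable B μ) (hC : Integrable C μ) (hD : Integrable D μ) :
    ∫ x, (A x + B x - C x - D x) ∂μ =
      (∫ x, A x ∂μ) + (∫ x, B x ∂μ) - (∫ x, C x ∂μ) - ∫ x, D x ∂μ :=
  (integral_sub ((hA.add hB).sub hC) hD).trans
    (congrArg (fun t => t - _) ((integral_sub (hA.add hB) hC).trans
      (congrArg (fun t => t - _) (integral_add hA hB))))

namespace Speed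

variable (S : Speed)

lemma integral_wedgeT_mul (r : ℝ) (g : ℝ → ℝ) :
    ∫ x, S.wedgeT r x * g x =
      ∫ x in Icc (S.phi (-1)) (S.phi 1), wedge (S.psi r) (S.psi x) * g x := by
  rw [← integral_indicator measurableSet_Icc]
  congr 1
  funext x
  by_cases hx : x ∈ Icc (S.phi (-1)) (S.phi 1)
  · rw [indicator_of_mem hx, wedgeT, indicator_of_mem hx]
  · rw [indicator_of_notMem hx, wedgeT_of_notMem S hx, zero_mul]

lemma integrable_line {k : ℝ → ℝ → ℝ} (hk : Continuous fun x : ℝ × ℝ => k x.1 x.2) {y : ℝ}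
    (hy : y ∈ Icc (S.phi (-1)) (S.phi 1)) :
    Integrable (fun x : ℝ × ℝ => S.wedgeT x.2 (x.2 + x.1) * k (S.psi x.2) (S.psi (x.2 + x.1)))
      (volume.prod (volume.restrict (Icc (S.phi (-1)) y))) := by
  set a := S.phi (-1)
  set b := S.phi 1
  have hpsi := S.psi_continuous
  have hk' : Continuous fun x : ℝ × ℝ => k (S.psi x.1) (S.psi x.2) :=
    hk.comp (f := fun x : ℝ × ℝ => (S.psi x.1, S.psi x.2)) (by fun_prop)
  obtain ⟨B, hB⟩ := ((isCompact_Icc (a := a) (b := b)).prod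
    (isCompact_Icc (a := a) (b := b))).exists_bound_of_continuousOn hk'.continuousOn
  have hB0 : 0 ≤ B := (norm_nonneg _).trans (hB (y, y) ⟨hy, hy⟩)
  have hg : Integrable (fun x : ℝ × ℝ => (Icc (a - b) (b - a)).indicator (fun _ => B) x.1)
      (volume.prod (volume.restrict (Icc a y))) :=
    ((integrable_indicator_iff measurableSet_Icc).2 (integrableOn_const (by simp))).comp_fst _
  refine hg.mono' ?_ ?_
  · have h1 : Measurable fun x : ℝ × ℝ => S.wedgeT x.2 (x.2 + x.1) :=
      S.measurable_wedgeT.comp (f := fun x : ℝ × ℝ => (x.2, x.2 + x.1)) (by fun_prop)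
    have h2 : Continuous fun x : ℝ × ℝ => k (S.psi x.2) (S.psi (x.2 + x.1)) :=
      hk'.comp (f := fun x : ℝ × ℝ => (x.2, x.2 + x.1)) (by fun_prop)
    exact (h1.mul h2.measurable).aestronglyMeasurable
  · have hm : ∀ᵐ x : ℝ × ℝ ∂(volume.prod (volume.restrict (Icc a y))), x.2 ∈ Icc a y :=
      Measure.quasiMeasurePreserving_snd.ae (ae_restrict_mem measurableSet_Icc)
    filter_upwards [hm] with x hx
    by_cases hxm : x.2 + x.1 ∈ Icc a b
    · have hx1 : x.1 ∈ Icc (a - b) (b - a) :=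
        ⟨by linarith [hxm.1, hx.2, hy.2], by linarith [hxm.2, hx.1]⟩
      rw [indicator_of_mem hx1, norm_mul, Real.norm_eq_abs]
      calc _ ≤ 1 * B := mul_le_mul (S.abs_wedgeT_le _ _)
            (hB (x.2, x.2 + x.1) ⟨⟨hx.1, hx.2.trans hy.2⟩, hxm⟩) (norm_nonneg _) zero_le_one
        _ = B := one_mul B
    · rw [S.wedgeT_of_notMem hxm, zero_mul, norm_zero]
      exact indicator_nonneg (fun _ _ => hB0) _

/-- The rate of change of the integral of `f` over the sections of the kernel domain, when `k` is
the derivative of `f` along the characteristics. -/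
noncomputable def sectionRate (f k : ℝ → ℝ → ℝ) (z : ℝ) : ℝ :=
  (∫ w in spaceI, wedge z w * (k z w / S.v w)) + f z (-z) * (1 + S.v z / S.v (-z)) -
    f z 1 - f z (-1)

lemma continuous_sectionRate {f k : ℝ → ℝ → ℝ} (hf : Continuous fun x : ℝ × ℝ => f x.1 x.2)
    (hk : Continuous fun x : ℝ × ℝ => k x.1 x.2) : Continuous (S.sectionRate f k) := by
  have hS := S.cont
  have h1 := continuous_integral_wedge_mul (g := fun z w => k z w / S.v w)
    (hk.div (by fun_prop) fun x => S.ne _)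
  have h2 : Continuous fun z : ℝ => 1 + S.v z / S.v (-z) :=
    continuous_const.add (hS.div (by fun_prop) fun x => S.ne _)
  have h3 : Continuous fun z : ℝ => f z (-z) := hf.comp (f := fun z => (z, -z)) (by fun_prop)
  have h4 : Continuous fun z : ℝ => f z 1 := hf.comp (f := fun z => (z, 1)) (by fun_prop)
  have h5 : Continuous fun z : ℝ => f z (-1) := hf.comp (f := fun z => (z, -1)) (by fun_prop)
  exact ((h1.add (h3.mul h2)).sub h4).sub h5

lemma integral_section_eq {f k : ℝ → ℝ → ℝ} (h : SolvesAlongCharacteristics S.v S.v f k)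
    (hf : Continuous fun x : ℝ × ℝ => f x.1 x.2) (hk : Continuous fun x : ℝ × ℝ => k x.1 x.2)
    {y : ℝ} (hy : y ∈ Icc (S.phi (-1)) (S.phi 1)) :
    ∫ w in spaceI, wedge (S.psi y) w * (f (S.psi y) w / S.v w) =
      ∫ r in S.phi (-1)..y, S.sectionRate f k (S.psi r) := by
  have hpsi := S.psi_continuous
  have hug := S.ungap_continuous
  have hS := S.cont
  have hswitch : ∀ (g : ℝ → ℝ → ℝ) (r : ℝ),
      ∫ w in spaceI, wedge (S.psi r) w * (g (S.psi r) w / S.v w) =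
      ∫ x, S.wedgeT r x * g (S.psi r) (S.psi x) := fun g r => by
    rw [S.integral_wedgeT_mul]
    simp_rw [← mul_div_assoc]
    exact S.setIntegral_div_speed _
  have hmc : Continuous fun η => f (-S.ungap η) (S.ungap η) :=
    hf.comp (f := fun η => (-S.ungap η, S.ungap η)) (by fun_prop)
  have htc : ∀ c, Continuous fun η => f (S.psi (c - η)) 1 := fun c =>
    hf.comp (f := fun η => (S.psi (c - η), 1)) (by fun_prop)
  have hbc : ∀ c, Continuous fun η => f (S.psi (c - η)) (-1) := fun c =>
    hf.comp (f := fun η => (S.psi (c - η), -1)) (by fun_prop)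
  set a := S.phi (-1)
  set b := S.phi 1
  have hgap1 : S.gap 1 = b - a := rfl
  have hy1 : S.psi y ≤ 1 := S.psi_le_iff.2 hy.2
  have hy0 : -1 ≤ S.psi y := S.le_psi_iff.2 hy.1
  have hgy : S.gap (-S.psi y) ≤ S.gap 1 := S.gap_strictMono.monotone (by linarith)
  -- the contribution of the interior
  have hint := S.integrable_line hk hy
  have hT1i := hint.integral_prod_left
  have hT1 : ∫ η, ∫ r in Icc a y, S.wedgeT r (r + η) * k (S.psi r) (S.psi (r + η)) =
      ∫ r in a..y, ∫ w in spaceI, wedge (S.psi r) w * (k (S.psi r) w / S.v w) := by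
    rw [integral_integral_swap hint, intervalIntegral.integral_of_le hy.1,
      ← integral_Icc_eq_integral_Ioc]
    refine integral_congr_ae (ae_of_all _ fun r => ?_)
    beta_reduce
    rw [hswitch]
    exact integral_add_left_eq_self (fun x => S.wedgeT r x * k (S.psi r) (S.psi x)) r
  -- the contributions of the boundary
  have hind : ∀ {g : ℝ → ℝ} {p q : ℝ}, Continuous g → Integrable ((Icc p q).indicator g) :=
    fun hg => (integrable_indicator_iff measurableSet_Icc).2
      (hg.continuousOn.integrableOn_compact isCompact_Icc)
  have hindI : ∀ {g : ℝ → ℝ} {p q : ℝ}, p ≤ q →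
      ∫ η, (Icc p q).indicator g η = ∫ η in p..q, g η := fun hpq => by
    rw [integral_indicator measurableSet_Icc, integral_Icc_eq_integral_Ioc,
      intervalIntegral.integral_of_le hpq]
  have hT2 : ∫ η, (Icc (S.gap (-S.psi y)) (S.gap 1)).indicator
      (fun η => f (-S.ungap η) (S.ungap η)) η =
      ∫ r in a..y, f (S.psi r) (-S.psi r) * (1 + S.v (S.psi r) / S.v (-S.psi r)) := by
    rw [hindI hgy]
    have hd : ∀ r ∈ uIcc y a, HasDerivAt (fun r => S.gap (-S.psi r))
        ((1 / S.v (-S.psi r) + 1 / S.v (S.psi r)) * -S.v (S.psi r)) r := fun r _ => by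
      have := (S.gap_hasDerivAt (-S.psi r)).comp r (S.psi_hasDerivAt r).fun_neg
      rwa [neg_neg] at this
    have hd' : Continuous fun r =>
        (1 / S.v (-S.psi r) + 1 / S.v (S.psi r)) * -S.v (S.psi r) := by
      refine Continuous.mul (Continuous.add ?_ ?_) (by fun_prop)
      · exact continuous_const.div (by fun_prop) fun r => S.ne _
      · exact continuous_const.div (by fun_prop) fun r => S.ne _
    have := intervalIntegral.integral_comp_mul_deriv hd hd'.continuousOn hmc
    have ha : S.psi a = -1 := S.psi_phi _
    rw [ha, neg_neg] at this
    rw [← this, intervalIntegral.integral_symm, ← intervalIntegral.integral_neg]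
    refine intervalIntegral.integral_congr fun r _ => ?_
    simp only [Function.comp, ungap_gap, neg_neg]
    have h1 := S.ne (S.psi r)
    field_simp
    ring
  have hT3 : ∫ η, (Icc (b - y) (S.gap 1)).indicator (fun η => f (S.psi (b - η)) 1) η =
      ∫ r in a..y, f (S.psi r) 1 := by
    rw [hgap1, hindI (by linarith [hy.1]),
      intervalIntegral.integral_comp_sub_left (fun r => f (S.psi r) 1)]
    simp
  have hT4 : ∫ η, (Icc (a - y) 0).indicator (fun η => f (S.psi (a - η)) (-1)) η =
      ∫ r in a..y, f (S.psi r) (-1) := by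
    rw [hindI (by linarith [hy.1]),
      intervalIntegral.integral_comp_sub_left (fun r => f (S.psi r) (-1))]
    simp
  have hae : ∀ᵐ η : ℝ, η ∉ ({0, b - y, S.gap (-S.psi y)} : Set ℝ) :=
    measure_eq_zero_iff_ae_notMem.1 ((Set.toFinite _).measure_zero volume)
  have hmain : ∫ w in spaceI, wedge (S.psi y) w * (f (S.psi y) w / S.v w) = ∫ η,
      ((∫ r in Icc a y, S.wedgeT r (r + η) * k (S.psi r) (S.psi (r + η))) +
      (Icc (S.gap (-S.psi y)) (S.gap 1)).indicator
        (fun η => f (-S.ungap η) (S.ungap η)) η -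
      (Icc (b - y) (S.gap 1)).indicator (fun η => f (S.psi (b - η)) 1) η -
      (Icc (a - y) 0).indicator (fun η => f (S.psi (a - η)) (-1)) η) := by
    rw [hswitch, ← integral_add_left_eq_self _ y]
    refine integral_congr_ae ?_
    filter_upwards [hae] with η hη
    simp only [mem_insert_iff, mem_singleton_iff, not_or] at hη
    exact S.line_balance h hk hy hη.1 hη.2.1 hη.2.2
  have hc1 : Continuous fun r =>
      ∫ w in spaceI, wedge (S.psi r) w * (k (S.psi r) w / S.v w) :=
    (continuous_integral_wedge_mul (g := fun z w => k z w / S.v w)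
      (hk.div (by fun_prop) fun x => S.ne _)).comp hpsi
  have hc2 : Continuous fun r =>
      f (S.psi r) (-S.psi r) * (1 + S.v (S.psi r) / S.v (-S.psi r)) :=
    (hf.comp (f := fun r => (S.psi r, -S.psi r)) (by fun_prop)).mul
      (continuous_const.add (Continuous.div (by fun_prop) (by fun_prop) fun x => S.ne _))
  have hc3 : Continuous fun r => f (S.psi r) 1 :=
    hf.comp (f := fun r => (S.psi r, 1)) (by fun_prop)
  have hc4 : Continuous fun r => f (S.psi r) (-1) :=
    hf.comp (f := fun r => (S.psi r, -1)) (by fun_prop)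
  rw [hmain]
  refine (integral_add_sub_sub hT1i (hind hmc) (hind (htc b)) (hind (hbc a))).trans ?_
  rw [hT2, hT3, hT4]
  refine (congrArg (fun t => t + _ - _ - _) hT1).trans ?_
  simp only [intervalIntegral.integral_of_le hy.1]
  exact (integral_add_sub_sub hc1.integrableOn_Ioc hc2.integrableOn_Ioc hc3.integrableOn_Ioc
    hc4.integrableOn_Ioc).symm

/-- Differentiation of an integral over the sections of the kernel domain. -/
theorem hasDerivWithinAt_integral_section {f k : ℝ → ℝ → ℝ}
    (h : SolvesAlongCharacteristics S.v S.v f k)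
    (hf : Continuous fun x : ℝ × ℝ => f x.1 x.2) (hk : Continuous fun x : ℝ × ℝ => k x.1 x.2)
    {z : ℝ} (hz : z ∈ spaceI) :
    HasDerivWithinAt (fun z => ∫ w in spaceI, wedge z w * (f z w / S.v w))
      (S.sectionRate f k z / S.v z) spaceI z := by
  have hc : Continuous fun r => S.sectionRate f k (S.psi r) :=
    (S.continuous_sectionRate hf hk).comp S.psi_continuous
  have h1 := (intervalIntegral.integral_hasDerivAt_right
    (hc.intervalIntegrable (S.phi (-1)) (S.phi z)) (hc.stronglyMeasurableAtFilter _ _)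
    hc.continuousAt).comp z (S.phi_hasDerivAt z)
  rw [psi_phi, mul_one_div] at h1
  have key : ∀ z ∈ spaceI, ∫ w in spaceI, wedge z w * (f z w / S.v w) =
      ∫ r in S.phi (-1)..S.phi z, S.sectionRate f k (S.psi r) := fun z hz => by
    rw [← S.integral_section_eq h hf hk ⟨S.phi_strictMono.monotone hz.1,
      S.phi_strictMono.monotone hz.2⟩, psi_phi]
  exact h1.hasDerivWithinAt.congr key (key z hz)

end Speed

lemma memLp_of_continuousOn {f : ℝ → ℝ} (hf : ContinuousOn f spaceI) :
    MemLp f 2 (volume.restrict spaceI) := by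
  obtain ⟨B, hB⟩ := (isCompact_Icc (a := (-1 : ℝ)) (b := 1)).exists_bound_of_continuousOn hf
  exact MemLp.of_bound (hf.aestronglyMeasurable measurableSet_Icc) B
    ((ae_restrict_iff' measurableSet_Icc).2 (ae_of_all _ hB))

open Classical in
/-- The class of a square integrable function, and zero for other functions. -/
noncomputable def toL2 (f : ℝ → ℝ) : L2I :=
  if h : MemLp f 2 (volume.restrict spaceI) then h.toLp f else 0

lemma coeFn_toL2 {f : ℝ → ℝ} (h : MemLp f 2 (volume.restrict spaceI)) :
    toL2 f =ᵐ[volume.restrict spaceI] f := by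
  rw [toL2, dif_pos h]
  exact h.coeFn_toLp

lemma toL2_add {f g : ℝ → ℝ} (hf : MemLp f 2 (volume.restrict spaceI))
    (hg : MemLp g 2 (volume.restrict spaceI)) : toL2 (f + g) = toL2 f + toL2 g := by
  rw [toL2, toL2, toL2, dif_pos hf, dif_pos hg, dif_pos (hf.add hg), MemLp.toLp_add]

lemma toL2_const_smul {f : ℝ → ℝ} (r : ℝ) (hf : MemLp f 2 (volume.restrict spaceI)) :
    toL2 (r • f) = r • toL2 f := by
  rw [toL2, toL2, dif_pos hf, dif_pos (hf.const_smul r), MemLp.toLp_const_smul]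

lemma toL2_congr {f g : ℝ → ℝ} (h : ∀ z ∈ spaceI, f z = g z) : toL2 f = toL2 g := by
  have hae : f =ᵐ[volume.restrict spaceI] g :=
    (ae_restrict_iff' measurableSet_Icc).2 (ae_of_all _ h)
  by_cases hf : MemLp f 2 (volume.restrict spaceI)
  · have hg := (memLp_congr_ae hae).1 hf
    rw [toL2, toL2, dif_pos hf, dif_pos hg]
    exact (MemLp.toLp_eq_toLp_iff hf hg).2 hae
  · rw [toL2, toL2, dif_neg hf, dif_neg fun hg => hf ((memLp_congr_ae hae).2 hg)]

/-- The norm of the constant function `1` in `L²([-1, 1])`. -/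
noncomputable def normOne : ℝ :=
  (measureUnivNNReal (volume.restrict spaceI) : ℝ) ^ (2 : ENNReal).toReal⁻¹

lemma normOne_nonneg : 0 ≤ normOne := Real.rpow_nonneg NNReal.zero_le_coe _

lemma norm_L2_le_of_ae_bound {f : L2I} {B : ℝ} (hB : 0 ≤ B)
    (h : ∀ᵐ z ∂volume.restrict spaceI, |f z| ≤ B) : ‖f‖ ≤ normOne * B := by
  exact Lp.norm_le_of_ae_bound (f := f) hB (by simpa only [Real.norm_eq_abs] using h)

lemma norm_toL2_le {f : ℝ → ℝ} (hf : MemLp f 2 (volume.restrict spaceI)) {B : ℝ} (hB : 0 ≤ B)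
    (h : ∀ z ∈ spaceI, |f z| ≤ B) : ‖toL2 f‖ ≤ normOne * B := by
  refine norm_L2_le_of_ae_bound hB ?_
  filter_upwards [coeFn_toL2 hf, ae_restrict_mem measurableSet_Icc] with z hz hzI
  rw [hz]
  exact h z hzI

/-- The pairing of an `L²` function with a function on `[-1, 1]`. -/
noncomputable def pairing (X : L2I) (f : ℝ → ℝ) : ℝ := ∫ z in spaceI, X z * f z

lemma inner_toL2 (X : L2I) {f : ℝ → ℝ} (hf : MemLp f 2 (volume.restrict spaceI)) :
    inner ℝ X (toL2 f) = pairing X f := by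
  rw [L2.inner_def, pairing]
  refine integral_congr_ae ?_
  filter_upwards [coeFn_toL2 hf] with z hz
  rw [hz, RCLike.inner_apply, mul_comm]
  simp

lemma pairing_congr (X : L2I) {f g : ℝ → ℝ} (h : ∀ z ∈ spaceI, f z = g z) :
    pairing X f = pairing X g :=
  setIntegral_congr_fun measurableSet_Icc fun z hz => by simp only [h z hz]

lemma integrable_L2_mul (X : L2I) {f : ℝ → ℝ} (hf : MemLp f 2 (volume.restrict spaceI)) :
    Integrable (fun z => X z * f z) (volume.restrict spaceI) :=
  (Lp.memLp X).integrable_mul hf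

lemma pairing_add (X : L2I) {f g : ℝ → ℝ} (hf : MemLp f 2 (volume.restrict spaceI))
    (hg : MemLp g 2 (volume.restrict spaceI)) :
    pairing X (fun z => f z + g z) = pairing X f + pairing X g := by
  simp only [pairing, mul_add]
  exact integral_add (integrable_L2_mul X hf) (integrable_L2_mul X hg)

lemma pairing_mul_const (X : L2I) (f : ℝ → ℝ) (r : ℝ) :
    pairing X (fun z => f z * r) = pairing X f * r := by
  simp only [pairing, ← mul_assoc]
  exact integral_mul_const _ _

lemma L2I_integrable (X : L2I) : Integrable X (volume.restrict spaceI) :=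
  (Lp.memLp X).integrable (by norm_num)

/-- A bounded measurable kernel on the square whose sections depend continuously on the parameter,
almost everywhere. -/
structure L2Kernel where
  k : ℝ → ℝ → ℝ
  meas : Measurable fun x : ℝ × ℝ => k x.1 x.2
  C : ℝ
  bound : ∀ z w, |k z w| ≤ C
  cont_snd : ∀ w, ∀ᵐ z ∂volume.restrict spaceI, ContinuousAt (fun w => k z w) w
  cont_fst : ∀ z, ∀ᵐ w ∂volume.restrict spaceI, ContinuousAt (fun z => k z w) z

namespace L2Kernel

variable (K : L2Kernel)

/-- The transposed kernel. -/
def swap : L2Kernel where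
  k := fun z w => K.k w z
  meas := K.meas.comp measurable_swap
  C := K.C
  bound := fun z w => K.bound w z
  cont_snd := K.cont_fst
  cont_fst := K.cont_snd

lemma C_nonneg : 0 ≤ K.C := (abs_nonneg _).trans (K.bound 0 0)

lemma meas_fst (w : ℝ) : Measurable fun z => K.k z w :=
  K.meas.comp (f := fun z => (z, w)) (by fun_prop)

lemma memLp_section (w : ℝ) : MemLp (fun z => K.k z w) 2 (volume.restrict spaceI) :=
  MemLp.of_bound (K.meas_fst w).aestronglyMeasurable K.C (ae_of_all _ fun z => K.bound z w)

/-- The integral operator with kernel `K`, as a function. -/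
noncomputable def app (X : L2I) (w : ℝ) : ℝ := pairing X fun z => K.k z w

lemma app_continuous (X : L2I) : Continuous (K.app X) := by
  refine continuous_iff_continuousAt.2 fun w₀ => ?_
  refine continuousAt_of_dominated (bound := fun z => |X z| * K.C)
    (Filter.Eventually.of_forall fun w => (integrable_L2_mul X (K.memLp_section w)).1)
    (Filter.Eventually.of_forall fun w => ae_of_all _ fun z => ?_)
    ((L2I_integrable X).abs.mul_const _) ?_
  · rw [norm_mul, Real.norm_eq_abs, Real.norm_eq_abs]
    exact mul_le_mul_of_nonneg_left (K.bound z w) (abs_nonneg _)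
  · filter_upwards [K.cont_snd w₀] with z hz
    exact continuousAt_const.mul hz

lemma app_memLp (X : L2I) : MemLp (K.app X) 2 (volume.restrict spaceI) :=
  memLp_of_continuousOn (K.app_continuous X).continuousOn

lemma abs_app_le (X : L2I) (w : ℝ) : |K.app X w| ≤ normOne * K.C * ‖X‖ := by
  rw [app, ← inner_toL2 X (K.memLp_section w)]
  refine (abs_real_inner_le_norm _ _).trans ?_
  rw [mul_comm]
  exact mul_le_mul_of_nonneg_right
    (norm_toL2_le (K.memLp_section w) K.C_nonneg fun z _ => K.bound z w) (norm_nonneg _)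

/-- The integral operator with kernel `K` on `L²([-1, 1])`. -/
noncomputable def op : L2I →L[ℝ] L2I :=
  LinearMap.mkContinuous
    { toFun := fun X => toL2 (K.app X)
      map_add' := fun X Y => by
        rw [← toL2_add (K.app_memLp X) (K.app_memLp Y)]
        refine toL2_congr fun w _ => ?_
        rw [Pi.add_apply, app, app, app, ← inner_toL2 _ (K.memLp_section w),
          ← inner_toL2 _ (K.memLp_section w), ← inner_toL2 _ (K.memLp_section w), inner_add_left]
      map_smul' := fun r X => by
        rw [RingHom.id_apply, ← toL2_const_smul r (K.app_memLp X)]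
        refine toL2_congr fun w _ => ?_
        rw [Pi.smul_apply, app, app, ← inner_toL2 _ (K.memLp_section w),
          ← inner_toL2 _ (K.memLp_section w), real_inner_smul_left, smul_eq_mul] }
    (normOne * (normOne * K.C)) fun X => by
      have := norm_toL2_le (K.app_memLp X)
        (mul_nonneg (mul_nonneg normOne_nonneg K.C_nonneg) (norm_nonneg X))
        (fun z _ => K.abs_app_le X z)
      rw [mul_assoc]
      exact this

lemma op_apply (X : L2I) : K.op X = toL2 (K.app X) := rfl

lemma inner_op (X Y : L2I) : inner ℝ (K.op X) Y = inner ℝ X (K.swap.op Y) := by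
  rw [op_apply, op_apply, inner_toL2 X (K.swap.app_memLp Y), real_inner_comm,
    inner_toL2 Y (K.app_memLp X)]
  simp only [pairing, app, swap, ← integral_const_mul]
  have hint : Integrable (Function.uncurry fun z w => Y z * (X w * K.k w z))
      ((volume.restrict spaceI).prod (volume.restrict spaceI)) := by
    have h1 := (L2I_integrable Y).mul_prod (L2I_integrable X)
    refine ((h1.bdd_mul (f := fun x : ℝ × ℝ => K.k x.2 x.1) (c := K.C)
      (K.meas.comp measurable_swap).aestronglyMeasurable
      (ae_of_all _ fun x => K.bound _ _))).congr (ae_of_all _ fun x => ?_)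
    simp only [Function.uncurry]
    ring
  rw [integral_integral_swap hint]
  refine integral_congr_ae (ae_of_all _ fun z => integral_congr_ae (ae_of_all _ fun w => ?_))
  simp only
  ring

end L2Kernel

/-- The state space of pairs of square integrable functions. -/
abbrev StateL2 : Type := PiLp 2 fun _ : Fin 2 => L2I

/-- Matrix kernels. -/
abbrev MatKernel : Type := Fin 2 → Fin 2 → L2Kernel

namespace MatKernel

/-- The transposed matrix kernel. -/
def swap (K : MatKernel) : MatKernel := fun i j => (K j i).swap

variable (K : MatKernel)

/-- The matrix integral operator, as a function. -/
noncomputable def app (X : StateL2) (i : Fin 2) (w : ℝ) : ℝ := ∑ j, (K i j).app (X j) w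

lemma app_continuous (X : StateL2) (i : Fin 2) : Continuous (K.app X i) :=
  continuous_finsetSum _ fun j _ => (K i j).app_continuous (X j)

lemma app_memLp (X : StateL2) (i : Fin 2) : MemLp (K.app X i) 2 (volume.restrict spaceI) :=
  memLp_of_continuousOn (K.app_continuous X i).continuousOn

/-- The matrix integral operator on the state space. -/
noncomputable def op : StateL2 →L[ℝ] StateL2 :=
  ((PiLp.continuousLinearEquiv 2 ℝ fun _ : Fin 2 => L2I).symm.toContinuousLinearMap.comp
    (ContinuousLinearMap.pi fun i =>
      ∑ j, (K i j).op.comp (ContinuousLinearMap.proj j))).comp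
    (PiLp.continuousLinearEquiv 2 ℝ fun _ : Fin 2 => L2I).toContinuousLinearMap

lemma op_apply_eq_sum (X : StateL2) (i : Fin 2) : K.op X i = ∑ j, (K i j).op (X j) := by
  simp [op]

lemma op_apply (X : StateL2) (i : Fin 2) : K.op X i = toL2 (K.app X i) := by
  rw [op_apply_eq_sum, Fin.sum_univ_two, L2Kernel.op_apply, L2Kernel.op_apply,
    ← toL2_add ((K i 0).app_memLp _) ((K i 1).app_memLp _)]
  refine toL2_congr fun w _ => ?_
  rw [app, Fin.sum_univ_two, Pi.add_apply]

lemma adjoint_op : ContinuousLinearMap.adjoint K.op = K.swap.op := by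
  symm
  rw [ContinuousLinearMap.eq_adjoint_iff]
  intro X Y
  simp only [PiLp.inner_apply, op_apply_eq_sum, Fin.sum_univ_two, inner_add_left, inner_add_right,
    swap, L2Kernel.inner_op]
  have : ∀ k : L2Kernel, k.swap.swap = k := fun _ => rfl
  simp only [this]
  ring

end MatKernel

lemma setIntegral_abs_pow (n : ℕ) {t : ℝ} (ht : 0 ≤ t) :
    ∫ z in Icc (-t) t, |z| ^ n = 2 * (t ^ (n + 1) / (n + 1)) := by
  have h0 : ∫ z in (0 : ℝ)..t, |z| ^ n = t ^ (n + 1) / (n + 1) := by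
    have : ∫ z in (0 : ℝ)..t, |z| ^ n = ∫ z in (0 : ℝ)..t, z ^ n := by
      refine intervalIntegral.integral_congr fun z hz => ?_
      rw [uIcc_of_le ht] at hz
      simp only [abs_of_nonneg hz.1]
    rw [this, integral_pow]
    simp
  have h1 : ∫ z in (-t)..0, |z| ^ n = t ^ (n + 1) / (n + 1) := by
    rw [← h0, ← neg_zero, ← intervalIntegral.integral_comp_neg (fun z => |z| ^ n)]
    simp
  have hi : ∀ a b : ℝ, IntervalIntegrable (fun z : ℝ => |z| ^ n) volume a b := fun a b =>
    Continuous.intervalIntegrable (by fun_prop) _ _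
  rw [integral_Icc_eq_integral_Ioc, ← intervalIntegral.integral_of_le (by linarith),
    ← intervalIntegral.integral_add_adjacent_intervals (hi _ 0) (hi 0 _), h0, h1]
  ring

namespace MatKernel

variable (K : MatKernel)

lemma abs_app_le_of_volterra (hK : ∀ i j z w, |w| < |z| → (K i j).k z w = 0) {B : ℝ}
    (hKB : ∀ i j, (K i j).C ≤ B) {X : StateL2} {A : ℝ} {n : ℕ}
    (hX : ∀ j, ∀ᵐ z ∂volume.restrict spaceI, |X j z| ≤ A * |z| ^ n) (i : Fin 2) {w : ℝ}
    (hw : w ∈ spaceI) : |K.app X i w| ≤ 4 * B * A / (n + 1) * |w| ^ (n + 1) := by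
  have hA : 0 ≤ A := by
    by_contra hneg
    push Not at hneg
    have : ∀ᵐ z ∂volume.restrict spaceI, False := by
      filter_upwards [hX 0, ae_abs_ne 0 spaceI] with z hz hz0
      have h1 : 0 < |z| ^ n := pow_pos (lt_of_le_of_ne (abs_nonneg z) (by simpa using hz0)) n
      have := mul_neg_of_neg_of_pos hneg h1
      linarith [abs_nonneg (X 0 z)]
    rw [ae_iff] at this
    simp [spaceI] at this
    norm_num at this
  have key : ∀ j, |(K i j).app (X j) w| ≤ B * A * (2 * (|w| ^ (n + 1) / (n + 1))) := fun j => by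
    rw [← setIntegral_abs_pow n (abs_nonneg w), ← integral_const_mul]
    have hsub : Icc (-|w|) |w| ⊆ spaceI := fun z hz => by
      rw [mem_spaceI_iff]
      exact (abs_le.2 hz).trans (mem_spaceI_iff.1 hw)
    have e : (K i j).app (X j) w = ∫ z in Icc (-|w|) |w|, X j z * (K i j).k z w := by
      rw [L2Kernel.app, pairing]
      refine setIntegral_eq_of_subset_of_forall_sdiff_eq_zero measurableSet_Icc hsub fun z hz => ?_
      rw [hK i j z w, mul_zero]
      by_contra hcon
      exact hz.2 (abs_le.1 (not_lt.1 hcon))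
    rw [e, ← Real.norm_eq_abs]
    refine norm_integral_le_of_norm_le
      ((Continuous.continuousOn (by fun_prop)).integrableOn_compact isCompact_Icc) ?_
    filter_upwards [ae_mono (Measure.restrict_mono hsub le_rfl) (hX j)] with z hz
    rw [norm_mul, Real.norm_eq_abs, Real.norm_eq_abs]
    calc _ ≤ A * |z| ^ n * B := mul_le_mul hz (((K i j).bound z w).trans (hKB i j))
          (abs_nonneg _) (by positivity)
      _ = B * A * |z| ^ n := by ring
  rw [app, Fin.sum_univ_two]
  refine (abs_add_le _ _).trans ((add_le_add (key 0) (key 1)).trans (le_of_eq ?_))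
  ring

lemma norm_le_of_ae_bound {X : StateL2} {A : ℝ} (hA : 0 ≤ A)
    (hX : ∀ j, ∀ᵐ z ∂volume.restrict spaceI, |X j z| ≤ A) : ‖X‖ ≤ 2 * normOne * A := by
  have h := fun j => norm_L2_le_of_ae_bound hA (hX j)
  have h0 : 0 ≤ normOne * A := mul_nonneg normOne_nonneg hA
  have h2 := PiLp.norm_sq_eq_of_L2 (fun _ : Fin 2 => L2I) X
  rw [Fin.sum_univ_two] at h2
  have h3 : ‖X‖ ^ 2 ≤ (2 * normOne * A) ^ 2 := by
    rw [h2]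
    nlinarith [h 0, h 1, norm_nonneg (X 0), norm_nonneg (X 1)]
  exact (abs_le_of_sq_le_sq' h3 (by linarith)).2

/-- The identity minus a matrix integral operator of Volterra type is invertible. -/
theorem isUnit_one_sub_op (hK : ∀ i j z w, |w| < |z| → (K i j).k z w = 0) :
    IsUnit (1 - K.op) := by
  obtain ⟨B, hB, hKB⟩ : ∃ B, 0 ≤ B ∧ ∀ i j, (K i j).C ≤ B :=
    ⟨∑ i, ∑ j, (K i j).C, Finset.sum_nonneg fun i _ => Finset.sum_nonneg fun j _ =>
      (K i j).C_nonneg, fun i j =>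
      (Finset.single_le_sum (f := fun j => (K i j).C) (fun j _ => (K i j).C_nonneg)
        (Finset.mem_univ j)).trans (Finset.single_le_sum (f := fun i => ∑ j, (K i j).C)
        (fun i _ => Finset.sum_nonneg fun j _ => (K i j).C_nonneg) (Finset.mem_univ i))⟩
  set D := 2 * (normOne * B) with hD
  have hD0 : 0 ≤ D := mul_nonneg zero_le_two (mul_nonneg normOne_nonneg hB)
  have hiter : ∀ (X : StateL2) (n : ℕ) (j : Fin 2), ∀ᵐ z ∂volume.restrict spaceI,
      |(K.op ^ (n + 1)) X j z| ≤ D * ‖X‖ * (4 * B) ^ n / n.factorial * |z| ^ n := by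
    intro X n
    induction n with
    | zero =>
      intro j
      rw [zero_add, pow_one, op_apply]
      filter_upwards [coeFn_toL2 (K.app_memLp X j)] with z hz
      rw [hz, app, Fin.sum_univ_two]
      have h1 : ∀ l, |(K j l).app (X l) z| ≤ normOne * B * ‖X‖ := fun l => by
        refine ((K j l).abs_app_le (X l) z).trans ?_
        have := normOne_nonneg
        have := hKB j l
        have := PiLp.norm_apply_le X l
        gcongr
      refine (abs_add_le _ _).trans ((add_le_add (h1 0) (h1 1)).trans (le_of_eq ?_))
      simp [hD]
      ring
    | succ n ih =>
      intro j
      rw [pow_succ', mul_apply_eq_comp, op_apply]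
      filter_upwards [coeFn_toL2 (K.app_memLp ((K.op ^ (n + 1)) X) j),
        ae_restrict_mem measurableSet_Icc] with z hz hzI
      rw [hz]
      refine (K.abs_app_le_of_volterra hK hKB ih j hzI).trans (le_of_eq ?_)
      rw [Nat.factorial_succ]
      push_cast
      field_simp
      ring
  have hnorm : ∀ n : ℕ, ‖K.op ^ (n + 1)‖ ≤ 2 * normOne * D * ((4 * B) ^ n / n.factorial) := by
    intro n
    have h0 := normOne_nonneg
    refine ContinuousLinearMap.opNorm_le_bound _ (by positivity) fun X => ?_
    have h1 : ∀ j, ∀ᵐ z ∂volume.restrict spaceI,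
        |(K.op ^ (n + 1)) X j z| ≤ D * ‖X‖ * (4 * B) ^ n / n.factorial := fun j => by
      filter_upwards [hiter X n j, ae_restrict_mem measurableSet_Icc] with z hz hzI
      refine hz.trans (mul_le_of_le_one_right (by positivity) ?_)
      exact pow_le_one₀ (abs_nonneg _) (mem_spaceI_iff.1 hzI)
    refine (norm_le_of_ae_bound (by positivity) h1).trans (le_of_eq ?_)
    ring
  obtain ⟨n, hn⟩ : ∃ n : ℕ, ‖K.op ^ (n + 1)‖ < 1 := by
    have ht := (FloorSemiring.tendsto_pow_div_factorial_atTop (4 * B)).const_mul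
      (2 * normOne * D)
    rw [mul_zero] at ht
    obtain ⟨n, hn⟩ := (ht.eventually_lt_const one_pos).exists
    exact ⟨n, (hnorm n).trans_lt hn⟩
  have hu : IsUnit (1 - K.op ^ (n + 1)) := isUnit_one_sub_of_norm_lt_one hn
  have hcomm : Commute (1 - K.op) (∑ i ∈ Finset.range (n + 1), K.op ^ i) :=
    Commute.sum_right _ _ _ fun i _ => (Commute.one_left _).sub_left (Commute.self_pow _ _)
  rw [← mul_neg_geom_sum] at hu
  exact (hcomm.isUnit_mul_iff.1 hu).1

theorem isUnit_one_sub_swap_op (hK : ∀ i j z w, |w| < |z| → (K i j).k z w = 0) :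
    IsUnit (1 - K.swap.op) := by
  have := (K.isUnit_one_sub_op hK).star
  rw [ContinuousLinearMap.star_eq_adjoint, map_sub, adjoint_op] at this
  convert! this using 2
  exact ContinuousLinearMap.adjoint_id.symm

end MatKernel

lemma integrable_wedge_mul {g : ℝ → ℝ} (hg : Continuous g) (z : ℝ) :
    Integrable (fun w => wedge z w * g w) (volume.restrict spaceI) :=
  (hg.continuousOn.integrableOn_compact isCompact_Icc).bdd_mul (c := 1)
    (measurable_wedge.comp (f := fun w => (z, w)) (by fun_prop)).aestronglyMeasurable
    (ae_of_all _ fun w => abs_wedge_le z w)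

/-- The kernel `wedge * m` for a bounded continuous function `m`. -/
noncomputable def L2Kernel.ofContinuous (m : ℝ → ℝ → ℝ)
    (hm : Continuous fun x : ℝ × ℝ => m x.1 x.2) (C : ℝ) (hC : ∀ z w, |m z w| ≤ C) :
    L2Kernel where
  k := fun z w => wedge z w * m z w
  meas := measurable_wedge.mul hm.measurable
  C := C
  bound := fun z w => by
    rw [abs_mul]
    calc _ ≤ 1 * C := mul_le_mul (abs_wedge_le z w) (hC z w) (abs_nonneg _) zero_le_one
      _ = C := one_mul C
  cont_snd := fun w => by
    filter_upwards [ae_abs_ne w spaceI] with z hz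
    exact (continuousAt_wedge_snd (Ne.symm hz)).mul
      (hm.comp (f := fun w => (z, w)) (by fun_prop)).continuousAt
  cont_fst := fun z => by
    filter_upwards [ae_abs_ne z spaceI] with w hw
    exact (continuousAt_wedge_fst hw).mul
      (hm.comp (f := fun z => (z, w)) (by fun_prop)).continuousAt

/-- A matrix kernel extended to a bounded continuous function on the plane. -/
structure ExtendedKernel (S : Speed) (c : Fin 2 → ℝ → ℝ) where
  M : Fin 2 → Fin 2 → ℝ → ℝ → ℝ
  isChar : IsCharKernel S c M
  cont : ∀ i j, Continuous fun x : ℝ × ℝ => M i j x.1 x.2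
  C : ℝ
  bound : ∀ i j z w, |M i j z w| ≤ C
  cont_coupling : ∀ i, Continuous (c i)

lemma IsCharKernel.exists_extendedKernel {S : Speed} {c : Fin 2 → ℝ → ℝ}
    {M : Fin 2 → Fin 2 → ℝ → ℝ → ℝ} (h : IsCharKernel S c M) (hc : ∀ i, Continuous (c i)) :
    ∃ E : ExtendedKernel S c, ∀ i j z w, (z, w) ∈ kernelDomain → E.M i j z w = M i j z w := by
  choose B hB using fun i j =>
    isCompact_kernelDomain.exists_bound_of_continuousOn (h.cont i j)
  have hBn : ∀ i j, 0 ≤ B i j := fun i j =>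
    (norm_nonneg _).trans (hB i j _ (kernelRetract_mem (0, 0)))
  have he : ∀ i j z w, (z, w) ∈ kernelDomain →
      M i j (kernelRetract (z, w)).1 (kernelRetract (z, w)).2 = M i j z w := fun i j z w hzw => by
    rw [kernelRetract_of_mem hzw]
  refine ⟨⟨fun i j z w => M i j (kernelRetract (z, w)).1 (kernelRetract (z, w)).2,
    ⟨fun i j => ?_, fun i j => ?_, fun i j w hw => ?_⟩, fun i j => ?_,
    ∑ i, ∑ j, B i j, fun i j z w => ?_, hc⟩, he⟩
  · exact (h.cont i j).comp_kernelRetract.continuousOn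
  · refine (h.eqn i j).congr (fun _ _ => rfl) (fun _ _ => rfl) (fun z w hzw => ?_)
      fun z w hzw => ?_
    · rw [he i j z w hzw]
    · rw [he i j.rev (-z) w (neg_mem_kernelDomain_iff.2 hzw)]
  · rw [he i j, h.bdry i j w hw]
    rw [mem_kernelDomain_iff, abs_neg]
    exact ⟨le_rfl, mem_spaceI_iff.1 hw⟩
  · exact (h.cont i j).comp_kernelRetract
  · refine (hB i j _ (kernelRetract_mem (z, w))).trans ?_
    exact (Finset.single_le_sum (f := fun j => B i j) (fun j _ => hBn i j)
        (Finset.mem_univ j)).trans (Finset.single_le_sum (f := fun i => ∑ j, B i j)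
        (fun i _ => Finset.sum_nonneg fun j _ => hBn i j) (Finset.mem_univ i))

/-- `q` is a pair of admissible test functions for the equation `X_t + S X_w = …` with a boundary
condition at `-1`, and `dq` is the derivative of `S q`. -/
structure IsTestPair (S : Speed) (q dq : Fin 2 → ℝ → ℝ) : Prop where
  cont : ∀ i, Continuous (q i)
  cont_deriv : ∀ i, Continuous (dq i)
  deriv : ∀ i, ∀ w ∈ spaceI, HasDerivWithinAt (fun w => S.v w * q i w) (dq i w) spaceI w
  zero : ∀ i, q i 1 = 0

namespace ExtendedKernel

variable {S : Speed} {c : Fin 2 → ℝ → ℝ} (E : ExtendedKernel S c)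

/-- The kernel of the backstepping transformation. -/
noncomputable def ker : MatKernel := fun i j =>
  L2Kernel.ofContinuous (E.M i j) (E.cont i j) E.C (E.bound i j)

lemma ker_eq_zero (i j : Fin 2) (z w : ℝ) (h : |w| < |z|) : (E.ker i j).k z w = 0 := by
  change wedge z w * E.M i j z w = 0
  rw [wedge_of_lt h, zero_mul]

/-- The transpose of the integral operator of the backstepping transformation. -/
noncomputable def dual (p : Fin 2 → ℝ → ℝ) (j : Fin 2) (z : ℝ) : ℝ :=
  ∫ w in spaceI, wedge z w * ∑ i, E.M i j z w * p i w

lemma continuous_dual_integrand {p : Fin 2 → ℝ → ℝ} (hp : ∀ i, Continuous (p i)) (j : Fin 2) :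
    Continuous fun x : ℝ × ℝ => ∑ i, E.M i j x.1 x.2 * p i x.2 :=
  continuous_finsetSum _ fun i _ => (E.cont i j).mul ((hp i).comp continuous_snd)

lemma continuous_dual {p : Fin 2 → ℝ → ℝ} (hp : ∀ i, Continuous (p i)) (j : Fin 2) :
    Continuous (E.dual p j) :=
  continuous_integral_wedge_mul (g := fun z w => ∑ i, E.M i j z w * p i w)
    (E.continuous_dual_integrand hp j)

lemma dual_of_abs_eq_one (p : Fin 2 → ℝ → ℝ) (j : Fin 2) {z : ℝ} (hz : |z| = 1) :
    E.dual p j z = 0 := by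
  rw [dual, ← integral_zero ℝ ℝ]
  refine integral_congr_ae ?_
  filter_upwards [ae_abs_ne z spaceI, ae_restrict_mem measurableSet_Icc] with w hw hwI
  have h1 := mem_spaceI_iff.1 hwI
  rw [wedge_of_lt (lt_of_le_of_ne (hz ▸ h1) (Ne.symm hw)), zero_mul]

/-- The transpose of the backstepping transformation, on test functions. -/
noncomputable def transpose (p : Fin 2 → ℝ → ℝ) (j : Fin 2) (z : ℝ) : ℝ :=
  p j z - E.dual p j z

lemma continuous_transpose {p : Fin 2 → ℝ → ℝ} (hp : ∀ i, Continuous (p i)) (j : Fin 2) :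
    Continuous (E.transpose p j) :=
  (hp j).sub (E.continuous_dual hp j)

/-- The part of lower order of the adjoint of the closed loop generator. -/
noncomputable def lower (q : Fin 2 → ℝ → ℝ) (j : Fin 2) (z : ℝ) : ℝ :=
  c j.rev (-z) * q j.rev (-z) - S.v (-1) * ∑ i, E.M i j z (-1) * q i (-1)

lemma continuous_lower {q : Fin 2 → ℝ → ℝ} (hq : ∀ i, Continuous (q i)) (j : Fin 2) :
    Continuous (E.lower q j) := by
  have h1 := E.cont_coupling j.rev
  have h2 := hq j.rev
  have h3 : ∀ i, Continuous fun z => E.M i j z (-1) := fun i =>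
    (E.cont i j).comp (f := fun z => (z, -1)) (by fun_prop)
  unfold lower
  fun_prop

lemma dual_sub (p p' : Fin 2 → ℝ → ℝ) (hp : ∀ i, Continuous (p i))
    (hp' : ∀ i, Continuous (p' i)) (r : ℝ) (j : Fin 2) (z : ℝ) :
    E.dual (fun i w => p i w - r * p' i w) j z = E.dual p j z - r * E.dual p' j z := by
  have h1 := fun (p : Fin 2 → ℝ → ℝ) (hp : ∀ i, Continuous (p i)) => integrable_wedge_mul
    ((E.continuous_dual_integrand hp j).comp (f := fun w => (z, w)) (by fun_prop)) z
  rw [dual, dual, dual, ← integral_const_mul]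
  refine Eq.trans (integral_congr_ae (ae_of_all _ fun w => ?_))
    (integral_sub (h1 p hp) ((h1 p' hp').const_mul r))
  simp only [Fin.sum_univ_two]
  ring

/-- The transposed transformation intertwines the adjoint of the closed loop generator with the
adjoint of the generator of the target system. -/
theorem isTestPair_transpose {p dp : Fin 2 → ℝ → ℝ} (h : IsTestPair S p dp) :
    IsTestPair S (E.transpose p)
      (fun j z => E.transpose dp j z - E.lower (E.transpose p) j z) := by
  have hbd : ∀ i z, |z| = 1 → E.transpose p i z = p i z := fun i z hz => by
    rw [transpose, E.dual_of_abs_eq_one p i hz, sub_zero]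
  refine ⟨E.continuous_transpose h.cont, fun j =>
    (E.continuous_transpose h.cont_deriv j).sub
      (E.continuous_lower (E.continuous_transpose h.cont) j),
    fun j z hz => ?_, fun i => by rw [hbd i 1 (by simp), h.zero i]⟩
  have hS := S.cont
  set f : ℝ → ℝ → ℝ := fun z w => ∑ i, S.v w * p i w * (S.v z * E.M i j z w) with hf
  set k : ℝ → ℝ → ℝ := fun z w => ∑ i, (dp i w * S.v w * (S.v z * E.M i j z w) +
    S.v w * p i w * (-(S.v z * c j.rev (-z)) * E.M i j.rev (-z) w)) with hk
  have hsol : SolvesAlongCharacteristics S.v S.v f k := by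
    simp only [hf, hk, Fin.sum_univ_two]
    exact ((E.isChar.eqn 0 j).mul_snd (h.deriv 0)).add ((E.isChar.eqn 1 j).mul_snd (h.deriv 1))
  have hp := h.cont
  have hdp := h.cont_deriv
  have hM := E.cont
  have hMn : ∀ i j, Continuous fun x : ℝ × ℝ => E.M i j (-x.1) x.2 := fun i j =>
    (E.cont i j).comp (f := fun x : ℝ × ℝ => (-x.1, x.2)) (by fun_prop)
  have hcj := E.cont_coupling j.rev
  have hfc : Continuous fun x : ℝ × ℝ => f x.1 x.2 :=
    continuous_finsetSum _ fun i _ => by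
      have := hM i j; have := hp i; fun_prop
  have hkc : Continuous fun x : ℝ × ℝ => k x.1 x.2 :=
    continuous_finsetSum _ fun i _ => by
      have := hM i j; have := hp i; have := hdp i; have := hMn i j.rev; fun_prop
  have hsec : ∀ z, ∫ w in spaceI, wedge z w * (f z w / S.v w) = S.v z * E.dual p j z := fun z => by
    rw [dual, ← integral_const_mul]
    refine integral_congr_ae (ae_of_all _ fun w => ?_)
    have := S.ne w
    simp only [hf, Fin.sum_univ_two]
    field_simp
  have hrate : S.sectionRate f k z / S.v z = E.dual dp j z -
      c j.rev (-z) * E.dual p j.rev (-z) + c j.rev (-z) * p j.rev (-z) -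
      S.v (-1) * ∑ i, E.M i j z (-1) * p i (-1) := by
    have hint : ∫ w in spaceI, wedge z w * (k z w / S.v w) =
        S.v z * E.dual dp j z - S.v z * c j.rev (-z) * E.dual p j.rev (-z) := by
      have i1 := integrable_wedge_mul ((E.continuous_dual_integrand hdp j).comp
        (f := fun w => (z, w)) (by fun_prop)) z
      have i2 := integrable_wedge_mul ((E.continuous_dual_integrand hp j.rev).comp
        (f := fun w => (-z, w)) (by fun_prop)) (-z)
      rw [dual, dual, ← integral_const_mul, ← integral_const_mul]
      refine Eq.trans (integral_congr_ae (ae_of_all _ fun w => ?_))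
        (integral_sub (i1.const_mul _) (i2.const_mul _))
      have := S.ne w
      simp only [hk, Fin.sum_univ_two, wedge_neg_fst]
      field_simp
      ring
    have hdiag : f z (-z) * (1 + S.v z / S.v (-z)) =
        S.v z * (c j.rev (-z) * p j.rev (-z)) := by
      have hb := fun i => E.isChar.bdry i j (-z) (neg_mem_spaceI hz)
      simp only [neg_neg] at hb
      have h1 := S.ne (-z)
      have h2 : S.v (-z) + S.v z ≠ 0 := (add_pos (S.pos _) (S.pos _)).ne'
      simp only [hf, hb, Fin.sum_univ_two]
      fin_cases j
      · simp
        field_simp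
      · simp
        field_simp
    have htop : f z 1 = 0 := by simp [hf, h.zero]
    have hbot : f z (-1) = S.v z * (S.v (-1) * ∑ i, E.M i j z (-1) * p i (-1)) := by
      simp only [hf, Fin.sum_univ_two]
      ring
    rw [Speed.sectionRate, hint, hdiag, htop, hbot, div_eq_iff (S.ne z)]
    ring
  have hg := S.hasDerivWithinAt_integral_section hsol hfc hkc hz
  rw [hrate] at hg
  simp only [hsec] at hg
  have := (h.deriv j z hz).fun_sub hg
  refine (this.congr_deriv ?_).congr (fun w _ => ?_) ?_
  · have hb := fun i => hbd i (-1) (by simp)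
    rw [lower]
    simp only [hb]
    rw [transpose, transpose]
    ring
  · rw [transpose]; ring
  · rw [transpose]; ring

end ExtendedKernel

/-- The element of the state space given by a pair of functions. -/
noncomputable def toState (q : Fin 2 → ℝ → ℝ) : StateL2 := WithLp.toLp 2 fun j => toL2 (q j)

lemma toState_apply (q : Fin 2 → ℝ → ℝ) (j : Fin 2) : toState q j = toL2 (q j) := rfl

lemma memLp_of_continuous {f : ℝ → ℝ} (hf : Continuous f) :
    MemLp f 2 (volume.restrict spaceI) :=
  memLp_of_continuousOn hf.continuousOn

lemma inner_toState (X : StateL2) {q : Fin 2 → ℝ → ℝ} (hq : ∀ i, Continuous (q i)) :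
    inner ℝ X (toState q) = ∑ j, pairing (X j) (q j) := by
  rw [PiLp.inner_apply]
  exact Finset.sum_congr rfl fun j _ => inner_toL2 _ (memLp_of_continuous (hq j))

lemma toL2_congr_ae {f g : ℝ → ℝ} (hf : MemLp f 2 (volume.restrict spaceI))
    (hg : MemLp g 2 (volume.restrict spaceI)) (h : f =ᵐ[volume.restrict spaceI] g) :
    toL2 f = toL2 g := by
  rw [toL2, toL2, dif_pos hf, dif_pos hg]
  exact (MemLp.toLp_eq_toLp_iff hf hg).2 h

namespace ExtendedKernel

variable {S : Speed} {c : Fin 2 → ℝ → ℝ} (E : ExtendedKernel S c)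

lemma swap_app_toState {p : Fin 2 → ℝ → ℝ} (hp : ∀ i, Continuous (p i)) (j : Fin 2) (z : ℝ) :
    E.ker.swap.app (toState p) j z = E.dual p j z := by
  have h1 : ∀ i, (E.ker i j).swap.app (toL2 (p i)) z =
      ∫ w in spaceI, wedge z w * (E.M i j z w * p i w) := fun i => by
    rw [L2Kernel.app, pairing]
    refine integral_congr_ae ?_
    filter_upwards [coeFn_toL2 (memLp_of_continuous (hp i))] with w hw
    rw [hw]
    change p i w * (wedge z w * E.M i j z w) = _
    ring
  have hi : ∀ i, Integrable (fun w => wedge z w * (E.M i j z w * p i w))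
      (volume.restrict spaceI) := fun i =>
    integrable_wedge_mul (((E.cont i j).comp (f := fun w => (z, w)) (by fun_prop)).mul (hp i)) z
  rw [MatKernel.app, dual]
  simp only [MatKernel.swap, toState_apply, h1, Fin.sum_univ_two, mul_add]
  exact (integral_add (hi 0) (hi 1)).symm

/-- The backstepping transformation. -/
noncomputable def backstep : StateL2 →L[ℝ] StateL2 := 1 - E.ker.op

lemma isUnit_backstep : IsUnit E.backstep := E.ker.isUnit_one_sub_op E.ker_eq_zero

lemma swap_op_toState {p : Fin 2 → ℝ → ℝ} (hp : ∀ i, Continuous (p i)) :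
    E.ker.swap.op (toState p) = toState (E.dual p) := by
  ext1 j
  rw [MatKernel.op_apply]
  exact toL2_congr fun z _ => E.swap_app_toState hp j z

lemma toState_sub {p q : Fin 2 → ℝ → ℝ} (hp : ∀ i, Continuous (p i))
    (hq : ∀ i, Continuous (q i)) :
    toState (fun j z => p j z - q j z) = toState p - toState q := by
  rw [eq_sub_iff_add_eq]
  ext1 j
  change toL2 _ + toL2 _ = toL2 _
  rw [← toL2_add (f := fun z => p j z - q j z) (memLp_of_continuous ((hp j).sub (hq j)))
    (memLp_of_continuous (hq j))]
  exact toL2_congr fun z _ => by simp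

lemma inner_backstep (X : StateL2) {p : Fin 2 → ℝ → ℝ} (hp : ∀ i, Continuous (p i)) :
    inner ℝ (E.backstep X) (toState p) = inner ℝ X (toState (E.transpose p)) := by
  have e : toState (E.transpose p) = toState p - E.ker.swap.op (toState p) := by
    rw [E.swap_op_toState hp, ← toState_sub hp (E.continuous_dual hp)]
    rfl
  rw [e, backstep, inner_sub_right, ← MatKernel.adjoint_op,
    ContinuousLinearMap.adjoint_inner_right, ← inner_sub_left]
  rfl

/-- The transposed transformation is onto the continuous functions. -/
lemma exists_transpose_eq {g : Fin 2 → ℝ → ℝ} (hg : ∀ i, Continuous (g i)) :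
    ∃ h : Fin 2 → ℝ → ℝ, (∀ i, Continuous (h i)) ∧ ∀ j z, E.transpose h j z = g j z := by
  obtain ⟨u, hu⟩ := E.ker.isUnit_one_sub_swap_op E.ker_eq_zero
  set X : StateL2 := (↑u⁻¹ : StateL2 →L[ℝ] StateL2) (toState g) with hX
  have hX1 : X - E.ker.swap.op X = toState g := by
    have : ((↑u : StateL2 →L[ℝ] StateL2) * ↑u⁻¹) (toState g) = toState g := by
      rw [u.mul_inv]; rfl
    rw [hu] at this
    exact this
  have hc : ∀ j, Continuous fun z => g j z + E.ker.swap.app X j z := fun j =>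
    (hg j).add (E.ker.swap.app_continuous X j)
  have hXe : X = toState fun j z => g j z + E.ker.swap.app X j z := by
    ext1 j
    rw [toState_apply]
    have h1 := congrArg (fun Y : StateL2 => Y j) (sub_eq_iff_eq_add.1 hX1)
    simp only [PiLp.add_apply, MatKernel.op_apply, toState_apply] at h1
    rw [h1, ← toL2_add (memLp_of_continuous (hg j)) (E.ker.swap.app_memLp X j)]
    rfl
  refine ⟨_, hc, fun j z => ?_⟩
  rw [transpose, ← E.swap_app_toState hc, ← hXe]
  ring

end ExtendedKernel

/-- Solution of the resolvent equation of the target system. -/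
lemma Speed.exists_resolvent (S : Speed) (s : ℝ) {h : Fin 2 → ℝ → ℝ}
    (hh : ∀ i, Continuous (h i)) :
    ∃ p, IsTestPair S p fun i w => s * p i w + h i w := by
  have hS := S.cont
  have hphi := S.phi_continuous
  let r : Fin 2 → ℝ → ℝ := fun i z =>
    Real.exp (s * S.phi z) * ∫ w in (1 : ℝ)..z, Real.exp (-(s * S.phi w)) * h i w
  have hd : ∀ i z, HasDerivAt (r i) (s * (r i z / S.v z) + h i z) z := fun i z => by
    have hc : Continuous fun w => Real.exp (-(s * S.phi w)) * h i w := by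
      have := hh i; fun_prop
    have h1 := (((S.phi_hasDerivAt z).const_mul s).exp).mul
      (intervalIntegral.integral_hasDerivAt_right (hc.intervalIntegrable 1 z)
        (hc.stronglyMeasurableAtFilter _ _) hc.continuousAt)
    refine h1.congr_deriv ?_
    have : Real.exp (s * S.phi z) * (Real.exp (-(s * S.phi z)) * h i z) = h i z := by
      rw [← mul_assoc, ← Real.exp_add, add_neg_cancel, Real.exp_zero, one_mul]
    rw [this]
    simp only [r]
    ring
  have hrc : ∀ i, Continuous (r i) := fun i =>
    continuous_iff_continuousAt.2 fun z => (hd i z).continuousAt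
  have hpc : ∀ i, Continuous fun z => r i z / S.v z := fun i => (hrc i).div hS S.ne
  refine ⟨fun i z => r i z / S.v z, hpc, fun i => ((hpc i).const_mul s).add (hh i),
    fun i w _ => ?_, fun i => by simp [r]⟩
  have e : (fun w => S.v w * (r i w / S.v w)) = r i := by
    funext w; exact mul_div_cancel₀ _ (S.ne w)
  rw [e]
  exact (hd i w).hasDerivWithinAt

namespace ExtendedKernel

variable {S : Speed} {c : Fin 2 → ℝ → ℝ} (E : ExtendedKernel S c)

lemma exists_coupling_bound (E : ExtendedKernel S c) :
    ∃ B, 0 ≤ B ∧ ∀ i, ∀ z ∈ spaceI, |c i z| ≤ B := by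
  have := fun i => (isCompact_Icc (a := (-1 : ℝ)) (b := 1)).exists_bound_of_continuousOn
    (E.cont_coupling i).continuousOn
  choose B hB using this
  refine ⟨max 0 (max (B 0) (B 1)), le_max_left _ _, fun i z hz => (hB i z hz).trans ?_⟩
  fin_cases i <;> simp

/-- Dissipativity estimate for the adjoint of the closed loop generator, in a weighted norm. -/
lemma dissipative_pointwise {B : ℝ} (hB : 0 ≤ B) (hcB : ∀ i, ∀ z ∈ spaceI, |c i z| ≤ B)
    (e : Fin 2 → ℝ → ℝ) (s : ℝ) (hs : 0 ≤ s) {z : ℝ} (hz : z ∈ spaceI) :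
    (2 * s * S.lo - S.hi * B - 8 * (S.hi * E.C) ^ 2) * (e 0 z ^ 2 + e 1 z ^ 2) -
      S.hi * B * (e 0 (-z) ^ 2 + e 1 (-z) ^ 2) -
      1 / 2 * ((S.v (-1) * e 0 (-1)) ^ 2 + (S.v (-1) * e 1 (-1)) ^ 2) ≤
    ∑ j, 2 * (S.v z * e j z) * (s * e j z - E.lower e j z) := by
  have hv := S.pos z
  have hvl := S.lo_le z
  have hvh := S.le_hi z
  have hhi := S.hi_pos
  have key : ∀ j : Fin 2, 2 * s * S.lo * e j z ^ 2 - S.hi * B * (e j z ^ 2 + e j.rev (-z) ^ 2) -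
      8 * (S.hi * E.C) ^ 2 * e j z ^ 2 -
      1 / 4 * ((S.v (-1) * e 0 (-1)) ^ 2 + (S.v (-1) * e 1 (-1)) ^ 2) ≤
      2 * (S.v z * e j z) * (s * e j z - E.lower e j z) := fun j => by
    have h1 : 2 * (S.v z * (e j z * (c j.rev (-z) * e j.rev (-z)))) ≤
        S.hi * B * (e j z ^ 2 + e j.rev (-z) ^ 2) := by
      have hc := abs_le.1 (hcB j.rev (-z) (neg_mem_spaceI hz))
      have h2 : 2 * (e j z * (c j.rev (-z) * e j.rev (-z))) ≤
          B * (e j z ^ 2 + e j.rev (-z) ^ 2) := by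
        nlinarith [sq_nonneg (e j z + e j.rev (-z)), sq_nonneg (e j z - e j.rev (-z)),
          mul_nonneg (sub_nonneg.2 hc.2) (sq_nonneg (e j z + e j.rev (-z))),
          mul_nonneg (by linarith [hc.1] : 0 ≤ B + c j.rev (-z))
            (sq_nonneg (e j z - e j.rev (-z)))]
      have h3 : 0 ≤ B * (e j z ^ 2 + e j.rev (-z) ^ 2) := by positivity
      nlinarith
    have h4 : ∀ i, -(2 * (S.v z * e j z) * (E.M i j z (-1) * (S.v (-1) * e i (-1)))) ≤
        1 / 4 * (S.v (-1) * e i (-1)) ^ 2 + 4 * (S.hi * E.C) ^ 2 * e j z ^ 2 := fun i => by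
      set r := S.v (-1) * e i (-1)
      set a := S.v z * E.M i j z (-1) * e j z
      have h5 : a ^ 2 ≤ (S.hi * E.C) ^ 2 * e j z ^ 2 := by
        have hm := E.bound i j z (-1)
        have h6 : |S.v z * E.M i j z (-1)| ≤ S.hi * E.C := by
          rw [abs_mul, abs_of_pos hv]
          exact mul_le_mul hvh hm (abs_nonneg _) hhi.le
        rw [mul_pow]
        exact mul_le_mul_of_nonneg_right (sq_le_sq.2 (h6.trans (le_abs_self _))) (sq_nonneg _)
      have h7 : 2 * (S.v z * e j z) * (E.M i j z (-1) * r) = 2 * (a * r) := by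
        simp only [a]; ring
      rw [h7]
      nlinarith [sq_nonneg (1 / 2 * r + 2 * a)]
    have h8 : s * S.lo * e j z ^ 2 ≤ s * S.v z * e j z ^ 2 := by
      gcongr
    rw [lower, Fin.sum_univ_two]
    linarith [h4 0, h4 1]
  have k0 := key 0
  have k1 := key 1
  rw [show (0 : Fin 2).rev = 1 from rfl] at k0
  rw [show (1 : Fin 2).rev = 0 from rfl] at k1
  rw [Fin.sum_univ_two]
  linarith

lemma exists_resolvent_injective : ∃ s : ℝ, ∀ e de, IsTestPair S e de →
    (∀ j, ∀ z ∈ spaceI, de j z + E.lower e j z = s * e j z) →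
    ∀ j, ∀ᵐ z ∂volume.restrict spaceI, e j z = 0 := by
  obtain ⟨B, hB, hcB⟩ := E.exists_coupling_bound
  have hlo := S.lo_pos
  have hhi := S.hi_pos
  obtain ⟨s, hs, hs1⟩ : ∃ s : ℝ, 0 ≤ s ∧
      2 * s * S.lo - 2 * (S.hi * B) - 8 * (S.hi * E.C) ^ 2 = 1 :=
    ⟨(1 + 2 * (S.hi * B) + 8 * (S.hi * E.C) ^ 2) / (2 * S.lo), by positivity, by
      field_simp; ring⟩
  refine ⟨s, fun e de h heq => ?_⟩
  have hS := S.cont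
  have he := h.cont
  have hde := h.cont_deriv
  have he0 := he 0
  have he1 := he 1
  set R := (S.v (-1) * e 0 (-1)) ^ 2 + (S.v (-1) * e 1 (-1)) ^ 2 with hR
  -- the balance of energy
  have henergy : ∀ j, ∫ z in (-1 : ℝ)..1, 2 * (S.v z * e j z) * de j z =
      -(S.v (-1) * e j (-1)) ^ 2 := fun j => by
    have hd : ∀ z ∈ Ioo (-1 : ℝ) 1, HasDerivAt (fun z => (S.v z * e j z) ^ 2)
        (2 * (S.v z * e j z) * de j z) z := fun z hz => by
      have := ((h.deriv j z (Ioo_subset_Icc_self hz)).hasDerivAt (Icc_mem_nhds hz.1 hz.2)).fun_pow 2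
      simpa using this
    have hej := he j
    have hdej := hde j
    rw [intervalIntegral.integral_eq_sub_of_hasDerivAt_of_le (by norm_num)
      (Continuous.continuousOn (by fun_prop)) hd
      (Continuous.intervalIntegrable (by fun_prop) _ _), h.zero j]
    ring
  have hcont : ∀ j, Continuous fun z => 2 * (S.v z * e j z) * de j z := fun j => by
    have := he j; have := hde j; fun_prop
  have hsum : ∫ z in (-1 : ℝ)..1, ∑ j, 2 * (S.v z * e j z) * de j z = -R := by
    simp only [Fin.sum_univ_two]
    rw [intervalIntegral.integral_add ((hcont 0).intervalIntegrable _ _)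
      ((hcont 1).intervalIntegrable _ _), henergy, henergy]
    ring
  set N := ∫ z in (-1 : ℝ)..1, (e 0 z ^ 2 + e 1 z ^ 2) with hN
  have hNneg : ∫ z in (-1 : ℝ)..1, (e 0 (-z) ^ 2 + e 1 (-z) ^ 2) = N := by
    rw [intervalIntegral.integral_comp_neg (fun z => e 0 z ^ 2 + e 1 z ^ 2), neg_neg]
  have hle := intervalIntegral.integral_mono_on (a := -1) (b := 1) (μ := volume) (by norm_num)
    (Continuous.intervalIntegrable (u := fun z =>
      (2 * s * S.lo - S.hi * B - 8 * (S.hi * E.C) ^ 2) * (e 0 z ^ 2 + e 1 z ^ 2) -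
      S.hi * B * (e 0 (-z) ^ 2 + e 1 (-z) ^ 2) - 1 / 2 * R) (by fun_prop) _ _)
    ((continuous_finsetSum Finset.univ fun j _ => hcont j).intervalIntegrable (-1) 1)
    (fun z hz => by
      refine (E.dissipative_pointwise hB hcB e s hs hz).trans (le_of_eq ?_)
      refine Finset.sum_congr rfl fun j _ => ?_
      rw [← heq j z hz, add_sub_cancel_right])
  rw [hsum, intervalIntegral.integral_sub (Continuous.intervalIntegrable (by fun_prop) _ _)
      (Continuous.intervalIntegrable (by fun_prop) _ _),
    intervalIntegral.integral_sub (Continuous.intervalIntegrable (by fun_prop) _ _)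
      (Continuous.intervalIntegrable (by fun_prop) _ _),
    intervalIntegral.integral_const_mul, intervalIntegral.integral_const_mul, hNneg, ← hN,
    intervalIntegral.integral_const] at hle
  have hN0 : N ≤ 0 := by
    simp only [smul_eq_mul] at hle
    nlinarith
  have hNge : 0 ≤ N := intervalIntegral.integral_nonneg (by norm_num) fun z _ => by positivity
  have hN' : ∫ z in spaceI, (e 0 z ^ 2 + e 1 z ^ 2) = 0 := by
    rw [integral_Icc_eq_integral_Ioc, ← intervalIntegral.integral_of_le (by norm_num)]
    exact le_antisymm hN0 hNge
  have hae := (integral_eq_zero_iff_of_nonneg (fun z => by positivity)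
    ((Continuous.continuousOn (f := fun z => e 0 z ^ 2 + e 1 z ^ 2)
      (by fun_prop)).integrableOn_compact isCompact_Icc)).1 hN'
  intro j
  filter_upwards [hae] with z hz
  simp only [Pi.zero_apply] at hz
  have h0 : e 0 z ^ 2 = 0 := by nlinarith [sq_nonneg (e 0 z), sq_nonneg (e 1 z)]
  have h1 : e 1 z ^ 2 = 0 := by nlinarith [sq_nonneg (e 0 z), sq_nonneg (e 1 z)]
  fin_cases j
  · exact pow_eq_zero_iff two_ne_zero |>.1 h0
  · exact pow_eq_zero_iff two_ne_zero |>.1 h1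

/-- Up to null sets, every test pair is the image of a test pair under the transposed
transformation, which conjugates the adjoints of the generators. -/
theorem exists_transpose_ae_eq {q dq : Fin 2 → ℝ → ℝ} (hq : IsTestPair S q dq) :
    ∃ p dp, IsTestPair S p dp ∧ toState q = toState (E.transpose p) ∧
      toState (fun j z => dq j z + E.lower q j z) = toState (E.transpose dp) := by
  obtain ⟨s, hs⟩ := E.exists_resolvent_injective
  obtain ⟨h, hh, hhe⟩ := E.exists_transpose_eq (g := fun j z => dq j z + E.lower q j z - s * q j z)
    fun j => ((hq.cont_deriv j).add (E.continuous_lower hq.cont j)).sub ((hq.cont j).const_mul s)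
  obtain ⟨p, hp⟩ := S.exists_resolvent s hh
  set dp : Fin 2 → ℝ → ℝ := fun i w => s * p i w + h i w with hdp
  have ht := E.isTestPair_transpose hp
  have hth : ∀ j z, E.transpose dp j z - s * E.transpose p j z =
      dq j z + E.lower q j z - s * q j z := fun j z => by
    have e1 : h = fun i w => dp i w - s * p i w := by
      funext i w; simp only [hdp]; ring
    have e2 := E.dual_sub dp p hp.cont_deriv hp.cont s j z
    rw [← hhe j z]
    rw [transpose, transpose, transpose, e1, e2]
    ring
  have hlow : ∀ j z, E.lower (fun i w => q i w - E.transpose p i w) j z =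
      E.lower q j z - E.lower (E.transpose p) j z := fun j z => by
    simp only [lower, Fin.sum_univ_two]
    ring
  have hae := hs (fun i w => q i w - E.transpose p i w)
    (fun i w => dq i w - (E.transpose dp i w - E.lower (E.transpose p) i w))
    ⟨fun i => (hq.cont i).sub (ht.cont i), fun i => (hq.cont_deriv i).sub (ht.cont_deriv i),
      fun i w hw => ((hq.deriv i w hw).fun_sub (ht.deriv i w hw)).congr
        (fun _ _ => by ring) (by ring), fun i => by simp only [hq.zero, ht.zero, sub_zero]⟩
    (fun j z _ => by
      rw [hlow]
      linarith [hth j z])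
  refine ⟨p, dp, hp, ?_, ?_⟩
  · ext1 j
    refine toL2_congr_ae (memLp_of_continuous (hq.cont j)) (memLp_of_continuous (ht.cont j)) ?_
    filter_upwards [hae j] with z hz using sub_eq_zero.1 hz
  · ext1 j
    refine toL2_congr_ae
      (memLp_of_continuous ((hq.cont_deriv j).add (E.continuous_lower hq.cont j)))
      (memLp_of_continuous (E.continuous_transpose hp.cont_deriv j)) ?_
    filter_upwards [hae j] with z hz
    have := hth j z
    rw [← sub_eq_zero.1 hz] at this
    linarith

end ExtendedKernel

lemma LipschitzWith.map_volume_le {f g : ℝ → ℝ} {K : NNReal} (hg : LipschitzWith K g)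
    (hf : Continuous f) (hgf : Function.LeftInverse g f) :
    Measure.map f volume ≤ (K : ENNReal) • (volume : Measure ℝ) := by
  refine Measure.le_iff.2 fun s hs => ?_
  rw [Measure.map_apply hf.measurable hs, Measure.smul_apply, smul_eq_mul]
  have h := hg.hausdorffMeasure_image_le (d := 1) zero_le_one s
  rw [hausdorffMeasure_real, ENNReal.rpow_one] at h
  refine (measure_mono fun w hw => ?_).trans h
  exact ⟨f w, hw, hgf w⟩

namespace Speed

variable (S : Speed)

lemma psi_lipschitz : LipschitzWith S.hi.toNNReal S.psi :=
  lipschitzWith_of_nnnorm_deriv_le (fun x => (S.psi_hasDerivAt x).differentiableAt) fun x => by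
    rw [(S.psi_hasDerivAt x).deriv, ← NNReal.coe_le_coe, coe_nnnorm, Real.norm_eq_abs,
      abs_of_pos (S.pos _), Real.coe_toNNReal _ S.hi_pos.le]
    exact S.le_hi _

lemma phi_lipschitz : LipschitzWith (1 / S.lo).toNNReal S.phi :=
  lipschitzWith_of_nnnorm_deriv_le (fun x => (S.phi_hasDerivAt x).differentiableAt) fun x => by
    rw [(S.phi_hasDerivAt x).deriv, ← NNReal.coe_le_coe, coe_nnnorm, Real.norm_eq_abs,
      abs_of_pos (one_div_pos.2 (S.pos _)), Real.coe_toNNReal _ (one_div_pos.2 S.lo_pos).le]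
    exact one_div_le_one_div_of_le S.lo_pos (S.lo_le _)

lemma map_phi_le : Measure.map S.phi volume ≤ (S.hi.toNNReal : ENNReal) • (volume : Measure ℝ) :=
  S.psi_lipschitz.map_volume_le S.phi_continuous S.psi_phi

lemma map_psi_le :
    Measure.map S.psi volume ≤ ((1 / S.lo).toNNReal : ENNReal) • (volume : Measure ℝ) :=
  S.phi_lipschitz.map_volume_le S.psi_continuous S.phi_psi

lemma phi_quasi : Measure.QuasiMeasurePreserving S.phi :=
  ⟨S.phi_continuous.measurable, Measure.absolutelyContinuous_of_le_smul S.map_phi_le⟩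

/-- Composition with the travel time, from `L²(ℝ)` to `L²([-1, 1])`. -/
noncomputable def pullback : Lp ℝ 2 (volume : Measure ℝ) →L[ℝ] L2I :=
  (LpToLpRestrictCLM ℝ ℝ ℝ volume 2 spaceI).comp
    ((Lp.compMeasurePreservingₗᵢ ℝ S.phi
      (S.phi_continuous.measurable.measurePreserving volume)).toContinuousLinearMap.comp
      (Lp.LpToLpOfMeasureLeSMul ENNReal.coe_ne_top S.map_phi_le))

lemma coeFn_pullback (h : Lp ℝ 2 (volume : Measure ℝ)) :
    S.pullback h =ᵐ[volume.restrict spaceI] fun w => h (S.phi w) := by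
  refine (LpToLpRestrictCLM_coeFn ℝ spaceI _).trans (ae_restrict_of_ae ?_)
  refine (Lp.coeFn_compMeasurePreserving _
    (S.phi_continuous.measurable.measurePreserving volume)).trans ?_
  exact (S.phi_continuous.measurable.measurePreserving volume).quasiMeasurePreserving.ae_eq_comp
    (Lp.coeFn_LpToLpOfMeasureLeSMul _ _ _)

/-- An `L²` function on `[-1, 1]` in the coordinate given by the travel time, as a function. -/
noncomputable def pushFun (X : L2I) (x : ℝ) : ℝ := spaceI.indicator X (S.psi x)

lemma memLp_pushFun (X : L2I) : MemLp (S.pushFun X) 2 volume := by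
  have h : MemLp (spaceI.indicator X) 2 volume :=
    (memLp_indicator_iff_restrict measurableSet_Icc).2 (Lp.memLp X)
  exact (h.of_measure_le_smul ENNReal.coe_ne_top S.map_psi_le).comp_of_map
    S.psi_continuous.aemeasurable

/-- An `L²` function on `[-1, 1]` in the coordinate given by the travel time, extended by zero. -/
noncomputable def push (X : L2I) : Lp ℝ 2 (volume : Measure ℝ) := (S.memLp_pushFun X).toLp

/-- The solution at time `t` of the transport equation with homogeneous boundary condition. -/
noncomputable def shift (X : L2I) (t : ℝ) : L2I :=
  S.pullback (Lp.compMeasurePreserving (fun x => x - t) (measurePreserving_sub_right volume t)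
    (S.push X))

lemma continuous_shift (X : L2I) : Continuous (S.shift X) := by
  refine S.pullback.continuous.comp ?_
  let f : ℝ → C(ℝ, ℝ) := fun t => ⟨fun x => x - t, by fun_prop⟩
  have hf : Continuous f :=
    ContinuousMap.continuous_of_continuous_uncurry _
      (by change Continuous fun x : ℝ × ℝ => x.2 - x.1; fun_prop)
  have hm : ∀ t, MeasurePreserving (f t) volume volume :=
    fun t => measurePreserving_sub_right volume t
  exact Continuous.compMeasurePreservingLp (f := fun _ : ℝ => S.push X) (g := f)
    continuous_const hf hm ENNReal.ofNat_ne_top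

lemma coeFn_shift (X : L2I) (t : ℝ) :
    S.shift X t =ᵐ[volume.restrict spaceI] fun w => S.pushFun X (S.phi w - t) := by
  refine (S.coeFn_pullback _).trans (ae_restrict_of_ae ?_)
  have h1 := Lp.coeFn_compMeasurePreserving (S.push X) (measurePreserving_sub_right volume t)
  have h2 := (measurePreserving_sub_right volume t).quasiMeasurePreserving.ae_eq_comp
    (S.memLp_pushFun X).coeFn_toLp
  exact S.phi_quasi.ae_eq_comp (h1.trans h2)

lemma shift_zero (X : L2I) : S.shift X 0 = X := by
  refine Lp.ext ((S.coeFn_shift X 0).trans ?_)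
  filter_upwards [ae_restrict_mem measurableSet_Icc] with w hw
  rw [sub_zero, pushFun, psi_phi, indicator_of_mem hw]

lemma psi_mem_spaceI_iff {x : ℝ} : S.psi x ∈ spaceI ↔ x ∈ Icc (S.phi (-1)) (S.phi 1) := by
  rw [spaceI, mem_Icc, mem_Icc, le_psi_iff, psi_le_iff]

/-- Change of variables in the pairing of a transported function with a test function. -/
lemma pairing_shift (X : L2I) (t : ℝ) (g : ℝ → ℝ) :
    pairing (S.shift X t) g = ∫ y, S.pushFun X y *
      (Icc (S.phi (-1)) (S.phi 1)).indicator (fun x => S.v (S.psi x) * g (S.psi x)) (y + t) := by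
  have h1 : pairing (S.shift X t) g =
      ∫ w in spaceI, (S.pushFun X (S.phi w - t) * (S.v w * g w)) / S.v w := by
    refine integral_congr_ae ?_
    filter_upwards [S.coeFn_shift X t] with w hw
    rw [hw]
    have := S.ne w
    field_simp
  have h2 := S.setIntegral_div_speed fun w => S.pushFun X (S.phi w - t) * (S.v w * g w)
  rw [h1, h2, ← integral_indicator measurableSet_Icc, ← integral_add_right_eq_self _ t]
  refine integral_congr_ae (ae_of_all _ fun y => ?_)
  simp only [indicator]
  split_ifs <;> simp

lemma pushFun_eq_zero (X : L2I) {y : ℝ} (hy : y ∉ Icc (S.phi (-1)) (S.phi 1)) :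
    S.pushFun X y = 0 :=
  indicator_of_notMem (fun h => hy (S.psi_mem_spaceI_iff.1 h)) _

lemma integrable_pushFun (X : L2I) : Integrable (S.pushFun X) := by
  have h : Integrable (S.pushFun X) (volume.restrict (Icc (S.phi (-1)) (S.phi 1))) :=
    ((S.memLp_pushFun X).restrict _).integrable (by norm_num)
  refine ((integrable_indicator_iff measurableSet_Icc).2 h).congr (ae_of_all _ fun y => ?_)
  rw [indicator_apply_eq_self]
  exact S.pushFun_eq_zero X

end Speed

namespace Speed

variable (S : Speed)

/-- Integration along a characteristic that leaves the interval at the right end. -/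
lemma integral_indicator_deriv {p dp : ℝ → ℝ} (hp : Continuous p) (hdp : Continuous dp)
    (hd : ∀ w ∈ spaceI, HasDerivWithinAt (fun w => S.v w * p w) (dp w) spaceI w)
    (h1 : p 1 = 0) {y T : ℝ} (hy : y ∈ Icc (S.phi (-1)) (S.phi 1)) (hT : 0 ≤ T) :
    ∫ t in (0 : ℝ)..T, (Icc (S.phi (-1)) (S.phi 1)).indicator
        (fun x => S.v (S.psi x) * dp (S.psi x)) (y + t) =
      (Icc (S.phi (-1)) (S.phi 1)).indicator (fun x => S.v (S.psi x) * p (S.psi x)) (y + T) -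
      (Icc (S.phi (-1)) (S.phi 1)).indicator (fun x => S.v (S.psi x) * p (S.psi x)) y := by
  have hv := S.cont
  have hpsi := S.psi_continuous
  set a := S.phi (-1) with ha
  set b := S.phi 1 with hb
  set m := min (y + T) b with hm
  have hym : y ≤ m := le_min (by linarith) hy.2
  have hset : Ioc y (y + T) ∩ Icc a b = Ioc y m := by
    ext x
    simp only [mem_inter_iff, mem_Ioc, mem_Icc, hm, le_min_iff]
    exact ⟨fun h => ⟨h.1.1, h.1.2, h.2.2⟩, fun h => ⟨⟨h.1, h.2.1⟩, hy.1.trans h.1.le, h.2.2⟩⟩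
  rw [intervalIntegral.integral_comp_add_left (fun x => (Icc a b).indicator
      (fun x => S.v (S.psi x) * dp (S.psi x)) x), add_zero,
    intervalIntegral.integral_of_le (by linarith), setIntegral_indicator measurableSet_Icc, hset,
    ← intervalIntegral.integral_of_le hym,
    intervalIntegral.integral_eq_sub_of_hasDerivAt_of_le hym
      (f := fun x => S.v (S.psi x) * p (S.psi x)) (Continuous.continuousOn (by fun_prop)) ?_
      (Continuous.intervalIntegrable (by fun_prop) _ _), indicator_of_mem hy]
  · congr 1
    by_cases h : y + T ≤ b
    · rw [indicator_of_mem (show y + T ∈ Icc a b from ⟨by linarith [hy.1], h⟩), hm, min_eq_left h]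
    · rw [indicator_of_notMem fun h' => h h'.2, hm, min_eq_right (not_le.1 h).le, hb, psi_phi, h1,
        mul_zero]
  · intro x hx
    have hx1 : -1 < S.psi x := by
      rw [← S.phi_strictMono.lt_iff_lt, phi_psi]; exact hy.1.trans_lt hx.1
    have hx2 : S.psi x < 1 := by
      rw [← S.phi_strictMono.lt_iff_lt, phi_psi]; exact hx.2.trans_le (min_le_right _ _)
    have := ((hd _ ⟨hx1.le, hx2.le⟩).hasDerivAt (Icc_mem_nhds hx1 hx2)).comp x (S.psi_hasDerivAt x)
    rw [mul_comm (S.v _)]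
    exact this

/-- The transport semigroup solves the transport equation weakly. -/
lemma pairing_shift_sub (X : L2I) {p dp : ℝ → ℝ} (hp : Continuous p) (hdp : Continuous dp)
    (hd : ∀ w ∈ spaceI, HasDerivWithinAt (fun w => S.v w * p w) (dp w) spaceI w)
    (h1 : p 1 = 0) {T : ℝ} (hT : 0 ≤ T) :
    pairing (S.shift X T) p - pairing X p = ∫ t in (0 : ℝ)..T, pairing (S.shift X t) dp := by
  have hv := S.cont
  have hpsi := S.psi_continuous
  set A := Icc (S.phi (-1)) (S.phi 1) with hA
  have hbdd : ∀ g : ℝ → ℝ, Continuous g → ∃ B, ∀ x,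
      ‖A.indicator (fun x => S.v (S.psi x) * g (S.psi x)) x‖ ≤ B := fun g hg => by
    obtain ⟨B, hB⟩ := (isCompact_Icc (a := S.phi (-1)) (b := S.phi 1)).exists_bound_of_continuousOn
      (f := fun x => S.v (S.psi x) * g (S.psi x)) (Continuous.continuousOn (by fun_prop))
    refine ⟨max B 0, fun x => ?_⟩
    by_cases h : x ∈ A
    · rw [indicator_of_mem h]; exact (hB x h).trans (le_max_left _ _)
    · rw [indicator_of_notMem h, norm_zero]; exact le_max_right _ _
  have hmeas : ∀ g : ℝ → ℝ, Continuous g →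
      Measurable (A.indicator fun x => S.v (S.psi x) * g (S.psi x)) := fun g hg =>
    (Continuous.measurable (by fun_prop)).indicator measurableSet_Icc
  have hint : ∀ t, Integrable fun y => S.pushFun X y *
      A.indicator (fun x => S.v (S.psi x) * p (S.psi x)) (y + t) := fun t => by
    obtain ⟨B, hB⟩ := hbdd p hp
    exact (S.integrable_pushFun X).mul_bdd (c := B)
      ((hmeas p hp).comp (measurable_id.add_const t)).aestronglyMeasurable
      (ae_of_all _ fun y => hB _)
  have hint2 : Integrable (Function.uncurry fun t y => S.pushFun X y *
      A.indicator (fun x => S.v (S.psi x) * dp (S.psi x)) (y + t))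
      ((volume.restrict (Ioc 0 T)).prod volume) := by
    obtain ⟨B, hB⟩ := hbdd dp hdp
    have h2 : Integrable (fun _ : ℝ => (1 : ℝ)) (volume.restrict (Ioc 0 T)) :=
      integrable_const _
    have h3 := h2.mul_prod (S.integrable_pushFun X)
    refine (h3.mul_bdd (c := B)
      (g := fun x : ℝ × ℝ => A.indicator (fun x => S.v (S.psi x) * dp (S.psi x)) (x.2 + x.1))
      ((hmeas dp hdp).comp (measurable_snd.add measurable_fst)).aestronglyMeasurable
      (ae_of_all _ fun y => hB _)).congr (ae_of_all _ fun x => ?_)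
    simp only [one_mul]
    rfl
  nth_rw 2 [← S.shift_zero X]
  simp only [pairing_shift]
  rw [intervalIntegral.integral_of_le hT, integral_integral_swap hint2,
    ← integral_sub (hint T) (hint 0)]
  refine integral_congr_ae (ae_of_all _ fun y => ?_)
  simp only
  rw [integral_const_mul, ← intervalIntegral.integral_of_le hT, ← mul_sub, add_zero]
  by_cases hy : y ∈ A
  · rw [S.integral_indicator_deriv hp hdp hd h1 hy hT]
  · rw [S.pushFun_eq_zero X hy, zero_mul, zero_mul]

lemma ae_mem_Ioo : ∀ᵐ w ∂volume.restrict spaceI, w ∈ Ioo (-1 : ℝ) 1 := by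
  rw [← restrict_Ioo_eq_restrict_Icc]
  exact ae_restrict_mem measurableSet_Ioo

lemma shift_eq_zero (X : L2I) {t : ℝ} (ht : S.phi 1 - S.phi (-1) ≤ t) : S.shift X t = 0 := by
  refine Lp.ext ((S.coeFn_shift X t).trans ?_)
  filter_upwards [ae_mem_Ioo, Lp.coeFn_zero ℝ 2 (volume.restrict spaceI)] with w hw h0
  rw [h0, Pi.zero_apply]
  refine S.pushFun_eq_zero X fun h => ?_
  linarith [h.1, S.phi_strictMono hw.2]

/-- Smooth functions with support inside the interval separate points of `L²([-1, 1])`. -/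
lemma eq_zero_of_forall_integral_pushFun (X : L2I)
    (h : ∀ g : ℝ → ℝ, ContDiff ℝ 1 g → tsupport g ⊆ Ioo (S.phi (-1)) (S.phi 1) →
      ∫ y, S.pushFun X y * g y = 0) : X = 0 := by
  have h0 := isOpen_Ioo.ae_eq_zero_of_integral_contDiff_smul_eq_zero (μ := volume)
    (U := Ioo (S.phi (-1)) (S.phi 1))
    ((S.integrable_pushFun X).locallyIntegrable.locallyIntegrableOn _)
    (fun g hg _ hs => by
      rw [← h g (hg.of_le (by exact_mod_cast le_top)) hs]
      exact integral_congr_ae (ae_of_all _ fun y => by simp only [smul_eq_mul, mul_comm]))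
  refine Lp.ext ?_
  filter_upwards [ae_restrict_of_ae (S.phi_quasi.ae h0), ae_mem_Ioo,
    Lp.coeFn_zero ℝ 2 (volume.restrict spaceI)] with w hw hwI hz
  rw [hz, Pi.zero_apply, ← hw ⟨S.phi_strictMono hwI.1, S.phi_strictMono hwI.2⟩, pushFun, psi_phi,
    indicator_of_mem (Ioo_subset_Icc_self hwI)]

end Speed

section ProductRule

variable {H : Type*} [NormedAddCommGroup H] [InnerProductSpace ℝ H]

/-- The product rule for a weak solution and a differentiable curve of test vectors. -/
lemma inner_sub_inner_eq_integral {Y : ℝ → H} (hY : ContinuousOn Y (Ici 0)) {p p' b : ℝ → H}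
    (hp : ∀ t, HasDerivAt p (p' t) t) (hp' : Continuous p') (hb : Continuous b)
    {T : ℝ} (hT : 0 ≤ T)
    (h : ∀ t ∈ Icc 0 T, ∀ τ, 0 ≤ τ →
      inner ℝ (Y τ) (p t) - inner ℝ (Y 0) (p t) = ∫ r in (0 : ℝ)..τ, inner ℝ (Y r) (b t)) :
    inner ℝ (Y T) (p T) - inner ℝ (Y 0) (p 0) =
      ∫ t in (0 : ℝ)..T, inner ℝ (Y t) (b t + p' t) := by
  have hZ : Continuous fun t => Y (max t 0) :=
    hY.comp_continuous (by fun_prop) fun t => le_max_right t 0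
  set Z : ℝ → H := fun t => Y (max t 0) with hZd
  have hZe : ∀ t, 0 ≤ t → Z t = Y t := fun t ht => by simp only [hZd, max_eq_left ht]
  have hpc : Continuous p := continuous_iff_continuousAt.2 fun t => (hp t).continuousAt
  have hderiv : ∀ t ∈ Ioo 0 T, HasDerivAt (fun s => inner ℝ (Z s) (p s))
      (inner ℝ (Z t) (b t + p' t)) t := fun t ht => by
    have h1 : HasDerivAt (fun s => inner ℝ (Z s) (p t)) (inner ℝ (Z t) (b t)) t := by
      have hc : Continuous fun r => inner ℝ (Z r) (b t) := by fun_prop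
      have h2 := (intervalIntegral.integral_hasDerivAt_right (hc.intervalIntegrable 0 t)
        (hc.stronglyMeasurableAtFilter _ _) hc.continuousAt).const_add (inner ℝ (Y 0) (p t))
      refine h2.congr_of_eventuallyEq ?_
      filter_upwards [lt_mem_nhds ht.1] with s hs
      rw [hZe s hs.le, ← sub_eq_iff_eq_add', h t ⟨ht.1.le, ht.2.le⟩ s hs.le]
      refine intervalIntegral.integral_congr fun r hr => ?_
      rw [uIcc_of_le hs.le] at hr
      simp only [hZe r hr.1]
    have h3 : HasDerivAt (fun s => inner ℝ (Z s) (p s - p t)) (inner ℝ (Z t) (p' t)) t := by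
      rw [hasDerivAt_iff_tendsto_slope]
      have h4 := (hZ.tendsto t).mono_left (nhdsWithin_le_nhds (s := {t}ᶜ))
      refine (h4.inner (hasDerivAt_iff_tendsto_slope.1 (hp t))).congr fun s => ?_
      simp only [slope, vsub_eq_sub, sub_self, inner_zero_right, sub_zero, inner_smul_right,
        smul_eq_mul]
    rw [inner_add_right]
    refine (h1.add h3).congr_of_eventuallyEq (Filter.Eventually.of_forall fun s => ?_)
    simp only [Pi.add_apply, ← inner_add_right, add_sub_cancel]
  have := intervalIntegral.integral_eq_sub_of_hasDerivAt_of_le hT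
    (f := fun s => inner ℝ (Z s) (p s)) (Continuous.continuousOn (by fun_prop)) hderiv
    (Continuous.intervalIntegrable (by fun_prop) _ _)
  rw [← hZe T hT, ← hZe 0 le_rfl, ← this]
  refine intervalIntegral.integral_congr fun r hr => ?_
  rw [uIcc_of_le hT] at hr
  simp only [hZe r hr.1]

end ProductRule

lemma toL2_sub {f g : ℝ → ℝ} (hf : Continuous f) (hg : Continuous g) :
    toL2 (fun z => f z - g z) = toL2 f - toL2 g := by
  rw [eq_sub_iff_add_eq, ← toL2_add (f := fun z => f z - g z)
    (memLp_of_continuous (hf.sub hg)) (memLp_of_continuous hg)]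
  exact toL2_congr fun z _ => by simp

lemma tendstoUniformly_of_continuous {f : ℝ → ℝ → ℝ}
    (hf : Continuous fun x : ℝ × ℝ => f x.1 x.2) (t : ℝ) {ε : ℝ} (hε : 0 < ε) :
    ∀ᶠ s in nhds t, ∀ w ∈ spaceI, |f w s - f w t| < ε := by
  have h := Continuous.tendstoUniformly (fun (s : ℝ) (w : spaceI) => f w s)
    (hf.comp (f := fun x : ℝ × spaceI => ((x.2 : ℝ), x.1)) (by fun_prop)) t
  filter_upwards [Metric.tendstoUniformly_iff.1 h ε hε] with s hs w hw
  have := hs ⟨w, hw⟩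
  rwa [dist_comm, Real.dist_eq] at this

lemma continuous_toL2 {f : ℝ → ℝ → ℝ} (hf : Continuous fun x : ℝ × ℝ => f x.1 x.2) :
    Continuous fun t => toL2 fun w => f w t := by
  have hs : ∀ t, Continuous fun w => f w t := fun t =>
    hf.comp (f := fun w => (w, t)) (by fun_prop)
  refine continuous_iff_continuousAt.2 fun t => Metric.tendsto_nhds.2 fun ε hε => ?_
  have hn := normOne_nonneg
  filter_upwards [tendstoUniformly_of_continuous hf t
    (div_pos hε (by linarith : 0 < normOne + 1))] with s h
  rw [dist_eq_norm, ← toL2_sub (hs s) (hs t)]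
  refine (norm_toL2_le (memLp_of_continuous ((hs s).sub (hs t))) (by positivity)
    fun z hz => (h z hz).le).trans_lt ?_
  rw [mul_div_assoc', div_lt_iff₀ (by linarith)]
  nlinarith

lemma hasDerivAt_toL2 {f f' : ℝ → ℝ → ℝ} (hf : Continuous fun x : ℝ × ℝ => f x.1 x.2)
    (hf' : Continuous fun x : ℝ × ℝ => f' x.1 x.2)
    (hd : ∀ w ∈ spaceI, ∀ t, HasDerivAt (f w) (f' w t) t) (t : ℝ) :
    HasDerivAt (fun t => toL2 fun w => f w t) (toL2 fun w => f' w t) t := by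
  have hs : ∀ t, Continuous fun w => f w t := fun t =>
    hf.comp (f := fun w => (w, t)) (by fun_prop)
  have hs' : ∀ t, Continuous fun w => f' w t := fun t =>
    hf'.comp (f := fun w => (w, t)) (by fun_prop)
  have hn := normOne_nonneg
  rw [hasDerivAt_iff_isLittleO, Asymptotics.isLittleO_iff]
  intro ε hε
  obtain ⟨δ, hδ, h⟩ := Metric.eventually_nhds_iff_ball.1 (tendstoUniformly_of_continuous hf' t
    (div_pos hε (by linarith : 0 < normOne + 1)))
  filter_upwards [Metric.ball_mem_nhds t hδ] with s hsb
  rw [← toL2_const_smul _ (memLp_of_continuous (hs' t)), ← toL2_sub (hs s) (hs t)]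
  have e : (s - t) • (fun w => f' w t) = fun w => (s - t) * f' w t := rfl
  rw [e, ← toL2_sub (f := fun w => f w s - f w t) (g := fun w => (s - t) * f' w t)
    ((hs s).sub (hs t)) ((hs' t).const_mul _)]
  refine (norm_toL2_le (B := ε / (normOne + 1) * |s - t|) (memLp_of_continuous
    (((hs s).sub (hs t)).sub ((hs' t).const_mul _))) (by positivity) fun w hw => ?_).trans ?_
  · have := (convex_ball t δ).norm_image_sub_le_of_norm_hasDerivWithin_le
      (f := fun s => f w s - s * f' w t) (f' := fun s => f' w s - f' w t)
      (C := ε / (normOne + 1)) (x := t) (y := s) (fun r _ => by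
        simpa using ((hd w hw r).fun_sub ((hasDerivAt_id r).mul_const (f' w t))).hasDerivWithinAt)
      (fun r hr => (h r hr w hw).le) (Metric.mem_ball_self hδ) hsb
    rw [Real.norm_eq_abs, Real.norm_eq_abs] at this
    change |f w s - f w t - (s - t) * f' w t| ≤ _
    convert this using 2
    ring
  · rw [Real.norm_eq_abs, ← mul_assoc]
    refine mul_le_mul_of_nonneg_right ?_ (abs_nonneg _)
    rw [mul_div_assoc', div_le_iff₀ (by linarith)]
    nlinarith

lemma continuous_toState {f : Fin 2 → ℝ → ℝ → ℝ}
    (hf : ∀ i, Continuous fun x : ℝ × ℝ => f i x.1 x.2) :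
    Continuous fun t => toState fun i w => f i w t :=
  (PiLp.continuousLinearEquiv 2 ℝ fun _ : Fin 2 => L2I).symm.continuous.comp
    (continuous_pi fun i => continuous_toL2 (hf i))

lemma hasDerivAt_toState {f f' : Fin 2 → ℝ → ℝ → ℝ}
    (hf : ∀ i, Continuous fun x : ℝ × ℝ => f i x.1 x.2)
    (hf' : ∀ i, Continuous fun x : ℝ × ℝ => f' i x.1 x.2)
    (hd : ∀ i, ∀ w ∈ spaceI, ∀ t, HasDerivAt (f i w) (f' i w t) t) (t : ℝ) :
    HasDerivAt (fun t => toState fun i w => f i w t) (toState fun i w => f' i w t) t :=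
  (PiLp.continuousLinearEquiv 2 ℝ fun _ : Fin 2 => L2I).symm.hasFDerivAt.comp_hasDerivAt t
    (hasDerivAt_pi.2 fun i => hasDerivAt_toL2 (hf i) (hf' i) (hd i) t)

/-- A continuous curve `X` with `d/dt ⟨X, a⟩ = ⟨X, b⟩`, in the integrated sense, for all `(a, b)` in
the graph `D`. -/
structure IsWeakOrbit (D : StateL2 → StateL2 → Prop) (X : ℝ → StateL2) : Prop where
  cont : ContinuousOn X (Ici 0)
  weak : ∀ a b, D a b → ∀ T, 0 ≤ T →
    inner ℝ (X T) a - inner ℝ (X 0) a = ∫ t in (0 : ℝ)..T, inner ℝ (X t) b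

/-- The graph of the adjoint of the generator of the transport system. -/
def Speed.TransportGraph (S : Speed) (a b : StateL2) : Prop :=
  ∃ p dp, IsTestPair S p dp ∧ a = toState p ∧ b = toState dp

/-- The graph of the adjoint of the generator of the closed loop system. -/
def ExtendedKernel.AdjointGraph {S : Speed} {c : Fin 2 → ℝ → ℝ} (E : ExtendedKernel S c)
    (a b : StateL2) : Prop :=
  ∃ q dq, IsTestPair S q dq ∧ a = toState q ∧ b = toState fun j z => dq j z + E.lower q j z

lemma intervalIntegrable_inner {X : ℝ → StateL2} (hX : ContinuousOn X (Ici 0))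
    {b : ℝ → StateL2} (hb : Continuous b) {T : ℝ} (hT : 0 ≤ T) :
    IntervalIntegrable (fun t => inner ℝ (X t) (b t)) volume 0 T := by
  refine ContinuousOn.intervalIntegrable ?_
  rw [uIcc_of_le hT]
  exact (hX.mono Icc_subset_Ici_self).inner hb.continuousOn

lemma IsWeakOrbit.sub {D : StateL2 → StateL2 → Prop} {X Y : ℝ → StateL2} (hX : IsWeakOrbit D X)
    (hY : IsWeakOrbit D Y) : IsWeakOrbit D fun t => X t - Y t := by
  refine ⟨hX.cont.sub hY.cont, fun a b hab T hT => ?_⟩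
  simp only [inner_sub_left]
  rw [intervalIntegral.integral_sub (intervalIntegrable_inner hX.cont continuous_const hT)
    (intervalIntegrable_inner hY.cont continuous_const hT), ← hX.weak a b hab T hT,
    ← hY.weak a b hab T hT]
  ring

namespace Speed

variable (S : Speed)

/-- The transport semigroup on pairs. -/
noncomputable def shiftState (X : StateL2) (t : ℝ) : StateL2 :=
  WithLp.toLp 2 fun i => S.shift (X i) t

lemma shiftState_apply (X : StateL2) (t : ℝ) (i : Fin 2) : S.shiftState X t i = S.shift (X i) t :=
  rfl

lemma shiftState_zero (X : StateL2) : S.shiftState X 0 = X := by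
  ext1 i
  rw [shiftState_apply, shift_zero]

lemma shiftState_eq_zero (X : StateL2) {t : ℝ} (ht : S.phi 1 - S.phi (-1) ≤ t) :
    S.shiftState X t = 0 := by
  ext1 i
  rw [shiftState_apply, S.shift_eq_zero _ ht, PiLp.zero_apply]

lemma continuous_shiftState (X : StateL2) : Continuous (S.shiftState X) :=
  (PiLp.continuousLinearEquiv 2 ℝ fun _ : Fin 2 => L2I).symm.continuous.comp
    (continuous_pi fun i => S.continuous_shift (X i))

lemma isWeakOrbit_shiftState (X : StateL2) : IsWeakOrbit S.TransportGraph (S.shiftState X) := by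
  refine ⟨(S.continuous_shiftState X).continuousOn, ?_⟩
  rintro _ _ ⟨p, dp, h, rfl, rfl⟩ T hT
  have hi : ∀ j, IntervalIntegrable (fun t => pairing (S.shift (X j) t) (dp j)) volume 0 T :=
    fun j => by
      simp only [← inner_toL2 _ (memLp_of_continuous (h.cont_deriv j))]
      exact Continuous.intervalIntegrable
        ((S.continuous_shift (X j)).inner continuous_const) _ _
  simp only [inner_toState _ h.cont, inner_toState _ h.cont_deriv, shiftState_zero,
    shiftState_apply, Fin.sum_univ_two]
  rw [intervalIntegral.integral_add (hi 0) (hi 1),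
    ← S.pairing_shift_sub (X 0) (h.cont 0) (h.cont_deriv 0) (h.deriv 0) (h.zero 0) hT,
    ← S.pairing_shift_sub (X 1) (h.cont 1) (h.cont_deriv 1) (h.deriv 1) (h.zero 1) hT]
  ring

/-- Test pairs transported along the characteristics. -/
lemma isTestPair_travelling {g : ℝ → ℝ} (hg : ContDiff ℝ 1 g)
    (hs : tsupport g ⊆ Ioo (S.phi (-1)) (S.phi 1)) (i₀ : Fin 2) {s : ℝ} (hs0 : 0 ≤ s) :
    IsTestPair S (fun i w => if i = i₀ then g (S.phi w + s) / S.v w else 0)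
      (fun i w => if i = i₀ then deriv g (S.phi w + s) / S.v w else 0) := by
  have hphi := S.phi_continuous
  have hv := S.cont
  have hg' := hg.continuous_deriv le_rfl
  have hgc := hg.continuous
  have hne := S.ne
  refine ⟨fun i => ?_, fun i => ?_, fun i w _ => ?_, fun i => ?_⟩
  · split_ifs
    · fun_prop (disch := exact hne _)
    · exact continuous_const
  · split_ifs
    · fun_prop (disch := exact hne _)
    · exact continuous_const
  · split_ifs
    · have h1 : HasDerivAt (fun w => g (S.phi w + s)) (deriv g (S.phi w + s) * (1 / S.v w)) w :=
        (hg.differentiable one_ne_zero _).hasDerivAt.comp w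
          ((S.phi_hasDerivAt w).add_const s)
      have e : (fun w => S.v w * (g (S.phi w + s) / S.v w)) = fun w => g (S.phi w + s) := by
        funext w; exact mul_div_cancel₀ _ (S.ne w)
      rw [e, div_eq_mul_one_div]
      exact h1.hasDerivWithinAt
    · simpa using hasDerivWithinAt_const w spaceI (0 : ℝ)
  · split_ifs
    · rw [image_eq_zero_of_notMem_tsupport (f := g) (x := S.phi 1 + s) fun h => by
        linarith [(hs h).2],
        zero_div]
    · rfl

lemma pairing_comp_phi_div (X : L2I) (g : ℝ → ℝ) :
    pairing X (fun w => g (S.phi w) / S.v w) = ∫ y, S.pushFun X y * g y := by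
  have h := S.pairing_shift X 0 fun w => g (S.phi w) / S.v w
  rw [shift_zero] at h
  rw [h]
  refine integral_congr_ae (ae_of_all _ fun y => ?_)
  simp only [add_zero, phi_psi]
  by_cases hy : y ∈ Icc (S.phi (-1)) (S.phi 1)
  · rw [indicator_of_mem hy, mul_div_cancel₀ _ (S.ne _)]
  · rw [S.pushFun_eq_zero X hy, zero_mul, zero_mul]

lemma eq_zero_of_isWeakOrbit {Z : ℝ → StateL2} (hZ : IsWeakOrbit S.TransportGraph Z)
    (h0 : Z 0 = 0) {T : ℝ} (hT : 0 ≤ T) : Z T = 0 := by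
  have hphi := S.phi_continuous
  have hv := S.cont
  have hne := S.ne
  ext1 i₀
  refine S.eq_zero_of_forall_integral_pushFun _ fun g hg hs => ?_
  have hg' := hg.continuous_deriv le_rfl
  have hgc := hg.continuous
  let p : Fin 2 → ℝ → ℝ → ℝ := fun i w t => if i = i₀ then g (S.phi w + (T - t)) / S.v w else 0
  let dp : Fin 2 → ℝ → ℝ → ℝ := fun i w t =>
    if i = i₀ then deriv g (S.phi w + (T - t)) / S.v w else 0
  have hp : ∀ i, Continuous fun x : ℝ × ℝ => p i x.1 x.2 := fun i => by
    simp only [p]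
    split_ifs
    · exact Continuous.div (by fun_prop) (by fun_prop) fun x => hne _
    · exact continuous_const
  have hdp : ∀ i, Continuous fun x : ℝ × ℝ => dp i x.1 x.2 := fun i => by
    simp only [dp]
    split_ifs
    · exact Continuous.div (by fun_prop) (by fun_prop) fun x => hne _
    · exact continuous_const
  have hd : ∀ i, ∀ w ∈ spaceI, ∀ t, HasDerivAt (p i w) (-dp i w t) t := fun i w _ t => by
    simp only [p, dp]
    split_ifs
    · have h1 := (hg.differentiable one_ne_zero (S.phi w + (T - t))).hasDerivAt.comp t
        (((hasDerivAt_id t).const_sub T).const_add (S.phi w))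
      refine (h1.div_const (S.v w)).congr_deriv ?_
      simp only [mul_neg, mul_one, neg_div]
    · simpa using hasDerivAt_const t (0 : ℝ)
  have key := inner_sub_inner_eq_integral hZ.cont (hasDerivAt_toState hp (fun i => (hdp i).neg) hd)
    (continuous_toState fun i => (hdp i).neg) (continuous_toState hdp) hT
    fun t ht τ hτ => hZ.weak _ _
      ⟨_, _, S.isTestPair_travelling hg hs i₀ (sub_nonneg.2 ht.2), rfl, rfl⟩ τ hτ
  have hzero : ∀ t, (toState fun i w => dp i w t) + toState (fun i w => -dp i w t) = 0 :=
    fun t => by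
      have hc : ∀ i, Continuous fun w => dp i w t := fun i =>
        (hdp i).comp (f := fun w => (w, t)) (by fun_prop)
      have e : toState (fun i w => -dp i w t) =
          toState (fun _ _ => 0) - toState fun i w => dp i w t := by
        rw [← ExtendedKernel.toState_sub (fun _ => continuous_const) hc]
        simp only [zero_sub]
      have e0 : toState (fun _ _ => 0) = 0 := by
        have := ExtendedKernel.toState_sub (p := fun _ _ => 0) (q := fun _ _ => 0)
          (fun _ => continuous_const) (fun _ => continuous_const)
        simpa using this
      rw [e, e0]
      abel
  simp only [hzero, inner_zero_right, intervalIntegral.integral_zero, h0, inner_zero_left,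
    sub_zero] at key
  rw [inner_toState (q := fun i w => p i w T) _ fun i =>
      (hp i).comp (f := fun w => (w, T)) (by fun_prop),
    Finset.sum_eq_single i₀] at key
  · simp only [p, if_true, sub_self, add_zero] at key
    rw [pairing_comp_phi_div] at key
    exact key
  · intro i _ hi
    simp [p, hi, pairing]
  · simp

lemma eq_shiftState_of_isWeakOrbit {Y : ℝ → StateL2} (hY : IsWeakOrbit S.TransportGraph Y)
    {T : ℝ} (hT : 0 ≤ T) : Y T = S.shiftState (Y 0) T := by
  refine sub_eq_zero.1 (S.eq_zero_of_isWeakOrbit (hY.sub (S.isWeakOrbit_shiftState (Y 0))) ?_ hT)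
  rw [shiftState_zero, sub_self]

end Speed

namespace ExtendedKernel

variable {S : Speed} {c : Fin 2 → ℝ → ℝ} (E : ExtendedKernel S c)

lemma isWeakOrbit_backstep {X : ℝ → StateL2} (hX : IsWeakOrbit E.AdjointGraph X) :
    IsWeakOrbit S.TransportGraph fun t => E.backstep (X t) := by
  refine ⟨E.backstep.continuous.comp_continuousOn hX.cont, ?_⟩
  rintro _ _ ⟨p, dp, h, rfl, rfl⟩ T hT
  simp only [E.inner_backstep _ h.cont, E.inner_backstep _ h.cont_deriv]
  refine hX.weak _ _ ⟨_, _, E.isTestPair_transpose h, rfl, ?_⟩ T hT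
  simp only [sub_add_cancel]

lemma isWeakOrbit_of_backstep {X : ℝ → StateL2} (hX : ContinuousOn X (Ici 0))
    (h : IsWeakOrbit S.TransportGraph fun t => E.backstep (X t)) :
    IsWeakOrbit E.AdjointGraph X := by
  refine ⟨hX, ?_⟩
  rintro _ _ ⟨q, dq, hq, rfl, rfl⟩ T hT
  obtain ⟨p, dp, hp, e1, e2⟩ := E.exists_transpose_ae_eq hq
  simp only [e1, e2, ← E.inner_backstep _ hp.cont, ← E.inner_backstep _ hp.cont_deriv]
  exact h.weak _ _ ⟨p, dp, hp, rfl, rfl⟩ T hT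

/-- Well-posedness and extinction in finite time of the closed loop system, in dual form. -/
theorem exists_unique_weakOrbit (X₀ : StateL2) :
    ∃ X, X 0 = X₀ ∧ IsWeakOrbit E.AdjointGraph X ∧
      (∀ X', X' 0 = X₀ → IsWeakOrbit E.AdjointGraph X' → ∀ t, 0 ≤ t → X' t = X t) ∧
      ∀ t, S.phi 1 - S.phi (-1) ≤ t → X t = 0 := by
  obtain ⟨u, hu⟩ := E.isUnit_backstep
  have h1 : ∀ Y : StateL2, E.backstep ((↑u⁻¹ : StateL2 →L[ℝ] StateL2) Y) = Y := fun Y => by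
    have : (↑u * ↑u⁻¹ : StateL2 →L[ℝ] StateL2) Y = Y := by rw [u.mul_inv]; rfl
    rwa [hu] at this
  have h2 : ∀ X : StateL2, (↑u⁻¹ : StateL2 →L[ℝ] StateL2) (E.backstep X) = X := fun X => by
    have : (↑u⁻¹ * ↑u : StateL2 →L[ℝ] StateL2) X = X := by rw [u.inv_mul]; rfl
    rwa [hu] at this
  refine ⟨fun t => (↑u⁻¹ : StateL2 →L[ℝ] StateL2) (S.shiftState (E.backstep X₀) t), ?_, ?_, ?_, ?_⟩
  · simp only [S.shiftState_zero, h2]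
  · refine E.isWeakOrbit_of_backstep
      ((ContinuousLinearMap.continuous _).comp (S.continuous_shiftState _)).continuousOn ?_
    simp only [h1]
    exact S.isWeakOrbit_shiftState _
  · intro X' hX0 hX t ht
    have := S.eq_shiftState_of_isWeakOrbit (E.isWeakOrbit_backstep hX) ht
    rw [hX0] at this
    simp only
    rw [← this, h2]
  · intro t ht
    simp only [S.shiftState_eq_zero _ ht, map_zero]

end ExtendedKernel

lemma measurePreserving_neg_spaceI :
    MeasurePreserving (fun z : ℝ => -z) (volume.restrict spaceI) (volume.restrict spaceI) := by
  have h := (Measure.measurePreserving_neg (volume : Measure ℝ)).restrict_preimage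
    (s := spaceI) measurableSet_Icc
  have e : (Neg.neg : ℝ → ℝ) ⁻¹' spaceI = spaceI := by
    ext z
    simp only [mem_preimage, mem_spaceI_iff, abs_neg]
  rwa [e] at h

/-- The reflection of an `L²` function on `[-1, 1]`. -/
noncomputable def reflect : L2I →+ L2I :=
  Lp.compMeasurePreserving (fun z : ℝ => -z) measurePreserving_neg_spaceI

lemma continuous_reflect : Continuous reflect :=
  (Lp.isometry_compMeasurePreserving measurePreserving_neg_spaceI).continuous

lemma coeFn_reflect (X : L2I) : reflect X =ᵐ[volume.restrict spaceI] fun z => X (-z) :=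
  Lp.coeFn_compMeasurePreserving X measurePreserving_neg_spaceI

lemma reflect_reflect (X : L2I) : reflect (reflect X) = X := by
  refine Lp.ext ((coeFn_reflect _).trans ?_)
  have h := measurePreserving_neg_spaceI.quasiMeasurePreserving.ae_eq_comp (coeFn_reflect X)
  filter_upwards [h] with z hz
  simpa using hz

lemma pairing_reflect (X : L2I) (f : ℝ → ℝ) :
    pairing (reflect X) f = pairing X fun z => f (-z) := by
  have h1 : pairing (reflect X) f = ∫ z in spaceI, X (-z) * f z := by
    refine integral_congr_ae ?_
    filter_upwards [coeFn_reflect X] with z hz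
    rw [hz]
  rw [h1, pairing, ← measurePreserving_neg_spaceI.integral_comp
    (MeasurableEquiv.neg ℝ).measurableEmbedding]
  simp only [neg_neg]

/-- The pair of functions `u(w)`, `v(-w)`. -/
noncomputable def stateOf (u v : L2I) : StateL2 := WithLp.toLp 2 ![u, reflect v]

lemma stateOf_apply_zero (u v : L2I) : stateOf u v 0 = u := rfl

lemma stateOf_apply_one (u v : L2I) : stateOf u v 1 = reflect v := rfl

lemma stateOf_eta (X : StateL2) : stateOf (X 0) (reflect (X 1)) = X := by
  ext1 i
  fin_cases i
  · rfl
  · exact reflect_reflect _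

lemma stateOf_inj {u v u' v' : L2I} : stateOf u v = stateOf u' v' ↔ u = u' ∧ v = v' := by
  refine ⟨fun h => ⟨congrArg (fun X : StateL2 => X 0) h, ?_⟩, fun h => by rw [h.1, h.2]⟩
  rw [← reflect_reflect v, ← reflect_reflect v']
  exact congrArg (fun X : StateL2 => reflect (X 1)) h

lemma continuousOn_stateOf_iff {u v : ℝ → L2I} {s : Set ℝ} :
    ContinuousOn (fun t => stateOf (u t) (v t)) s ↔ ContinuousOn u s ∧ ContinuousOn v s := by
  have hp : ∀ i : Fin 2, Continuous fun X : StateL2 => X i := fun i => by fun_prop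
  constructor
  · refine fun h => ⟨(hp 0).comp_continuousOn h, ?_⟩
    refine ((continuous_reflect.comp (hp 1)).comp_continuousOn h).congr fun t _ => ?_
    exact (reflect_reflect _).symm
  · rintro ⟨hu, hv⟩
    refine (PiLp.continuousLinearEquiv 2 ℝ fun _ : Fin 2 => L2I).symm.continuous.comp_continuousOn
      (f := fun t => ![u t, reflect (v t)]) (continuousOn_pi.2 fun i => ?_)
    fin_cases i
    · exact hu
    · exact continuous_reflect.comp_continuousOn hv

lemma inner_stateOf (u v : L2I) {q : Fin 2 → ℝ → ℝ} (hq : ∀ i, Continuous (q i)) :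
    inner ℝ (stateOf u v) (toState q) = pairing u (q 0) + pairing v fun z => q 1 (-z) := by
  rw [inner_toState _ hq, Fin.sum_univ_two, stateOf_apply_zero, stateOf_apply_one, pairing_reflect]

lemma pairing_add_four (X : L2I) {f₁ f₂ f₃ f₄ : ℝ → ℝ} (h₁ : ContinuousOn f₁ spaceI)
    (h₂ : ContinuousOn f₂ spaceI) (h₃ : ContinuousOn f₃ spaceI) (h₄ : ContinuousOn f₄ spaceI)
    (r s : ℝ) :
    pairing X (fun z => f₁ z + f₂ z + (f₃ z * r + f₄ z * s)) =
      pairing X f₁ + pairing X f₂ + (pairing X f₃ * r + pairing X f₄ * s) := by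
  have h₃r : ContinuousOn (fun z => f₃ z * r) spaceI := h₃.mul continuousOn_const
  have h₄s : ContinuousOn (fun z => f₄ z * s) spaceI := h₄.mul continuousOn_const
  rw [pairing_add X (f := fun z => f₁ z + f₂ z) (g := fun z => f₃ z * r + f₄ z * s)
      (memLp_of_continuousOn (h₁.add h₂)) (memLp_of_continuousOn (h₃r.add h₄s)),
    pairing_add X (memLp_of_continuousOn h₁) (memLp_of_continuousOn h₂),
    pairing_add X (memLp_of_continuousOn h₃r) (memLp_of_continuousOn h₄s), pairing_mul_const,
    pairing_mul_const]

lemma integral_mul_add_mul (X Y : L2I) {f g h : ℝ → ℝ} (hf : ContinuousOn f spaceI)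
    (hg : ContinuousOn g spaceI) (hh : ContinuousOn h spaceI) :
    ∫ z in spaceI, (X z * f z + g z * Y z * h z) = pairing X f + pairing Y fun z => g z * h z := by
  have hgh : ContinuousOn (fun z => g z * h z) spaceI := hg.mul hh
  rw [pairing, pairing, ← integral_add (integrable_L2_mul X (memLp_of_continuousOn hf))
    (integrable_L2_mul Y (memLp_of_continuousOn hgh))]
  exact integral_congr_ae (ae_of_all _ fun z => by simp only; ring)

section Feedback

variable {lam mu b c : ℝ → ℝ} {K : Kernels}

lemma continuousOn_section {f : ℝ → ℝ → ℝ}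
    (hf : ContinuousOn (fun x : ℝ × ℝ => f x.1 x.2) kernelDomain) {w : ℝ} (hw : |w| = 1) :
    ContinuousOn (fun z => f z w) spaceI :=
  hf.comp (f := fun z => (z, w)) (by fun_prop) fun z hz =>
    mem_kernelDomain_iff.2 ⟨hw ▸ mem_spaceI_iff.1 hz, hw.le⟩

lemma Kernels.feedbackLeft_eq (K : Kernels) (u v : L2I) :
    K.feedbackLeft u v =
      -pairing u (fun z => K.L11 z (-1)) - pairing v fun z => K.L12 z (-1) := rfl

lemma Kernels.feedbackRight_eq (K : Kernels) (u v : L2I) :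
    K.feedbackRight u v = pairing u (fun z => K.L21 z 1) + pairing v fun z => K.L22 z 1 := rfl

lemma continuousOn_pairing {u : ℝ → L2I} {s : Set ℝ} (hu : ContinuousOn u s) {f : ℝ → ℝ}
    (hf : ContinuousOn f spaceI) : ContinuousOn (fun t => pairing (u t) f) s := by
  simp only [← inner_toL2 _ (memLp_of_continuousOn hf)]
  exact hu.inner continuousOn_const

lemma Kernels.IsSolution.continuousOn_feedbackLeft (hK : K.IsSolution lam mu b c) {u v : ℝ → L2I}
    {s : Set ℝ} (hu : ContinuousOn u s) (hv : ContinuousOn v s) :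
    ContinuousOn (fun t => K.feedbackLeft (u t) (v t)) s :=
  (continuousOn_pairing hu (continuousOn_section hK.cont11 (by norm_num))).neg.sub
    (continuousOn_pairing hv (continuousOn_section hK.cont12 (by norm_num)))

lemma Kernels.IsSolution.continuousOn_feedbackRight (hK : K.IsSolution lam mu b c) {u v : ℝ → L2I}
    {s : Set ℝ} (hu : ContinuousOn u s) (hv : ContinuousOn v s) :
    ContinuousOn (fun t => K.feedbackRight (u t) (v t)) s :=
  (continuousOn_pairing hu (continuousOn_section hK.cont21 (by norm_num))).add
    (continuousOn_pairing hv (continuousOn_section hK.cont22 (by norm_num)))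

variable {S : Speed} {C : Fin 2 → ℝ → ℝ}

/-- The right hand side of the dual formulation in terms of the original unknowns. -/
lemma SystemData.inner_stateOf_adjoint (h : SystemData lam mu b c S C)
    (hb : ContinuousOn b spaceI) (hc : ContinuousOn c spaceI) (hK : K.IsSolution lam mu b c)
    (E : ExtendedKernel S C)
    (hE : ∀ i j z w, (z, w) ∈ kernelDomain → E.M i j z w = K.toMatrix i j z w)
    (u v : L2I) {q dq : Fin 2 → ℝ → ℝ} (hq : ∀ i, Continuous (q i)) (hdq : ∀ i, Continuous (dq i)) :
    inner ℝ (stateOf u v) (toState fun j z => dq j z + E.lower q j z) =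
      (∫ z in spaceI, (u z * dq 0 z + b z * v z * q 0 z)) +
        lam (-1) * q 0 (-1) * K.feedbackLeft u v +
      ((∫ z in spaceI, (v z * dq 1 (-z) + c z * u z * q 1 (-z))) +
        mu 1 * q 1 (-1) * K.feedbackRight u v) := by
  have hneg : ∀ {f : ℝ → ℝ}, Continuous f → ContinuousOn (fun z => f (-z)) spaceI := fun hf =>
    (hf.comp continuous_neg).continuousOn
  have c11 := continuousOn_section hK.cont11 (w := -1) (by norm_num)
  have c12 := continuousOn_section hK.cont12 (w := -1) (by norm_num)
  have c21 := continuousOn_section hK.cont21 (w := 1) (by norm_num)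
  have c22 := continuousOn_section hK.cont22 (w := 1) (by norm_num)
  have hl : S.v (-1) = lam (-1) := h.lam_eq _ (by simp [spaceI])
  have hm : mu 1 = lam (-1) := by rw [← hl, h.mu_eq 1 (by simp [spaceI])]
  have hdom : ∀ z ∈ spaceI, (z, -1) ∈ kernelDomain := fun z hz =>
    mem_kernelDomain_iff.2 ⟨by simpa using mem_spaceI_iff.1 hz, by simp⟩
  have e0 : ∀ z ∈ spaceI, dq 0 z + E.lower q 0 z = dq 0 z + c z * q 1 (-z) +
      (K.L11 z (-1) * (-(lam (-1) * q 0 (-1))) + K.L21 z 1 * (lam (-1) * q 1 (-1))) :=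
    fun z hz => by
      rw [ExtendedKernel.lower, Fin.sum_univ_two, hE _ _ _ _ (hdom z hz), hE _ _ _ _ (hdom z hz),
        hl, ← h.c_eq z hz]
      simp [Kernels.toMatrix]
      ring
  have e1 : ∀ z ∈ spaceI, dq 1 (-z) + E.lower q 1 (-z) = dq 1 (-z) + b z * q 0 z +
      (K.L12 z (-1) * (-(lam (-1) * q 0 (-1))) + K.L22 z 1 * (lam (-1) * q 1 (-1))) :=
    fun z hz => by
      rw [ExtendedKernel.lower, Fin.sum_univ_two, hE _ _ _ _ (hdom _ (neg_mem_spaceI hz)),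
        hE _ _ _ _ (hdom _ (neg_mem_spaceI hz)), hl, ← h.b_eq z hz]
      simp [Kernels.toMatrix]
      ring
  rw [inner_stateOf (q := fun j z => dq j z + E.lower q j z) _ _ fun i =>
      (hdq i).add (E.continuous_lower hq i), pairing_congr u e0,
    pairing_congr v e1,
    pairing_add_four u (f₂ := fun z => c z * q 1 (-z))
      (hdq 0).continuousOn (hc.mul (hneg (hq 1))) c11 c21,
    pairing_add_four v (f₂ := fun z => b z * q 0 z)
      (hneg (hdq 1)) (hb.mul (hq 0).continuousOn) c12 c22,
    integral_mul_add_mul u v (hdq 0).continuousOn hb (hq 0).continuousOn,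
    integral_mul_add_mul v u (hneg (hdq 1)) hc (hneg (hq 1)), K.feedbackLeft_eq,
    K.feedbackRight_eq, hm]
  ring

end Feedback

/-- A function on `[-1, 1]` whose product with a `C¹` function `κ` is `C¹` extends to a `C¹`
function on the line. -/
lemma exists_contDiff_extension {κ κ' q dq : ℝ → ℝ}
    (hκ : ∀ w ∈ spaceI, HasDerivWithinAt κ (κ' w) spaceI w) (hκ' : ContinuousOn κ' spaceI)
    (h0 : ∀ w ∈ spaceI, κ w ≠ 0) (hdq : ContinuousOn dq spaceI)
    (hd : ∀ w ∈ spaceI, HasDerivWithinAt (fun w => κ w * q w) (dq w) spaceI w) :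
    ∃ P : ℝ → ℝ, ContDiff ℝ 1 P ∧ (∀ w ∈ spaceI, P w = q w) ∧
      ∀ w ∈ spaceI, κ w * deriv P w + κ' w * P w = dq w := by
  have hκc : ContinuousOn κ spaceI := fun w hw => (hκ w hw).continuousWithinAt
  have hqd : ∀ w ∈ spaceI, HasDerivWithinAt q ((dq w - κ' w * q w) / κ w) spaceI w :=
    fun w hw => by
      have h := (hd w hw).fun_div (hκ w hw) (h0 w hw)
      have h1 := h0 w hw
      refine (h.congr_deriv ?_).congr (fun x hx => ?_) ?_
      · field_simp
      · rw [mul_div_cancel_left₀ _ (h0 x hx)]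
      · rw [mul_div_cancel_left₀ _ h1]
  have hqc : ContinuousOn q spaceI := fun w hw => (hqd w hw).continuousWithinAt
  have hr : ContinuousOn (fun w => (dq w - κ' w * q w) / κ w) spaceI :=
    (hdq.sub (hκ'.mul hqc)).div hκc h0
  have hrc := hr.comp_clampTo
  set r : ℝ → ℝ := fun x => (dq (clampTo 1 x) - κ' (clampTo 1 x) * q (clampTo 1 x)) /
    κ (clampTo 1 x) with hrdef
  let P : ℝ → ℝ := fun w => q 1 + ∫ x in (1 : ℝ)..w, r x
  have hP : ∀ w, HasDerivAt P (r w) w := fun w =>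
    (intervalIntegral.integral_hasDerivAt_right (hrc.intervalIntegrable 1 w)
      (hrc.stronglyMeasurableAtFilter _ _) hrc.continuousAt).const_add (q 1)
  have hPr : deriv P = r := funext fun w => (hP w).deriv
  have hre : ∀ w ∈ spaceI, r w = (dq w - κ' w * q w) / κ w := fun w hw => by
    simp only [hrdef, clampTo_of_mem hw]
  have hPq : ∀ w ∈ spaceI, P w = q w := fun w hw => by
    have h1 : (1 : ℝ) ∈ spaceI := by simp [spaceI]
    have := (convex_Icc (-1 : ℝ) 1).norm_image_sub_le_of_norm_hasDerivWithin_le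
      (f := fun w => P w - q w) (f' := fun _ => 0) (C := 0)
      (fun x hx => by
        have := (hP x).hasDerivWithinAt.fun_sub (hqd x hx)
        rwa [hre x hx, sub_self] at this) (fun _ _ => by simp) h1 hw
    rw [zero_mul, norm_le_zero_iff] at this
    have hP1 : P 1 = q 1 := by simp [P]
    rw [hP1] at this
    linarith
  refine ⟨P, contDiff_one_iff_deriv.2 ⟨fun w => (hP w).differentiableAt, hPr ▸ hrc⟩, hPq,
    fun w hw => ?_⟩
  rw [hPr, hre w hw, hPq w hw, mul_div_cancel₀ _ (h0 w hw), sub_add_cancel]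

lemma ContinuousOn.intervalIntegrable_of_Ici {f : ℝ → ℝ} (hf : ContinuousOn f (Ici 0)) {T : ℝ}
    (hT : 0 ≤ T) : IntervalIntegrable f volume 0 T :=
  ContinuousOn.intervalIntegrable (by
    rw [uIcc_of_le hT]; exact hf.mono Icc_subset_Ici_self)

lemma toState_add {p q : Fin 2 → ℝ → ℝ} (hp : ∀ i, Continuous (p i))
    (hq : ∀ i, Continuous (q i)) :
    toState (fun j z => p j z + q j z) = toState p + toState q := by
  rw [← sub_eq_iff_eq_add, ← ExtendedKernel.toState_sub (p := fun j z => p j z + q j z)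
    (fun i => (hp i).add (hq i)) hq]
  simp only [add_sub_cancel_right]

lemma ExtendedKernel.continuous_lower_param {S : Speed} {C : Fin 2 → ℝ → ℝ}
    (E : ExtendedKernel S C) {f : Fin 2 → ℝ → ℝ → ℝ}
    (hf : ∀ i, Continuous fun x : ℝ × ℝ => f i x.1 x.2) (j : Fin 2) :
    Continuous fun x : ℝ × ℝ => E.lower (fun i w => f i w x.2) j x.1 := by
  unfold ExtendedKernel.lower
  refine Continuous.sub ?_ (continuous_const.mul (continuous_finsetSum _ fun i _ => ?_))
  · exact ((E.cont_coupling _).comp (continuous_fst.neg)).mul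
      ((hf j.rev).comp (f := fun x : ℝ × ℝ => (-x.1, x.2)) (by fun_prop))
  · exact ((E.cont i j).comp (f := fun x : ℝ × ℝ => (x.1, -1)) (by fun_prop)).mul
      ((hf i).comp (f := fun x : ℝ × ℝ => (-1, x.2)) (by fun_prop))

namespace SystemData

variable {lam mu b c : ℝ → ℝ} {K : Kernels} {S : Speed} {C : Fin 2 → ℝ → ℝ}

lemma isWeakOrbit_of_isClosedLoopSolution (h : SystemData lam mu b c S C)
    (hmu : ContDiffOn ℝ 1 mu spaceI)
    (hb : ContinuousOn b spaceI) (hc : ContinuousOn c spaceI) (hK : K.IsSolution lam mu b c)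
    (E : ExtendedKernel S C)
    (hE : ∀ i j z w, (z, w) ∈ kernelDomain → E.M i j z w = K.toMatrix i j z w)
    {u₀ v₀ : L2I} {u v : ℝ → L2I} (hcl : IsClosedLoopSolution lam mu b c K u₀ v₀ u v) :
    IsWeakOrbit E.AdjointGraph fun t => stateOf (u t) (v t) := by
  refine ⟨continuousOn_stateOf_iff.2 ⟨hcl.cont_u, hcl.cont_v⟩, ?_⟩
  rintro _ _ ⟨q, dq, hq, rfl, rfl⟩ T hT
  have h1 : (1 : ℝ) ∈ spaceI := by simp [spaceI]
  have hn1 : (-1 : ℝ) ∈ spaceI := by simp [spaceI]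
  have hmu' : ContinuousOn (derivWithin mu spaceI) spaceI :=
    hmu.continuousOn_derivWithin (uniqueDiffOn_Icc (by norm_num)) le_rfl
  obtain ⟨P, hP, hPq, hPd⟩ := exists_contDiff_extension (q := q 0) (dq := dq 0) h.lam_deriv
    h.lam_deriv_cont (fun w hw => by rw [← h.lam_eq w hw]; exact S.ne w)
    (hq.cont_deriv 0).continuousOn
    fun w hw => (hq.deriv 0 w hw).congr (fun x hx => by rw [h.lam_eq x hx]) (by rw [h.lam_eq w hw])
  obtain ⟨Q, hQ, hQq, hQd⟩ := exists_contDiff_extension (q := fun w => q 1 (-w))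
    (dq := fun w => -dq 1 (-w)) h.mu_deriv
    hmu' (fun w hw => by rw [← h.mu_eq w hw]; exact S.ne _)
    ((hq.cont_deriv 1).comp continuous_neg).neg.continuousOn fun w hw => by
      have := (hq.deriv 1 (-w) (neg_mem_spaceI hw)).scomp w (hasDerivWithinAt_neg w spaceI)
        fun x hx => neg_mem_spaceI hx
      refine (this.congr_deriv (by simp)).congr (fun x hx => ?_) ?_
      · simp [h.mu_eq x hx]
      · simp [h.mu_eq w hw]
  have hu := hcl.weak_u T hT (fun w _ => P w) (by fun_prop) fun _ _ => by
    rw [hPq 1 h1, hq.zero]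
  have hv := hcl.weak_v T hT (fun w _ => Q w) (by fun_prop) fun _ _ => by
    rw [hQq _ hn1, neg_neg, hq.zero]
  have iu : ∀ t, ∫ w in spaceI, (u t w * (deriv (fun _ : ℝ => P w) t
      + lam w * deriv (fun x => P x) w
      + derivWithin lam spaceI w * P w) + b w * v t w * P w) =
      ∫ w in spaceI, (u t w * dq 0 w + b w * v t w * q 0 w) := fun t =>
    setIntegral_congr_fun measurableSet_Icc fun w hw => by
      simp only [deriv_const, zero_add]
      rw [← hPd w hw, hPq w hw]
  have iv : ∀ t, ∫ w in spaceI, (v t w * (deriv (fun _ : ℝ => Q w) t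
      - mu w * deriv (fun x => Q x) w
      - derivWithin mu spaceI w * Q w) + c w * u t w * Q w) =
      ∫ w in spaceI, (v t w * dq 1 (-w) + c w * u t w * q 1 (-w)) := fun t =>
    setIntegral_congr_fun measurableSet_Icc fun w hw => by
      simp only [deriv_const, zero_sub]
      rw [← neg_neg (dq 1 (-w)), ← hQd w hw, hQq w hw]
      ring
  have pu : ∀ X : L2I, ∫ w in spaceI, X w * P w = pairing X (q 0) := fun X => pairing_congr X hPq
  have pv : ∀ X : L2I, ∫ w in spaceI, X w * Q w = pairing X fun w => q 1 (-w) := fun X =>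
    pairing_congr X hQq
  simp only [iu, pu, hPq _ hn1] at hu
  simp only [iv, pv, hQq _ h1] at hv
  have hcn : ∀ {f : ℝ → ℝ}, Continuous f → ContinuousOn (fun z => f (-z)) spaceI := fun hf =>
    (hf.comp continuous_neg).continuousOn
  have cu : ContinuousOn (fun t => ∫ w in spaceI, (u t w * dq 0 w + b w * v t w * q 0 w))
      (Ici 0) := by
    simp only [integral_mul_add_mul _ _ (hq.cont_deriv 0).continuousOn hb (hq.cont 0).continuousOn]
    exact (continuousOn_pairing hcl.cont_u (hq.cont_deriv 0).continuousOn).add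
      (continuousOn_pairing hcl.cont_v (hb.mul (hq.cont 0).continuousOn))
  have cv : ContinuousOn (fun t => ∫ w in spaceI, (v t w * dq 1 (-w) + c w * u t w * q 1 (-w)))
      (Ici 0) := by
    simp only [integral_mul_add_mul _ _ (hcn (hq.cont_deriv 1)) hc (hcn (hq.cont 1))]
    exact (continuousOn_pairing hcl.cont_v (hcn (hq.cont_deriv 1))).add
      (continuousOn_pairing hcl.cont_u (hc.mul (hcn (hq.cont 1))))
  have bu : ContinuousOn (fun t => lam (-1) * q 0 (-1) * K.feedbackLeft (u t) (v t)) (Ici 0) :=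
    continuousOn_const.mul (hK.continuousOn_feedbackLeft hcl.cont_u hcl.cont_v)
  have bv : ContinuousOn (fun t => mu 1 * q 1 (-1) * K.feedbackRight (u t) (v t)) (Ici 0) :=
    continuousOn_const.mul (hK.continuousOn_feedbackRight hcl.cont_u hcl.cont_v)
  simp only [h.inner_stateOf_adjoint hb hc hK E hE _ _ hq.cont hq.cont_deriv]
  rw [intervalIntegral.integral_add
      ((cu.intervalIntegrable_of_Ici hT).add (bu.intervalIntegrable_of_Ici hT))
      ((cv.intervalIntegrable_of_Ici hT).add (bv.intervalIntegrable_of_Ici hT)),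
    intervalIntegral.integral_add (cu.intervalIntegrable_of_Ici hT)
      (bu.intervalIntegrable_of_Ici hT),
    intervalIntegral.integral_add (cv.intervalIntegrable_of_Ici hT)
      (bv.intervalIntegrable_of_Ici hT), inner_stateOf _ _ hq.cont, inner_stateOf _ _ hq.cont,
    ← hu, ← hv, hcl.init_u, hcl.init_v]
  ring

/-- The dual formulation with time dependent test functions. -/
lemma weak_timeDependent (h : SystemData lam mu b c S C)
    (hb : ContinuousOn b spaceI) (hc : ContinuousOn c spaceI) (hK : K.IsSolution lam mu b c)
    (E : ExtendedKernel S C)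
    (hE : ∀ i j z w, (z, w) ∈ kernelDomain → E.M i j z w = K.toMatrix i j z w)
    {u v : ℝ → L2I} (hX : IsWeakOrbit E.AdjointGraph fun t => stateOf (u t) (v t))
    {f df ft : Fin 2 → ℝ → ℝ → ℝ} (hf : ∀ i, Continuous fun x : ℝ × ℝ => f i x.1 x.2)
    (hdf : ∀ i, Continuous fun x : ℝ × ℝ => df i x.1 x.2)
    (hft : ∀ i, Continuous fun x : ℝ × ℝ => ft i x.1 x.2)
    (hd : ∀ i, ∀ w ∈ spaceI, ∀ t, HasDerivAt (f i w) (ft i w t) t) {T : ℝ} (hT : 0 ≤ T)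
    (htest : ∀ t ∈ Icc 0 T, IsTestPair S (fun i w => f i w t) fun i w => df i w t)
    {G : ℝ → ℝ} (hG : ∀ t, G t =
      (∫ z in spaceI, (u t z * (df 0 z t + ft 0 z t) + b z * v t z * f 0 z t)) +
        lam (-1) * f 0 (-1) t * K.feedbackLeft (u t) (v t) +
      ((∫ z in spaceI, (v t z * (df 1 (-z) t + ft 1 (-z) t) + c z * u t z * f 1 (-z) t)) +
        mu 1 * f 1 (-1) t * K.feedbackRight (u t) (v t))) :
    ContinuousOn G (Ici 0) ∧
      pairing (u T) (fun z => f 0 z T) + pairing (v T) (fun z => f 1 (-z) T) -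
        (pairing (u 0) (fun z => f 0 z 0) + pairing (v 0) (fun z => f 1 (-z) 0)) =
      ∫ t in (0 : ℝ)..T, G t := by
  have hsec : ∀ {g : ℝ → ℝ → ℝ}, (Continuous fun x : ℝ × ℝ => g x.1 x.2) → ∀ t,
      Continuous fun w => g w t := fun hg t => hg.comp (f := fun w => (w, t)) (by fun_prop)
  have hlow := E.continuous_lower_param hf
  have hB := continuous_toState (f := fun j z t => df j z t + E.lower (fun i w => f i w t) j z)
    fun i => (hdf i).add (hlow i)
  have hF := continuous_toState hft
  have hGe : ∀ t, inner ℝ (stateOf (u t) (v t))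
      (toState (fun j z => df j z t + E.lower (fun i w => f i w t) j z) +
        toState fun i w => ft i w t) = G t := fun t => by
    have e : toState (fun j z => df j z t + E.lower (fun i w => f i w t) j z) +
        toState (fun i w => ft i w t) =
        toState fun j z => (df j z t + ft j z t) + E.lower (fun i w => f i w t) j z := by
      rw [← toState_add (p := fun j z => df j z t + E.lower (fun i w => f i w t) j z)
        (q := fun j z => ft j z t)
        (fun j => (hsec (hdf j) t).add (E.continuous_lower (fun i => hsec (hf i) t) j))
        fun j => hsec (hft j) t]
      congr 1
      funext j z
      ring
    rw [e, h.inner_stateOf_adjoint hb hc hK E hE _ _ (q := fun i w => f i w t)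
      (dq := fun j z => df j z t + ft j z t) (fun i => hsec (hf i) t)
      fun i => (hsec (hdf i) t).add (hsec (hft i) t), hG t]
  constructor
  · exact (hX.cont.inner (hB.add hF).continuousOn).congr fun t _ => (hGe t).symm
  · have key := inner_sub_inner_eq_integral hX.cont (hasDerivAt_toState hf hft hd) hF hB hT
      fun t ht τ hτ => hX.weak _ _ ⟨_, _, htest t ht, rfl, rfl⟩ τ hτ
    simp only [hGe] at key
    rw [← key, inner_stateOf (q := fun i w => f i w T) _ _ fun i => hsec (hf i) T,
      inner_stateOf (q := fun i w => f i w 0) _ _ fun i => hsec (hf i) 0]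

lemma isClosedLoopSolution_of_isWeakOrbit (h : SystemData lam mu b c S C)
    (hmu : ContDiffOn ℝ 1 mu spaceI)
    (hb : ContinuousOn b spaceI) (hc : ContinuousOn c spaceI) (hK : K.IsSolution lam mu b c)
    (E : ExtendedKernel S C)
    (hE : ∀ i j z w, (z, w) ∈ kernelDomain → E.M i j z w = K.toMatrix i j z w)
    {u₀ v₀ : L2I} {u v : ℝ → L2I} (hX : IsWeakOrbit E.AdjointGraph fun t => stateOf (u t) (v t))
    (hu0 : u 0 = u₀) (hv0 : v 0 = v₀) : IsClosedLoopSolution lam mu b c K u₀ v₀ u v := by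
  obtain ⟨hu, hv⟩ := continuousOn_stateOf_iff.1 hX.cont
  have hS := S.cont
  have hmu' : ContinuousOn (derivWithin mu spaceI) spaceI :=
    hmu.continuousOn_derivWithin (uniqueDiffOn_Icc (by norm_num)) le_rfl
  obtain ⟨l, hl, hle⟩ : ∃ l : ℝ → ℝ, Continuous l ∧ ∀ w ∈ spaceI, l w = derivWithin lam spaceI w :=
    ⟨_, h.lam_deriv_cont.comp_clampTo, fun w hw => by rw [clampTo_of_mem hw]⟩
  obtain ⟨m, hm, hme⟩ : ∃ m : ℝ → ℝ, Continuous m ∧ ∀ w ∈ spaceI, m w = derivWithin mu spaceI w :=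
    ⟨_, hmu'.comp_clampTo, fun w hw => by rw [clampTo_of_mem hw]⟩
  have hpart : ∀ p : ℝ → ℝ → ℝ, ContDiff ℝ 1 (fun x : ℝ × ℝ => p x.1 x.2) →
      ∃ px pt : ℝ → ℝ → ℝ, (Continuous fun x : ℝ × ℝ => px x.1 x.2) ∧
        (Continuous fun x : ℝ × ℝ => pt x.1 x.2) ∧
        (∀ w t, HasDerivAt (fun x => p x t) (px w t) w) ∧
        ∀ w t, HasDerivAt (fun s => p w s) (pt w t) t := fun p hp => by
    have hc := hp.continuous_fderiv one_ne_zero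
    refine ⟨fun w t => fderiv ℝ (fun x : ℝ × ℝ => p x.1 x.2) (w, t) (1, 0),
      fun w t => fderiv ℝ (fun x : ℝ × ℝ => p x.1 x.2) (w, t) (0, 1),
      hc.clm_apply continuous_const, hc.clm_apply continuous_const, fun w t => ?_, fun w t => ?_⟩
    · exact (hp.differentiable one_ne_zero (w, t)).hasFDerivAt.comp_hasDerivAt w
        ((hasDerivAt_id w).prodMk (hasDerivAt_const w t))
    · exact (hp.differentiable one_ne_zero (w, t)).hasFDerivAt.comp_hasDerivAt t
        ((hasDerivAt_const t w).prodMk (hasDerivAt_id t))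
  have hfl := hK.continuousOn_feedbackLeft hu hv
  have hfr := hK.continuousOn_feedbackRight hu hv
  refine ⟨hu, hv, hu0, hv0, fun T hT p hp hpz => ?_, fun T hT p hp hpz => ?_⟩
  · obtain ⟨px, pt, hpx, hpt, hdx, hdt⟩ := hpart p hp
    have hpc := hp.continuous
    obtain ⟨hG, hGe⟩ := h.weak_timeDependent hb hc hK E hE hX (f := ![p, fun _ _ => 0])
      (df := ![fun w t => l w * p w t + S.v w * px w t, fun _ _ => 0])
      (ft := ![pt, fun _ _ => 0])
      (G := fun t => (∫ w in spaceI,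
          (u t w * (deriv (fun s => p w s) t + lam w * deriv (fun x => p x t) w
              + derivWithin lam spaceI w * p w t)
            + b w * v t w * p w t)) + lam (-1) * p (-1) t * K.feedbackLeft (u t) (v t))
      (Fin.forall_fin_two.2 ⟨hpc, continuous_const⟩)
      (Fin.forall_fin_two.2 ⟨((hl.comp continuous_fst).mul hpc).add
        ((hS.comp continuous_fst).mul hpx), continuous_const⟩)
      (Fin.forall_fin_two.2 ⟨hpt, continuous_const⟩)
      (Fin.forall_fin_two.2 ⟨fun w _ t => hdt w t, fun w _ t => hasDerivAt_const t 0⟩) hT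
      (fun t ht => by
        have h1 : Continuous fun w => p w t := hpc.comp (f := fun w => (w, t)) (by fun_prop)
        have h2 : Continuous fun w => px w t := hpx.comp (f := fun w => (w, t)) (by fun_prop)
        refine ⟨Fin.forall_fin_two.2 ⟨h1, continuous_const⟩,
          Fin.forall_fin_two.2 ⟨(hl.mul h1).add (hS.mul h2), continuous_const⟩,
          Fin.forall_fin_two.2 ⟨fun w hw => ?_, fun w _ => ?_⟩,
          Fin.forall_fin_two.2 ⟨hpz t ht, rfl⟩⟩
        · have := (h.lam_deriv w hw).fun_mul (hdx w t).hasDerivWithinAt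
          rw [← hle w hw, ← h.lam_eq w hw] at this
          exact this.congr (fun x hx => by simp [h.lam_eq x hx]) (by simp [h.lam_eq w hw])
        · simpa using hasDerivWithinAt_const w spaceI (0 : ℝ))
      (fun t => by
        simp only [Matrix.cons_val_zero, Matrix.cons_val_one, mul_zero, zero_mul, add_zero,
          integral_zero]
        congr 1
        refine setIntegral_congr_fun measurableSet_Icc fun w hw => ?_
        simp only [(hdx w t).deriv, (hdt w t).deriv, hle w hw, h.lam_eq w hw]
        ring)
    have hB : ContinuousOn (fun t => lam (-1) * p (-1) t * K.feedbackLeft (u t) (v t)) (Ici 0) :=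
      (Continuous.continuousOn (continuous_const.mul
        (hpc.comp (f := fun t => (-1, t)) (by fun_prop)))).mul hfl
    have hA := hG.fun_sub hB
    simp only [add_sub_cancel_right] at hA
    rw [intervalIntegral.integral_add (hA.intervalIntegrable_of_Ici hT)
      (hB.intervalIntegrable_of_Ici hT)] at hGe
    rw [← hGe, ← hu0]
    simp [pairing]
  · obtain ⟨px, pt, hpx, hpt, hdx, hdt⟩ := hpart p hp
    have hpc := hp.continuous
    have hneg : Continuous fun x : ℝ × ℝ => (-x.1, x.2) := by fun_prop
    obtain ⟨hG, hGe⟩ := h.weak_timeDependent hb hc hK E hE hX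
      (f := ![fun _ _ => 0, fun w t => p (-w) t])
      (df := ![fun _ _ => 0, fun w t => -(m (-w) * p (-w) t + S.v w * px (-w) t)])
      (ft := ![fun _ _ => 0, fun w t => pt (-w) t])
      (G := fun t => (∫ w in spaceI,
          (v t w * (deriv (fun s => p w s) t - mu w * deriv (fun x => p x t) w
              - derivWithin mu spaceI w * p w t)
            + c w * u t w * p w t)) + mu 1 * p 1 t * K.feedbackRight (u t) (v t))
      (Fin.forall_fin_two.2 ⟨continuous_const, hpc.comp hneg⟩)
      (Fin.forall_fin_two.2 ⟨continuous_const, (((hm.comp continuous_fst.neg).mul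
        (hpc.comp hneg)).add ((hS.comp continuous_fst).mul (hpx.comp hneg))).neg⟩)
      (Fin.forall_fin_two.2 ⟨continuous_const, hpt.comp hneg⟩)
      (Fin.forall_fin_two.2 ⟨fun w _ t => hasDerivAt_const t 0, fun w _ t => hdt (-w) t⟩) hT
      (fun t ht => by
        have h1 : Continuous fun w => p (-w) t := hpc.comp (f := fun w => (-w, t)) (by fun_prop)
        have h2 : Continuous fun w => px (-w) t := hpx.comp (f := fun w => (-w, t)) (by fun_prop)
        refine ⟨Fin.forall_fin_two.2 ⟨continuous_const, h1⟩,
          Fin.forall_fin_two.2 ⟨continuous_const,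
            (((hm.comp continuous_neg).mul h1).add (hS.mul h2)).neg⟩,
          Fin.forall_fin_two.2 ⟨fun w _ => ?_, fun w hw => ?_⟩,
          Fin.forall_fin_two.2 ⟨rfl, hpz t ht⟩⟩
        · simpa using hasDerivWithinAt_const w spaceI (0 : ℝ)
        · have hw' := neg_mem_spaceI hw
          have := ((h.mu_deriv (-w) hw').fun_mul (hdx (-w) t).hasDerivWithinAt).scomp w
            (hasDerivWithinAt_neg w spaceI) fun x hx => neg_mem_spaceI hx
          rw [← hme _ hw', ← h.mu_eq _ hw', neg_neg] at this
          refine (this.congr_deriv (by simp)).congr (fun x hx => ?_) ?_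
          · simp [← h.mu_eq _ (neg_mem_spaceI hx)]
          · simp [← h.mu_eq _ hw'])
      (fun t => by
        simp only [Matrix.cons_val_zero, Matrix.cons_val_one, mul_zero, zero_mul, add_zero,
          integral_zero, zero_add, neg_neg]
        congr 1
        refine setIntegral_congr_fun measurableSet_Icc fun w hw => ?_
        simp only [(hdx w t).deriv, (hdt w t).deriv, hme w hw, h.mu_eq w hw]
        ring)
    have hB : ContinuousOn (fun t => mu 1 * p 1 t * K.feedbackRight (u t) (v t)) (Ici 0) :=
      (Continuous.continuousOn (continuous_const.mul
        (hpc.comp (f := fun t => (1, t)) (by fun_prop)))).mul hfr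
    have hA := hG.fun_sub hB
    simp only [add_sub_cancel_right] at hA
    rw [intervalIntegral.integral_add (hA.intervalIntegrable_of_Ici hT)
      (hB.intervalIntegrable_of_Ici hT)] at hGe
    rw [← hGe, ← hv0]
    simp [pairing]

end SystemData

lemma SystemData.phiOf_eq {lam mu b c : ℝ → ℝ} {S : Speed} {C : Fin 2 → ℝ → ℝ}
    (h : SystemData lam mu b c S C) {w : ℝ} (hw : w ∈ spaceI) : phiOf lam w = S.phi w := by
  refine intervalIntegral.integral_congr fun y hy => ?_
  have h0 : (0 : ℝ) ∈ spaceI := by simp [spaceI]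
  simp only [h.lam_eq y (uIcc_subset_Icc h0 hw hy)]

theorem theorem2 (lam mu b c : ℝ → ℝ)
    (hlam : ContDiffOn ℝ 1 lam spaceI) (hmu : ContDiffOn ℝ 1 mu spaceI)
    (hlam_pos : ∀ w ∈ spaceI, 0 < lam w) (hmu_pos : ∀ w ∈ spaceI, 0 < mu w)
    (hb : ContinuousOn b spaceI) (hc : ContinuousOn c spaceI)
    (hcase : ∀ w ∈ spaceI, lam w = mu (-w)) :
    (∃ K : Kernels, K.IsSolution lam mu b c ∧
      ∀ K' : Kernels, K'.IsSolution lam mu b c → K'.AgreeOn K) ∧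
    ∀ K : Kernels, K.IsSolution lam mu b c → ∀ u₀ v₀ : L2I,
      ∃ u v : ℝ → L2I, IsClosedLoopSolution lam mu b c K u₀ v₀ u v ∧
        (∀ u' v' : ℝ → L2I, IsClosedLoopSolution lam mu b c K u₀ v₀ u' v' →
          ∀ t : ℝ, 0 ≤ t → u' t = u t ∧ v' t = v t) ∧
        ∀ t : ℝ, phiOf lam 1 - phiOf lam (-1) ≤ t → u t = 0 ∧ v t = 0 := by
  obtain ⟨S, C, h⟩ := exists_systemData hlam hmu hlam_pos hb hc hcase
  refine ⟨h.exists_unique_kernels, fun K hK u₀ v₀ => ?_⟩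
  obtain ⟨E, hE⟩ := ((h.isSolution_iff K).1 hK).exists_extendedKernel h.cont
  obtain ⟨X, hX0, hX, hun, hex⟩ := E.exists_unique_weakOrbit (stateOf u₀ v₀)
  have hXe : ∀ t, stateOf (X t 0) (reflect (X t 1)) = X t := fun t => stateOf_eta (X t)
  have h0 := stateOf_inj.1 ((hXe 0).trans hX0)
  refine ⟨fun t => X t 0, fun t => reflect (X t 1),
    h.isClosedLoopSolution_of_isWeakOrbit hmu hb hc hK E hE (by simpa only [hXe] using hX)
      h0.1 h0.2, fun u' v' hcl t ht => ?_, fun t ht => ?_⟩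
  · have := hun _ (by simp only [hcl.init_u, hcl.init_v])
      (h.isWeakOrbit_of_isClosedLoopSolution hmu hb hc hK E hE hcl) t ht
    exact stateOf_inj.1 (this.trans (hXe t).symm)
  · rw [h.phiOf_eq (by simp [spaceI]), h.phiOf_eq (by simp [spaceI])] at ht
    simp only [hex t ht, PiLp.zero_apply, map_zero, and_self]
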